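/- Let $d\in\mathbb N$, $d\ge 1$, be squarefree, let $k=\mathbb Q(i\sqrt d)\subset\mathbb C$, and let $\mathfrak o$ be its ring of integers. Let $F$ be a quaternion algebra over $\mathbb Q$ (a central simple $\mathbb Q$-algebra of dimension $4$). An $F$-order is a subring with $1$ of $F$ that is finitely generated as a $\mathbb Z$-module and spans $F$ over $\mathbb Q$; an $F$-maximal order is one that is maximal with respect to inclusion. For an $F$-order $\mathfrak G$ put $\Lambda(\mathfrak G)=[\mathfrak F:\mathfrak G]$, where $\mathfrak F\supseteq\mathfrak G$ is an $F$-maximal order (the index does not depend on the choice of $\mathfrak F$). For a prime $p$ let $F_p=\mathbb Q_p\otimes_{\mathbb Q}F$, $\mathfrak G_p=\mathbb Z_p\mathfrak G\subset F_p$ and $\mathfrak o_p=\mathbb Z_p\mathfrak o\subset\mathbb Q_p\otimes_{\mathbb Q}k$. The $F$-order $\mathfrak G$ is called $\mathfrak o$-compatible if for every prime $p\mid\Lambda(\mathfrak G)$ the ring $\mathfrak G_p$ contains a $\mathbb Z_p$-subalgebra isomorphic to $\mathfrak o_p$. Let $\Sigma_k(F)$ be the product of the primes $p$ at which $F$ is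 ramified (i.e. $F_p$ is a division algebra) and which are split in $k$ (i.e. $p\mathfrak o$ is a product of two distinct prime ideals). Let $I$ be the group of fractional $\mathfrak o$-ideals of $k$ and $N_{abs}:I\to\mathbb Q^{+}$ the absolute norm. Let $\mathfrak F$ be an $F$-maximal order. (i) If $\mathfrak G\subseteq\mathfrak F$ is an $\mathfrak o$-compatible $F$-order, then $\Lambda(\mathfrak G)$ is coprime to $\Sigma_k(F)$ and $\Lambda(\mathfrak G)\in N_{abs}(I)$. (ii) Conversely, if $\lambda\ge 1$ is an integer that is coprime to $\Sigma_k(F)$ and satisfies $\lambda\in N_{abs}(I)$, then there is an $\mathfrak o$-compatible $F$-order $\mathfrak G\subseteq\mathfrak F$ with $\Lambda(\mathfrak G)=\lambda$. (iii) If $\mathfrak G,\mathfrak G'$ are $\mathfrak o$-compatible $F$-orders (not necessarily contained in the same maximal order) with $\Lambda(\mathfrak G)=\Lambda(\mathfrak G')$, then for every prime $p$ the $\mathbb Z_p$-algebras $\mathfrak G_p$ and $\mathfrak G'_p$ are isomorphic. -/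

import Mathlib

open scoped TensorProduct NumberField nonZeroDivisors

noncomputable section

namespace QuatOrder

/-- The imaginary quadratic field `ℚ(i√d)`, as a subfield of `ℂ`. -/
abbrev imagQuad (d : ℕ) : IntermediateField ℚ ℂ :=
  IntermediateField.adjoin ℚ {Complex.I * ((Real.sqrt d : ℝ) : ℂ)}

theorem isIntegral_generator (d : ℕ) :
    IsIntegral ℚ (Complex.I * ((Real.sqrt d : ℝ) : ℂ)) := by
  refine IsIntegral.of_pow (n := 2) two_pos ?_
  have h : (Complex.I * ((Real.sqrt d : ℝ) : ℂ)) ^ 2 = algebraMap ℚ ℂ (-(d : ℚ)) := by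
    have h1 : ((Real.sqrt d : ℝ) : ℂ) ^ 2 = (d : ℂ) := by
      rw [← Complex.ofReal_pow, Real.sq_sqrt (Nat.cast_nonneg d)]
      simp
    rw [mul_pow, h1, Complex.I_sq]
    simp
  rw [h]
  exact isIntegral_algebraMap

instance instFiniteDimensionalImagQuad (d : ℕ) : FiniteDimensional ℚ (imagQuad d) :=
  IntermediateField.adjoin.finiteDimensional (isIntegral_generator d)

instance instNumberFieldImagQuad (d : ℕ) : NumberField (imagQuad d) where
  to_charZero := inferInstance
  to_finiteDimensional := inferInstance

/-- A quaternion algebra over a field: central, simple, of dimension `4`. -/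
structure IsQuaternionAlgebra (K Q : Type*) [Field K] [Ring Q] [Algebra K Q] : Prop where
  isCentral : Algebra.IsCentral K Q
  isSimpleRing : IsSimpleRing Q
  finrank_eq : Module.finrank K Q = 4

section Global

variable {F : Type*} [Ring F] [Algebra ℚ F]

/-- An order of a `ℚ`-algebra: a subring which is a full `ℤ`-lattice. -/
structure IsOrder (G : Subalgebra ℤ F) : Prop where
  fg : (Subalgebra.toSubmodule G).FG
  span_eq_top : Submodule.span ℚ (G : Set F) = ⊤

/-- A maximal order: maximal with respect to inclusion among all orders. -/
def IsMaximalOrder (M : Subalgebra ℤ F) : Prop :=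
  Maximal (fun G : Subalgebra ℤ F => IsOrder G) M

/-- The index `[M : G]` of additive groups, used for orders `G ⊆ M`. -/
def orderIndex (M G : Subalgebra ℤ F) : ℕ :=
  (Subalgebra.toSubmodule G).toAddSubgroup.relIndex (Subalgebra.toSubmodule M).toAddSubgroup

end Global

section Local

variable (p : ℕ) [Fact p.Prime] {A : Type*} [Ring A] [Algebra ℚ A]

/-- The `p`-component `ℤ_p G ⊆ ℚ_p ⊗ A` of a subring `G` of a `ℚ`-algebra `A`. -/
def localComponent (G : Subalgebra ℤ A) : Subalgebra ℤ_[p] (ℚ_[p] ⊗[ℚ] A) :=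
  Algebra.adjoin ℤ_[p]
    ((Algebra.TensorProduct.includeRight : A →ₐ[ℚ] ℚ_[p] ⊗[ℚ] A) '' (G : Set A))

/-- As a `ℤ_p`-module, the `p`-component is spanned by the image of `G`. -/
theorem toSubmodule_localComponent (G : Subalgebra ℤ A) :
    Subalgebra.toSubmodule (localComponent p G) =
      Submodule.span ℤ_[p]
        ((Algebra.TensorProduct.includeRight : A →ₐ[ℚ] ℚ_[p] ⊗[ℚ] A) '' (G : Set A)) := by
  have h : ((Algebra.TensorProduct.includeRight : A →ₐ[ℚ] ℚ_[p] ⊗[ℚ] A) '' (G : Set A)) =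
      ((G.toSubmonoid.map
        (Algebra.TensorProduct.includeRight : A →ₐ[ℚ] ℚ_[p] ⊗[ℚ] A) :
          Submonoid (ℚ_[p] ⊗[ℚ] A)) : Set (ℚ_[p] ⊗[ℚ] A)) := rfl
  rw [localComponent, Algebra.adjoin_eq_span, h, Submonoid.closure_eq]

variable (A) in
/-- A quaternion algebra over `ℚ` is ramified at the prime `p` if its `p`-component `ℚ_p ⊗ A` is a
division algebra. -/
def IsRamifiedAt : Prop :=
  ∀ x : ℚ_[p] ⊗[ℚ] A, x ≠ 0 → IsUnit x

end Local

/-- The prime `p` is split in `ℚ(i√d)`: `(p)` is a product of two distinct prime ideals. -/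
def IsSplitAt (d p : ℕ) : Prop :=
  ∃ P Q : Ideal (𝓞 (imagQuad d)), P.IsPrime ∧ Q.IsPrime ∧ P ≠ Q ∧
    Ideal.span {(p : 𝓞 (imagQuad d))} = P * Q

/-- The primes at which `F` is ramified and which are split in `ℚ(i√d)`. (The infinite place of `ℚ`
is never split in `ℚ(i√d)`.) -/
def ramifiedSplitPrimes (d : ℕ) (F : Type*) [Ring F] [Algebra ℚ F] : Set ℕ :=
  {p : ℕ | ∃ _ : Fact p.Prime, IsRamifiedAt p F ∧ IsSplitAt d p}

/-- `Σ_k(F)`: the product of the ramified places of `F` that are split in `k = ℚ(i√d)`. -/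
def sigmaK (d : ℕ) (F : Type*) [Ring F] [Algebra ℚ F] : ℕ :=
  ∏ᶠ p ∈ ramifiedSplitPrimes d F, p

/-- An order `G` of `F` is `𝔬`-compatible, `𝔬` being the ring of integers of `ℚ(i√d)`, if for all
primes `p` dividing its index in a maximal order, `G_p` contains an order isomorphic to `𝔬_p`. -/
structure IsCompatible {F : Type*} [Ring F] [Algebra ℚ F] (d : ℕ) (G : Subalgebra ℤ F) :
    Prop where
  isOrder : IsOrder G
  exists_le : ∀ M : Subalgebra ℤ F, IsMaximalOrder M → G ≤ M →
    ∀ (p : ℕ) [Fact p.Prime], p ∣ orderIndex M G →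
      ∃ O : Subalgebra ℤ_[p] (ℚ_[p] ⊗[ℚ] F), O ≤ localComponent p G ∧
        Nonempty (O ≃ₐ[ℤ_[p]] localComponent p (integralClosure ℤ (imagQuad d)))

/-- `x` lies in `N_abs(I)`, with `I` the group of (fractional) ideals of `ℚ(i√d)`. -/
def IsAbsNormOfIdeal (d : ℕ) (x : ℚ) : Prop :=
  ∃ J : (FractionalIdeal (𝓞 (imagQuad d))⁰ (imagQuad d))ˣ,
    FractionalIdeal.absNorm (J : FractionalIdeal (𝓞 (imagQuad d))⁰ (imagQuad d)) = x

end QuatOrder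

end

/-! ### Arithmetic in `ℤ_p`: Hensel's lemma and quadratic polynomials irreducible modulo `p`. -/

noncomputable section
namespace QuatOrder

section PadicArithmetic

variable {p : ℕ} [Fact p.Prime]

/-! The theorem is decided prime by prime. The ring of integers is `ℤ[θ]` with `θ` a root of some `f
= X² - tX + n` (`exists_generator_ringOfIntegers`), and a `ℤ_p`-order contains a copy of `𝔬_p`
exactly when it contains a non-scalar root of `f` (`IsIntegralGenerator.exists_subalgebra_iff`). The
behaviour of `p` in `k` is read off from `f` modulo `p` (`IsInertPoly`, `IsSplitPoly`), and
`IsMaximalPoly` records that `R = ℤ_p[θ]` is integrally closed. The `p`-part of a global index is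
the index of the `p`-components (`padicIndex_localComponent`), whose maximality is inherited from
the global order.

Locally there are two cases. If `F_p` is a division algebra, its only maximal order is the valuation
ring of the reduced norm; it contains a root of `f` whenever `f` is non-split, and no non-scalar
root of a split `f`. Otherwise `F_p` is a matrix algebra, every maximal order is conjugate to the
integral matrices, and every `f` has a root there, which can be normalised to the companion matrix
because `R` is integrally closed. In both cases a maximal order `M` containing a root has the form
`R ⊕ R y` (`IsMaximalPadicOrder.exists_cyclic_generator`).

Part (i). A prime dividing the index gives a root of `f` in `F_p`, so it cannot be both ramified in
`F` and split in `k`. A positive integer is a norm of a fractional ideal exactly when its valuation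
at every inert prime is even. At an inert prime, left multiplication by the root makes `M / G` a
group whose order has even valuation; the same counting argument (`even_factorization_card`) applies
to quotients of the ring of integers by ideals.

Part (ii). For `ρ` in `R` the order `R + ρM` has index `[R : ρR]` in `M`, and these indices realise
every power of `p` allowed by the parity condition. The local orders chosen at the primes dividing
`λ` are glued to a global one (`localComponent_glue`).

Part (iii). An order `G` with `R ⊆ G ⊆ M` equals `R + 𝔞 y` for an ideal `𝔞` of `R` with `[M : G] =
[R : 𝔞]`. If `f` is non-split, the ideals of `R` form a chain, so the index determines `G` inside
`M`, and the pairs `(M, θ)` are all conjugate. If `f` is split, `R` contains the diagonal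
idempotents of a matrix algebra, and `G` is conjugate to the Eichler order whose level is its index.
At primes not dividing the index both orders are maximal, hence conjugate. -/

theorem padicInt_dvd_iff_norm_lt_one (x : ℤ_[p]) : (p : ℤ_[p]) ∣ x ↔ ‖x‖ < 1 := by
  rw [PadicInt.norm_lt_one_iff_dvd]

theorem padicInt_isUnit_iff_not_dvd (x : ℤ_[p]) : IsUnit x ↔ ¬ (p : ℤ_[p]) ∣ x := by
  rw [padicInt_dvd_iff_norm_lt_one, PadicInt.isUnit_iff, not_lt]
  exact ⟨fun h => h.ge, fun h => le_antisymm (PadicInt.norm_le_one x) h⟩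

theorem prime_padicInt : Prime (p : ℤ_[p]) := PadicInt.prime_p

/-- Hensel's lemma for quadratic polynomials. -/
theorem exists_root_quadratic (a b c x : ℤ_[p])
    (h0 : (p : ℤ_[p]) ∣ a * x ^ 2 + b * x + c) (h1 : ¬ (p : ℤ_[p]) ∣ 2 * a * x + b) :
    ∃ z : ℤ_[p], a * z ^ 2 + b * z + c = 0 ∧ (p : ℤ_[p]) ∣ z - x := by
  have hu : ‖2 * a * x + b‖ = 1 := by
    rw [← PadicInt.isUnit_iff, padicInt_isUnit_iff_not_dvd]; exact h1
  set P : Polynomial ℤ_[p] := .C a * .X ^ 2 + .C b * .X + .C c with hP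
  have e0 : ∀ z, Polynomial.aeval z P = a * z ^ 2 + b * z + c := by
    intro z; simp [hP]
  have e1 : Polynomial.aeval x P.derivative = 2 * a * x + b := by
    simp [hP]; ring
  obtain ⟨z, hz, hzx, -⟩ := hensels_lemma (F := P) (a := x) (by
    rw [e0, e1, hu]
    simpa using (padicInt_dvd_iff_norm_lt_one _).1 h0)
  refine ⟨z, by rw [← e0]; exact hz, ?_⟩
  rw [padicInt_dvd_iff_norm_lt_one]
  rwa [e1, hu] at hzx

/-- A monic quadratic polynomial with integral constant term and nonintegral linear term has a
root. -/
theorem exists_root_of_one_lt_norm (t n : ℚ_[p]) (hn : ‖n‖ ≤ 1) (ht : 1 < ‖t‖) :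
    ∃ r : ℚ_[p], r ^ 2 - t * r + n = 0 := by
  have ht0 : t ≠ 0 := by rintro rfl; simp at ht; linarith
  have hinv : ‖t⁻¹‖ < 1 := by rw [norm_inv]; exact inv_lt_one_of_one_lt₀ ht
  obtain ⟨a, ha⟩ : ∃ a : ℤ_[p], (a : ℚ_[p]) = t⁻¹ := ⟨⟨t⁻¹, hinv.le⟩, rfl⟩
  obtain ⟨c, hc⟩ : ∃ c : ℤ_[p], (c : ℚ_[p]) = n * t⁻¹ :=
    ⟨⟨n * t⁻¹, by rw [norm_mul]; exact mul_le_one₀ hn (norm_nonneg _) hinv.le⟩, rfl⟩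
  -- Divided by `t`, the polynomial becomes `t⁻¹X² - X + n t⁻¹`, which reduces to `-X` modulo `p`
  -- and has the simple root `0` there.
  obtain ⟨z, hz, -⟩ := exists_root_quadratic a (-1) c 0 (by
    rw [padicInt_dvd_iff_norm_lt_one, PadicInt.norm_def]
    have : (((a * 0 ^ 2 + -1 * 0 + c : ℤ_[p])) : ℚ_[p]) = n * t⁻¹ := by simp [hc]
    rw [this, norm_mul, norm_inv]
    calc ‖n‖ * ‖t‖⁻¹ ≤ 1 * ‖t‖⁻¹ := by gcongr
      _ < 1 := by simpa using hinv) (by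
    rw [← padicInt_isUnit_iff_not_dvd]; simp)
  refine ⟨z, ?_⟩
  have := congrArg (fun y : ℤ_[p] => (y : ℚ_[p])) hz
  have h2 : t⁻¹ * (z : ℚ_[p]) ^ 2 + -1 * z + n * t⁻¹ = 0 := by
    simpa [ha, hc] using this
  linear_combination t * h2 - ((z : ℚ_[p]) ^ 2 + n) * mul_inv_cancel₀ ht0

/-- The polynomial `X² - sX + r` has no root modulo `p`. -/
def IsInertPoly (s r : ℤ_[p]) : Prop := ∀ c : ℤ_[p], ¬ (p : ℤ_[p]) ∣ c ^ 2 - s * c + r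

/-- The norm form is anisotropic modulo `p`: if `b` were a unit, `-a / b` would be a root of the
polynomial modulo `p`. -/
theorem IsInertPoly.dvd_of_dvd_norm {s r : ℤ_[p]} (h : IsInertPoly s r) {a b : ℤ_[p]}
    (hab : (p : ℤ_[p]) ∣ a ^ 2 + s * a * b + r * b ^ 2) :
    (p : ℤ_[p]) ∣ a ∧ (p : ℤ_[p]) ∣ b := by
  by_cases hb : (p : ℤ_[p]) ∣ b
  · refine ⟨?_, hb⟩
    have : (p : ℤ_[p]) ∣ a ^ 2 := by
      have h2 : (p : ℤ_[p]) ∣ s * a * b + r * b ^ 2 := by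
        refine dvd_add (hb.mul_left _) ((dvd_pow hb two_ne_zero).mul_left _)
      have := dvd_sub hab h2
      convert this using 1; ring
    exact prime_padicInt.dvd_of_dvd_pow this
  · exfalso
    obtain ⟨u, hu⟩ := (padicInt_isUnit_iff_not_dvd b).2 hb
    apply h (-(a * ↑u⁻¹))
    have : (-(a * ↑u⁻¹)) ^ 2 - s * (-(a * ↑u⁻¹)) + r
        = (a ^ 2 + s * a * b + r * b ^ 2) * (↑u⁻¹ : ℤ_[p]) ^ 2 := by
      have hub : b * (↑u⁻¹ : ℤ_[p]) = 1 := by rw [← hu]; simp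
      linear_combination (-(s * a * (↑u⁻¹ : ℤ_[p])) - r * (1 + b * ↑u⁻¹)) * hub
    rw [this]
    exact hab.mul_right _

theorem not_dvd_two_of_odd (hp : p ≠ 2) : ¬ (p : ℤ_[p]) ∣ 2 := by
  intro h
  have : (p : ℤ) ∣ 2 := by
    have := (PadicInt.norm_int_lt_one_iff_dvd (p := p) 2).1 (by
      simpa using (padicInt_dvd_iff_norm_lt_one _).1 h)
    simpa using this
  have h2 := (Nat.prime_dvd_prime_iff_eq (Fact.out : p.Prime) Nat.prime_two).1 (by exact_mod_cast this)
  exact hp h2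

theorem padicInt_dvd_iff_toZMod (x : ℤ_[p]) : (p : ℤ_[p]) ∣ x ↔ PadicInt.toZMod x = 0 := by
  rw [← RingHom.mem_ker, PadicInt.ker_toZMod, PadicInt.maximalIdeal_eq_span_p,
    Ideal.mem_span_singleton]

theorem exists_toZMod_eq (x : ZMod p) : ∃ y : ℤ_[p], PadicInt.toZMod y = x := by
  obtain ⟨y, rfl⟩ := ZMod.natCast_zmod_surjective x
  exact ⟨y, by simp⟩

theorem zmod_two_sub_one : ∀ x : ZMod 2, x ≠ 0 → x - 1 = 0 := by decide

/-- The only irreducible quadratic polynomial over `𝔽_2` is `X² + X + 1`. -/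
theorem exists_norm_mod_two_odd {s r : ℤ_[2]} (h : IsInertPoly s r) : ¬ (2 : ℤ_[2]) ∣ s ∧ ¬ (2 : ℤ_[2]) ∣ r := by
  have h0 := h 0
  have h1 := h 1
  simp only [padicInt_dvd_iff_toZMod] at h0 h1
  have e2 : ∀ x : ℤ_[2], (2 : ℤ_[2]) ∣ x ↔ PadicInt.toZMod x = 0 := by
    intro x; exact_mod_cast padicInt_dvd_iff_toZMod (p := 2) x
  rw [e2, e2]
  simp at h0 h1
  generalize PadicInt.toZMod s = s' at *
  generalize PadicInt.toZMod r = r' at *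
  revert s' r'; decide

/-- The norm form of an inert polynomial represents all units modulo `p`. -/
theorem exists_norm_mod {s r : ℤ_[p]} (h : IsInertPoly s r) (u : ℤ_[p]) :
    ∃ a b : ℤ_[p], (p : ℤ_[p]) ∣ a ^ 2 + s * a * b + r * b ^ 2 - u := by
  by_cases hp : p = 2
  · subst hp
    -- Modulo `2` every element is its own square.
    refine ⟨u, 0, ?_⟩
    rw [padicInt_dvd_iff_toZMod]
    simp
  · have h2 := not_dvd_two_of_odd hp
    have h4 : ¬ (p : ℤ_[p]) ∣ 4 := by
      intro h; apply h2
      have : (4 : ℤ_[p]) = 2 ^ 2 := by norm_num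
      rw [this] at h
      exact prime_padicInt.dvd_of_dvd_pow h
    rw [padicInt_dvd_iff_toZMod] at h2 h4
    set s' := PadicInt.toZMod s with hs
    set r' := PadicInt.toZMod r with hr
    set u' := PadicInt.toZMod u with hu
    have two : (2 : ZMod p) ≠ 0 := by simpa only [map_ofNat] using h2
    have hd : s' ^ 2 - 4 * r' ≠ 0 := by
      intro h0
      obtain ⟨i, hi⟩ := exists_toZMod_eq (p := p) (2⁻¹)
      apply h (s * i)
      rw [padicInt_dvd_iff_toZMod]
      simp [hi, ← hs, ← hr]
      field_simp
      linear_combination (-1 : ZMod p) * h0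
    -- Four times the norm form is `(2a + sb)² - (s² - 4r) b²`, so it suffices to solve `x² - 4u =
    -- (s² - 4r) y²` over `𝔽_p`.
    obtain ⟨x, y, hxy⟩ := FiniteField.exists_root_sum_quadratic (R := ZMod p)
      (f := Polynomial.X ^ 2 - Polynomial.C (4 * u'))
      (g := Polynomial.C (-(s' ^ 2 - 4 * r')) * Polynomial.X ^ 2) (by
        rw [Polynomial.degree_X_pow_sub_C (by norm_num)]; rfl) (by
        rw [Polynomial.degree_C_mul_X_pow 2 (neg_ne_zero.2 hd)]; rfl) (by
        rw [ZMod.card]; exact Nat.Prime.mod_two_eq_one_iff_ne_two Fact.out |>.2 hp)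
    simp at hxy
    obtain ⟨a, ha⟩ := exists_toZMod_eq (p := p) ((x - s' * y) / 2)
    obtain ⟨b, hb⟩ := exists_toZMod_eq (p := p) y
    refine ⟨a, b, ?_⟩
    rw [padicInt_dvd_iff_toZMod]
    simp [ha, hb, ← hs, ← hr, ← hu]
    field_simp
    linear_combination hxy

theorem IsInertPoly.not_dvd_disc {s r : ℤ_[p]} (h : IsInertPoly s r) :
    ¬ (p : ℤ_[p]) ∣ s ^ 2 - 4 * r := by
  intro hd
  by_cases hp : p = 2
  · subst hp
    apply (exists_norm_mod_two_odd h).1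
    have : (2 : ℤ_[2]) ∣ s ^ 2 := by
      have h2 : (2 : ℤ_[2]) ∣ 4 * r := ⟨2 * r, by ring⟩
      have := dvd_add (by exact_mod_cast hd) h2
      simpa using this
    have := prime_padicInt (p := 2).dvd_of_dvd_pow (by exact_mod_cast this)
    exact_mod_cast this
  · have h2 := not_dvd_two_of_odd hp
    obtain ⟨i, hi⟩ := (padicInt_isUnit_iff_not_dvd (2 : ℤ_[p])).2 h2
    apply h (s * ↑i⁻¹)
    have e : (2 : ℤ_[p]) * ↑i⁻¹ = 1 := by rw [← hi]; simp
    have : (s * ↑i⁻¹) ^ 2 - s * (s * ↑i⁻¹) + r = (s ^ 2 - 4 * r) * (-(↑i⁻¹ : ℤ_[p]) ^ 2) := by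
      linear_combination (-(s ^ 2) * (↑i⁻¹ : ℤ_[p]) - r * (1 + 2 * ↑i⁻¹) + s ^ 2 * ↑i⁻¹ + s ^ 2 * ↑i⁻¹ ) * e
    rw [this]
    exact hd.mul_right _

/-- Every unit is a norm from the unramified quadratic extension. -/
theorem IsInertPoly.exists_norm_eq {s r : ℤ_[p]} (h : IsInertPoly s r) {u : ℤ_[p]}
    (hu : IsUnit u) : ∃ a b : ℤ_[p], a ^ 2 + s * a * b + r * b ^ 2 = u := by
  obtain ⟨a, b, hab⟩ := exists_norm_mod h u
  -- The two conditions concern the partial derivatives of the norm form. Hensel's lemma applies in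
  -- a variable whose derivative is a unit; if neither is, then `p` divides `a` and `b` because the
  -- discriminant is a unit, and hence divides `u`.
  by_cases h1 : (p : ℤ_[p]) ∣ 2 * a + s * b
  · by_cases h2 : (p : ℤ_[p]) ∣ 2 * r * b + s * a
    · exfalso
      rw [padicInt_isUnit_iff_not_dvd] at hu
      apply hu
      have hb : (p : ℤ_[p]) ∣ (s ^ 2 - 4 * r) * b := by
        have := dvd_sub (h1.mul_left s) (h2.mul_left 2)
        convert this using 1; ring
      have hb := (prime_padicInt.dvd_or_dvd hb).resolve_left h.not_dvd_disc
      have ha : (p : ℤ_[p]) ∣ (s ^ 2 - 4 * r) * a := by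
        have := dvd_sub (h2.mul_left s) (h1.mul_left (2 * r))
        convert this using 1; ring
      have ha := (prime_padicInt.dvd_or_dvd ha).resolve_left h.not_dvd_disc
      have : (p : ℤ_[p]) ∣ a ^ 2 + s * a * b + r * b ^ 2 :=
        dvd_add (dvd_add (dvd_pow ha two_ne_zero) (hb.mul_left _))
          ((dvd_pow hb two_ne_zero).mul_left _)
      have := dvd_sub this hab
      simpa using this
    · obtain ⟨z, hz, -⟩ := exists_root_quadratic r (s * a) (a ^ 2 - u) b
        (by convert hab using 1; ring) (by exact h2)
      exact ⟨a, z, by linear_combination hz⟩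
  · obtain ⟨z, hz, -⟩ := exists_root_quadratic 1 (s * b) (r * b ^ 2 - u) a
        (by convert hab using 1; ring) (by simpa using h1)
    exact ⟨z, b, by linear_combination hz⟩

/-- Discriminants of inert polynomials agree up to squares. -/
theorem IsInertPoly.exists_disc_eq {s r t n : ℤ_[p]} (h : IsInertPoly s r) (h' : IsInertPoly t n) :
    ∃ m : ℤ_[p], m ^ 2 * (s ^ 2 - 4 * r) = t ^ 2 - 4 * n := by
  obtain ⟨D, hD⟩ := (padicInt_isUnit_iff_not_dvd _).2 h.not_dvd_disc
  by_cases hp : p = 2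
  · subst hp
    obtain ⟨hs, hr⟩ := exists_norm_mod_two_odd h
    obtain ⟨ht, hn⟩ := exists_norm_mod_two_odd h'
    have odd : ∀ x : ℤ_[2], ¬ (2 : ℤ_[2]) ∣ x → ∃ y, x = 1 + 2 * y := by
      intro x hx
      have : (2 : ℤ_[2]) ∣ x - 1 := by
        have e2 : ∀ x : ℤ_[2], (2 : ℤ_[2]) ∣ x ↔ PadicInt.toZMod x = 0 := by
          intro x; exact_mod_cast padicInt_dvd_iff_toZMod (p := 2) x
        rw [e2] at hx ⊢
        rw [map_sub, map_one]
        exact zmod_two_sub_one _ hx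
      obtain ⟨y, hy⟩ := this
      exact ⟨y, by linear_combination hy⟩
    have tri : ∀ y : ℤ_[2], ∃ z, y ^ 2 + y = 2 * z := by
      intro y
      by_cases hy : (2 : ℤ_[2]) ∣ y
      · obtain ⟨z, rfl⟩ := hy
        exact ⟨2 * z ^ 2 + z, by ring⟩
      · obtain ⟨z, rfl⟩ := odd y hy
        exact ⟨2 * z ^ 2 + 3 * z + 1, by ring⟩
    -- Both discriminants are `5` modulo `8`, so their quotient is `1` modulo `8` and therefore a
    -- square.
    have key : ∀ s r : ℤ_[2], ¬ (2 : ℤ_[2]) ∣ s → ¬ (2 : ℤ_[2]) ∣ r →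
        ∃ y, s ^ 2 - 4 * r = 5 + 8 * y := by
      intro s r hs hr
      obtain ⟨x, rfl⟩ := odd s hs
      obtain ⟨y, rfl⟩ := odd r hr
      obtain ⟨z, hz⟩ := tri x
      exact ⟨z - y - 1, by linear_combination 4 * hz⟩
    obtain ⟨x, hx⟩ := key s r hs hr
    obtain ⟨y, hy⟩ := key t n ht hn
    have e : (D : ℤ_[2]) * ↑D⁻¹ = 1 := by simp
    -- the quotient is `1 + 8 q`, and `1 + 8 q = (1 + 2 z) ^ 2` with `z ^ 2 + z = 2 q`
    obtain ⟨z, hz, -⟩ := exists_root_quadratic (p := 2) 1 1 (-(2 * ((y - x) * ↑D⁻¹))) 0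
      (by
        have : (2 : ℤ_[2]) ∣ 1 * 0 ^ 2 + 1 * 0 + -(2 * ((y - x) * ↑D⁻¹)) :=
          ⟨-((y - x) * ↑D⁻¹), by ring⟩
        exact_mod_cast this)
      (by rw [← padicInt_isUnit_iff_not_dvd]; simp)
    refine ⟨1 + 2 * z, ?_⟩
    rw [hy]
    rw [hx] at hD ⊢
    rw [← hD]
    linear_combination 4 * (D : ℤ_[2]) * hz + 8 * (y - x) * e + hD
  · have h2 := not_dvd_two_of_odd hp
    have nsq : ∀ {s r : ℤ_[p]}, IsInertPoly s r →
        ¬ IsSquare (PadicInt.toZMod (s ^ 2 - 4 * r)) := by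
      rintro s r h ⟨x, hx⟩
      obtain ⟨x, rfl⟩ := exists_toZMod_eq x
      obtain ⟨i, hi⟩ := (padicInt_isUnit_iff_not_dvd (2 : ℤ_[p])).2 h2
      have e : (2 : ℤ_[p]) * ↑i⁻¹ = 1 := by rw [← hi]; simp
      apply h ((s + x) * ↑i⁻¹)
      have hd : (p : ℤ_[p]) ∣ (s ^ 2 - 4 * r) - x ^ 2 := by
        rw [padicInt_dvd_iff_toZMod, map_sub, hx]; simp [sq]
      have : ((s + x) * ↑i⁻¹) ^ 2 - s * ((s + x) * ↑i⁻¹) + r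
          = ((s ^ 2 - 4 * r) - x ^ 2) * (-(↑i⁻¹ : ℤ_[p]) ^ 2) := by
        linear_combination (s * (s + x) * (↑i⁻¹ : ℤ_[p]) - r * (1 + 2 * ↑i⁻¹)) * e
      rw [this]
      exact hd.mul_right _
    -- Both discriminants are non-squares modulo the odd prime `p`, so the quadratic character of
    -- their product is `1`.
    have hsq : IsSquare (PadicInt.toZMod (s ^ 2 - 4 * r) * PadicInt.toZMod (t ^ 2 - 4 * n)) := by
      have h1 := (quadraticChar_neg_one_iff_not_isSquare (F := ZMod p)).2 (nsq h)
      have h3 := (quadraticChar_neg_one_iff_not_isSquare (F := ZMod p)).2 (nsq h')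
      have hne : PadicInt.toZMod (s ^ 2 - 4 * r) * PadicInt.toZMod (t ^ 2 - 4 * n) ≠ 0 := by
        apply mul_ne_zero
        · rw [Ne, ← padicInt_dvd_iff_toZMod]; exact h.not_dvd_disc
        · rw [Ne, ← padicInt_dvd_iff_toZMod]; exact h'.not_dvd_disc
      rw [← quadraticChar_one_iff_isSquare hne, map_mul, h1, h3]; norm_num
    obtain ⟨x, hx⟩ := hsq
    obtain ⟨x, rfl⟩ := exists_toZMod_eq x
    have hd : (p : ℤ_[p]) ∣ x ^ 2 - (s ^ 2 - 4 * r) * (t ^ 2 - 4 * n) := by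
      rw [padicInt_dvd_iff_toZMod, map_sub, map_mul, hx]; simp [sq]
    obtain ⟨z, hz, -⟩ := exists_root_quadratic 1 0 (-((s ^ 2 - 4 * r) * (t ^ 2 - 4 * n))) x
      (by convert hd using 1; ring) (by
        intro h3
        have h3 : (p : ℤ_[p]) ∣ 2 * x := by simpa using h3
        have hx' := (prime_padicInt.dvd_or_dvd h3).resolve_left h2
        have := dvd_sub (dvd_pow hx' two_ne_zero) hd
        simp at this
        rcases prime_padicInt.dvd_or_dvd this with h4 | h4
        · exact h.not_dvd_disc h4
        · exact h'.not_dvd_disc h4)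
    have e : (D : ℤ_[p]) * ↑D⁻¹ = 1 := by simp
    refine ⟨z * ↑D⁻¹, ?_⟩
    rw [← hD] at hz ⊢
    linear_combination (D : ℤ_[p]) * (↑D⁻¹ : ℤ_[p]) ^ 2 * hz +
      (t ^ 2 - 4 * n) * (1 + D * (↑D⁻¹ : ℤ_[p])) * e

end PadicArithmetic
end QuatOrder
end

/-! ### The quadratic orders `ℤ_p[X]/(X² - tX + n)` and their ideals. -/

noncomputable section
namespace QuatOrder

section QuadraticOrder

variable {p : ℕ} [Fact p.Prime]

/-- `ℤ_p[X]/(X² - tX + n)` is a maximal order. -/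
def IsMaximalPoly (t n : ℤ_[p]) : Prop :=
  ∀ c : ℤ_[p], (p : ℤ_[p]) ∣ 2 * c - t → ¬ (p : ℤ_[p]) ^ 2 ∣ c ^ 2 - t * c + n

/-- `X² - tX + n` has a simple root modulo `p`. -/
def IsSplitPoly (t n : ℤ_[p]) : Prop :=
  ∃ c : ℤ_[p], (p : ℤ_[p]) ∣ c ^ 2 - t * c + n ∧ ¬ (p : ℤ_[p]) ∣ 2 * c - t

/-- The ring `ℤ_p[X]/(X² - tX + n)`. -/
abbrev QuadOrder (t n : ℤ_[p]) := QuadraticAlgebra ℤ_[p] (-n) t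

/-- This provides an element `θ - c` whose norm `f(c)` has valuation exactly one. Maximality gives
it at a double root modulo `p`; at a simple root, replacing `c` by `c + p` changes `f(c)` by `p
f'(c)` modulo `p²`. -/
theorem exists_dvd_not_sq_dvd {t n : ℤ_[p]} (hm : IsMaximalPoly t n) (hi : ¬ IsInertPoly t n) :
    ∃ c : ℤ_[p], (p : ℤ_[p]) ∣ c ^ 2 - t * c + n ∧ ¬ (p : ℤ_[p]) ^ 2 ∣ c ^ 2 - t * c + n := by
  simp only [IsInertPoly, not_forall, not_not] at hi
  obtain ⟨c, hc⟩ := hi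
  by_cases h : (p : ℤ_[p]) ∣ 2 * c - t
  · exact ⟨c, hc, hm c h⟩
  · by_cases h2 : (p : ℤ_[p]) ^ 2 ∣ c ^ 2 - t * c + n
    · have e : (c + p) ^ 2 - t * (c + p) + n = (c ^ 2 - t * c + n) + p * ((2 * c - t) + p) := by
        ring
      refine ⟨c + p, ?_, ?_⟩
      · rw [e]; exact dvd_add hc (dvd_mul_right _ _)
      · rw [e, dvd_add_right h2, sq, mul_dvd_mul_iff_left prime_padicInt.ne_zero,
          dvd_add_left dvd_rfl]
        exact h
    · exact ⟨c, hc, h2⟩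

theorem exists_eq_p_mul_unit {x : ℤ_[p]} (h : (p : ℤ_[p]) ∣ x) (h2 : ¬ (p : ℤ_[p]) ^ 2 ∣ x) :
    ∃ u : ℤ_[p], IsUnit u ∧ x = p * u := by
  obtain ⟨u, rfl⟩ := h
  refine ⟨u, ?_, rfl⟩
  rw [padicInt_isUnit_iff_not_dvd]
  intro h; exact h2 (by rw [sq]; exact mul_dvd_mul_left _ h)

theorem padicInt_exists_pow_mul_unit {x : ℤ_[p]} (hx : x ≠ 0) :
    ∃ (k : ℕ) (u : ℤ_[p]), IsUnit u ∧ x = p ^ k * u :=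
  ⟨x.valuation, PadicInt.unitCoeff hx, Units.isUnit _, by
    rw [mul_comm]; exact PadicInt.unitCoeff_spec hx⟩

/-- Two elements of `ℤ_p`, not both zero, have a power of `p` as a greatest common divisor. -/
theorem padicInt_exists_pow_mul_pair {x y : ℤ_[p]} (h : x ≠ 0 ∨ y ≠ 0) :
    ∃ (k : ℕ) (x' y' : ℤ_[p]), x = p ^ k * x' ∧ y = p ^ k * y' ∧ (IsUnit x' ∨ IsUnit y') := by
  by_cases hx : x = 0
  · obtain ⟨k, u, hu, rfl⟩ := padicInt_exists_pow_mul_unit (h.resolve_left (not_not.2 hx))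
    exact ⟨k, 0, u, by simp [hx], rfl, .inr hu⟩
  by_cases hy : y = 0
  · obtain ⟨k, u, hu, rfl⟩ := padicInt_exists_pow_mul_unit hx
    exact ⟨k, u, 0, rfl, by simp [hy], .inl hu⟩
  obtain ⟨k, u, hu, rfl⟩ := padicInt_exists_pow_mul_unit hx
  obtain ⟨l, v, hv, rfl⟩ := padicInt_exists_pow_mul_unit hy
  rcases le_total k l with hkl | hkl
  · exact ⟨k, u, p ^ (l - k) * v, rfl, by rw [← mul_assoc, ← pow_add, Nat.add_sub_cancel' hkl],
      .inl hu⟩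
  · exact ⟨l, p ^ (k - l) * u, v, by rw [← mul_assoc, ← pow_add, Nat.add_sub_cancel' hkl], rfl,
      .inr hv⟩

open QuadraticAlgebra in
theorem quadOrder_isUnit_iff {t n : ℤ_[p]} (x : QuadOrder t n) :
    IsUnit x ↔ ¬ (p : ℤ_[p]) ∣ x.re ^ 2 + t * x.re * x.im + n * x.im ^ 2 := by
  rw [isUnit_iff_norm_isUnit, padicInt_isUnit_iff_not_dvd, norm_def]
  have : x.re * x.re + t * x.re * x.im - -n * x.im * x.im
    = x.re ^ 2 + t * x.re * x.im + n * x.im ^ 2 := by ring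
  rw [this]

/-- In the local maximal order of a nonsplit quadratic algebra every element is, up to a unit,
a power of `p`, or a power of `p` times a fixed divisor of `p`. -/
theorem quadOrder_normal_form {t n : ℤ_[p]} (hm : IsMaximalPoly t n) (hs : ¬ IsSplitPoly t n) :
    ∃ π : QuadOrder t n, π ∣ (p : QuadOrder t n) ∧ ∀ x : QuadOrder t n, x ≠ 0 →
      ∃ (k : ℕ) (u : QuadOrder t n), IsUnit u ∧ (x = p ^ k * u ∨ x = p ^ k * (π * u)) := by
  by_cases hi : IsInertPoly t n
  · refine ⟨1, one_dvd _, fun x hx => ?_⟩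
    have : x.re ≠ 0 ∨ x.im ≠ 0 := by
      by_contra! h; exact hx (QuadraticAlgebra.ext h.1 h.2)
    obtain ⟨k, a, b, ha, hb, hu⟩ := padicInt_exists_pow_mul_pair this
    refine ⟨k, ⟨a, b⟩, ?_, .inl ?_⟩
    · rw [quadOrder_isUnit_iff]
      intro h
      have := hi.dvd_of_dvd_norm h
      simp only [padicInt_isUnit_iff_not_dvd] at hu
      tauto
    · have e : ((p : QuadOrder t n) ^ k) = algebraMap ℤ_[p] _ ((p : ℤ_[p]) ^ k) := by simp
      rw [e, ← Algebra.smul_def]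
      ext <;> simp [ha, hb]
  · obtain ⟨c, hc, hc2⟩ := exists_dvd_not_sq_dvd hm hi
    have hd : (p : ℤ_[p]) ∣ 2 * c - t := by
      by_contra h; exact hs ⟨c, hc, h⟩
    obtain ⟨u, hu, huc⟩ := exists_eq_p_mul_unit hc hc2
    obtain ⟨v, hv⟩ := hu.exists_right_inv
    -- The second factor is `u⁻¹` times the conjugate of `θ - c`, whose norm is `f(c) = p u`.
    have hpi : (⟨-c, 1⟩ * ⟨(t - c) * v, -v⟩ : QuadOrder t n) = (p : QuadOrder t n) := by
      ext
      · simp only [QuadraticAlgebra.re_mul, QuadraticAlgebra.re_natCast]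
        linear_combination v * huc + p * hv
      · simp only [QuadraticAlgebra.im_mul, QuadraticAlgebra.im_natCast]
        ring
    refine ⟨⟨-c, 1⟩, Dvd.intro _ hpi, fun x hx => ?_⟩
    -- `x = (re + c im) + im (ω - c)`
    have h0 : x.re + c * x.im ≠ 0 ∨ x.im ≠ 0 := by
      by_contra! h
      refine hx (QuadraticAlgebra.ext ?_ h.2)
      simpa [h.2] using h.1
    obtain ⟨k, a, b, ha, hb, hab⟩ := padicInt_exists_pow_mul_pair h0
    have e : ((p : QuadOrder t n) ^ k) = algebraMap ℤ_[p] _ ((p : ℤ_[p]) ^ k) := by simp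
    have hx' : x = p ^ k * (⟨a - c * b, b⟩ : QuadOrder t n) := by
      rw [e, ← Algebra.smul_def]
      ext
      · simp; linear_combination ha - c * hb
      · simp [hb]
    -- Since `p` divides `f(c)` and `f'(c) = 2c - t`, the norm of `a + b(θ - c)` is `a²` modulo `p`.
    -- It is a unit unless `p ∣ a`, and in that case `θ - c` can be factored out.
    by_cases hau : (p : ℤ_[p]) ∣ a
    · have hbu : IsUnit b := hab.resolve_left (by rw [padicInt_isUnit_iff_not_dvd]; simpa using hau)
      obtain ⟨a', rfl⟩ := hau
      refine ⟨k, ⟨b + a' * (t - c) * v, -(a' * v)⟩, ?_, .inr ?_⟩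
      · rw [quadOrder_isUnit_iff]
        intro h
        rw [padicInt_isUnit_iff_not_dvd] at hbu
        apply hbu
        apply prime_padicInt.dvd_of_dvd_pow (n := 2)
        obtain ⟨d, hd⟩ := hd
        have hh : (b + a' * (t - c) * v) ^ 2 + t * (b + a' * (t - c) * v) * (-(a' * v))
            + n * (-(a' * v)) ^ 2 = b ^ 2 + p * (-(a' * b * v * d) + a' ^ 2 * v ^ 2 * u) := by
          linear_combination a' ^ 2 * v ^ 2 * huc - (a' * b * v) * hd
        simp only at h
        rw [hh] at h
        exact (dvd_add_left (dvd_mul_right _ _)).1 h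
      · rw [hx']
        congr 1
        ext
        · simp only [QuadraticAlgebra.re_mul]
          linear_combination (-a' * v) * huc - a' * p * hv
        · simp only [QuadraticAlgebra.im_mul]
          ring
    · refine ⟨k, _, ?_, .inl hx'⟩
      rw [quadOrder_isUnit_iff]
      intro h
      apply hau
      apply prime_padicInt.dvd_of_dvd_pow (n := 2)
      obtain ⟨d, hd⟩ := hd
      have hh : (a - c * b) ^ 2 + t * (a - c * b) * b + n * b ^ 2
          = a ^ 2 + p * (b ^ 2 * u - a * b * d) := by
        linear_combination b ^ 2 * huc - a * b * hd
      simp only at h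
      rw [hh] at h
      exact (dvd_add_left (dvd_mul_right _ _)).1 h

/-- Up to units the nonzero elements are `p ^ k` and `p ^ k π`, with `p ^ k ∣ p ^ k π ∣ p ^ (k+1)`,
so divisibility is a chain. This is what makes the index determine an order in the non-split case.
-/
theorem quadOrder_dvd_total {t n : ℤ_[p]} (hm : IsMaximalPoly t n) (hs : ¬ IsSplitPoly t n)
    (x y : QuadOrder t n) : x ∣ y ∨ y ∣ x := by
  obtain ⟨π, ⟨q, hq⟩, h⟩ := quadOrder_normal_form hm hs
  by_cases hx : x = 0
  · right; simp [hx]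
  by_cases hy : y = 0
  · left; simp [hy]
  have hstep : ∀ {k l : ℕ}, k < l → (p : QuadOrder t n) ^ k * π ∣ p ^ l := by
    intro k l hkl
    refine dvd_trans ?_ (pow_dvd_pow _ hkl)
    rw [pow_succ]
    exact mul_dvd_mul_left _ ⟨q, hq⟩
  obtain ⟨k, u, hu, hxk⟩ := h x hx
  obtain ⟨l, v, hv, hyl⟩ := h y hy
  have unify : ∀ {z : QuadOrder t n} {k u}, IsUnit u → (z = p ^ k * u ∨ z = p ^ k * (π * u)) →
      Associated ((p : QuadOrder t n) ^ k) z ∨ Associated ((p : QuadOrder t n) ^ k * π) z := by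
    rintro z k u hu (rfl | rfl)
    · exact .inl (associated_mul_unit_right _ _ hu)
    · exact .inr (by rw [← mul_assoc]; exact associated_mul_unit_right _ _ hu)
  rcases unify hu hxk with hx' | hx' <;> rcases unify hv hyl with hy' | hy'
  · rw [← hx'.dvd_iff_dvd_left, ← hy'.dvd_iff_dvd_right, ← hy'.dvd_iff_dvd_left,
      ← hx'.dvd_iff_dvd_right]
    rcases le_total k l with h | h
    · exact .inl (pow_dvd_pow _ h)
    · exact .inr (pow_dvd_pow _ h)
  · rw [← hx'.dvd_iff_dvd_left, ← hy'.dvd_iff_dvd_right, ← hy'.dvd_iff_dvd_left,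
      ← hx'.dvd_iff_dvd_right]
    rcases le_or_gt k l with h | h
    · exact .inl (dvd_mul_of_dvd_left (pow_dvd_pow _ h) _)
    · exact .inr (hstep h)
  · rw [← hx'.dvd_iff_dvd_left, ← hy'.dvd_iff_dvd_right, ← hy'.dvd_iff_dvd_left,
      ← hx'.dvd_iff_dvd_right]
    rcases lt_or_ge k l with h | h
    · exact .inl (hstep h)
    · exact .inr (dvd_mul_of_dvd_left (pow_dvd_pow _ h) _)
  · rw [← hx'.dvd_iff_dvd_left, ← hy'.dvd_iff_dvd_right, ← hy'.dvd_iff_dvd_left,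
      ← hx'.dvd_iff_dvd_right]
    rcases le_total k l with h | h
    · exact .inl (mul_dvd_mul_right (pow_dvd_pow _ h) _)
    · exact .inr (mul_dvd_mul_right (pow_dvd_pow _ h) _)

/-- The index of a principal ideal, as a subgroup. -/
def principalIndex {S : Type*} [CommRing S] (r : S) : ℕ :=
  (Ideal.span {r}).toAddSubgroup.index

/-- Multiplication by the nonzerodivisor `r` identifies `S / sS` with `rS / rsS`. -/
theorem principalIndex_mul {S : Type*} [CommRing S] {r : S} (hr : r ∈ nonZeroDivisors S) (s : S) :
    principalIndex (r * s) = principalIndex r * principalIndex s := by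
  have hle : (Ideal.span {r * s}).toAddSubgroup ≤ (Ideal.span {r}).toAddSubgroup :=
    Ideal.span_singleton_le_span_singleton.2 (dvd_mul_right r s)
  rw [principalIndex, ← AddSubgroup.relIndex_mul_index hle, mul_comm]
  congr 1
  have h1 : ∀ x : S, (Ideal.span {r * x}).toAddSubgroup
      = (Ideal.span {x}).toAddSubgroup.map (AddMonoidHom.mulLeft r) := by
    intro x
    ext y
    simp only [Submodule.mem_toAddSubgroup, Ideal.mem_span_singleton, AddSubgroup.mem_map,
      AddMonoidHom.coe_mulLeft]
    constructor
    · rintro ⟨z, rfl⟩; exact ⟨x * z, dvd_mul_right _ _, by ring⟩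
    · rintro ⟨_, ⟨z, rfl⟩, rfl⟩; exact ⟨z, by ring⟩
  have h2 := h1 1
  rw [mul_one] at h2
  rw [h1 s, h2, AddSubgroup.relIndex_map_map_of_injective]
  · simp [principalIndex, AddSubgroup.relIndex_top_right]
  · intro a b hab
    exact (mul_cancel_left_mem_nonZeroDivisors hr).1 hab

theorem principalIndex_one {S : Type*} [CommRing S] : principalIndex (1 : S) = 1 := by
  simp [principalIndex]

theorem principalIndex_pow {S : Type*} [CommRing S] {r : S} (hr : r ∈ nonZeroDivisors S) (k : ℕ) :
    principalIndex (r ^ k) = principalIndex r ^ k := by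
  induction k with
  | zero => simp [principalIndex_one]
  | succ k ih => rw [pow_succ', principalIndex_mul hr, ih, pow_succ']

theorem principalIndex_eq_card {S T : Type*} [CommRing S] [AddGroup T] {r : S} (f : S →+ T)
    (hf : Function.Surjective f) (h : ∀ x, f x = 0 ↔ r ∣ x) : principalIndex r = Nat.card T := by
  have : (Ideal.span {r}).toAddSubgroup = f.ker := by
    ext x; simp [AddMonoidHom.mem_ker, h, Ideal.mem_span_singleton]
  rw [principalIndex, this, AddSubgroup.index_ker, AddMonoidHom.range_eq_top.2 hf]
  exact Nat.card_congr AddSubgroup.topEquiv.toEquiv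

theorem quadOrder_principalIndex_p (t n : ℤ_[p]) :
    principalIndex (p : QuadOrder t n) = p ^ 2 := by
  have hp : ∀ x : QuadOrder t n, (p : QuadOrder t n) ∣ x ↔ (p : ℤ_[p]) ∣ x.re ∧ (p : ℤ_[p]) ∣ x.im := by
    intro x
    have := QuadraticAlgebra.algebraMap_dvd_iff (r := (p : ℤ_[p])) (z := x)
    simpa using this
  let f : QuadOrder t n →+ ZMod p × ZMod p :=
    { toFun := fun x => (PadicInt.toZMod x.re, PadicInt.toZMod x.im)
      map_zero' := by simp
      map_add' := by simp }
  rw [principalIndex_eq_card f, Nat.card_prod, Nat.card_zmod, sq]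
  · rintro ⟨a, b⟩
    obtain ⟨a, rfl⟩ := exists_toZMod_eq a
    obtain ⟨b, rfl⟩ := exists_toZMod_eq b
    exact ⟨⟨a, b⟩, rfl⟩
  · intro x
    rw [hp, padicInt_dvd_iff_toZMod, padicInt_dvd_iff_toZMod]
    simp [f]

theorem quadOrder_dvd_p {t n c : ℤ_[p]} (hc : (p : ℤ_[p]) ∣ c ^ 2 - t * c + n)
    (hc2 : ¬ (p : ℤ_[p]) ^ 2 ∣ c ^ 2 - t * c + n) :
    (⟨-c, 1⟩ : QuadOrder t n) ∣ (p : QuadOrder t n) := by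
  obtain ⟨u, hu, huc⟩ := exists_eq_p_mul_unit hc hc2
  obtain ⟨v, hv⟩ := hu.exists_right_inv
  refine Dvd.intro (⟨(t - c) * v, -v⟩ : QuadOrder t n) ?_
  ext
  · simp only [QuadraticAlgebra.re_mul, QuadraticAlgebra.re_natCast]
    linear_combination v * huc + p * hv
  · simp only [QuadraticAlgebra.im_mul, QuadraticAlgebra.im_natCast]
    ring

/-- The ideal of `θ - c` contains `p`, so it is the kernel of the reduction `θ ↦ c` to `𝔽_p`; its
index is therefore `p`. -/
theorem quadOrder_dvd_iff {t n c : ℤ_[p]} (hc : (p : ℤ_[p]) ∣ c ^ 2 - t * c + n)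
    (hc2 : ¬ (p : ℤ_[p]) ^ 2 ∣ c ^ 2 - t * c + n) (x : QuadOrder t n) :
    (⟨-c, 1⟩ : QuadOrder t n) ∣ x ↔ (p : ℤ_[p]) ∣ x.re + c * x.im := by
  constructor
  · rintro ⟨y, rfl⟩
    simp only [QuadraticAlgebra.re_mul, QuadraticAlgebra.im_mul]
    have : -c * y.re + -n * 1 * y.im + c * (-c * y.im + 1 * y.re + t * 1 * y.im)
      = -(c ^ 2 - t * c + n) * y.im := by ring
    rw [this]
    exact (hc.neg_right).mul_right _
  · rintro ⟨d, hd⟩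
    have : x = p * algebraMap _ _ d + ⟨-c, 1⟩ * algebraMap _ _ x.im := by
      rw [mul_comm, ← Algebra.smul_def, mul_comm, ← Algebra.smul_def]
      ext
      · simp [QuadraticAlgebra.re_natCast]; linear_combination hd
      · simp [QuadraticAlgebra.im_natCast]
    rw [this]
    exact dvd_add ((quadOrder_dvd_p hc hc2).mul_right _) (dvd_mul_right _ _)

theorem quadOrder_principalIndex {t n c : ℤ_[p]} (hc : (p : ℤ_[p]) ∣ c ^ 2 - t * c + n)
    (hc2 : ¬ (p : ℤ_[p]) ^ 2 ∣ c ^ 2 - t * c + n) :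
    principalIndex (⟨-c, 1⟩ : QuadOrder t n) = p := by
  obtain ⟨f, hf⟩ : ∃ f : QuadOrder t n →+ ZMod p,
      ∀ x, f x = PadicInt.toZMod (x.re + c * x.im) :=
    ⟨(PadicInt.toZMod (p := p)).toAddMonoidHom.comp
      (QuadraticAlgebra.reₗ (-n) t + c • QuadraticAlgebra.imₗ (-n) t).toAddMonoidHom,
      fun x => rfl⟩
  rw [principalIndex_eq_card f, Nat.card_zmod]
  · intro a
    obtain ⟨a, rfl⟩ := exists_toZMod_eq a
    exact ⟨⟨a, 0⟩, by simp [hf]⟩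
  · intro x
    rw [hf, ← padicInt_dvd_iff_toZMod, quadOrder_dvd_iff hc hc2]

theorem quadOrder_mem_nonZeroDivisors {t n c : ℤ_[p]}
    (hc2 : ¬ (p : ℤ_[p]) ^ 2 ∣ c ^ 2 - t * c + n) :
    (⟨-c, 1⟩ : QuadOrder t n) ∈ nonZeroDivisors (QuadOrder t n) := by
  rw [← QuadraticAlgebra.norm_mem_nonZeroDivisors_iff]
  apply mem_nonZeroDivisors_of_ne_zero
  rw [QuadraticAlgebra.norm_def]
  intro h0
  apply hc2
  have : c ^ 2 - t * c + n = 0 := by simp only at h0; linear_combination h0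
  rw [this]; exact dvd_zero _

/-- The possible indices of ideals in a local maximal order. -/
theorem quadOrder_exists_principalIndex {t n : ℤ_[p]} (hm : IsMaximalPoly t n) (m : ℕ)
    (h : IsInertPoly t n → Even m) :
    ∃ (r : QuadOrder t n) (N : ℕ), principalIndex r = p ^ m ∧ r ∣ (p : QuadOrder t n) ^ N := by
  by_cases hi : IsInertPoly t n
  · obtain ⟨k, rfl⟩ := h hi
    refine ⟨p ^ k, k, ?_, dvd_rfl⟩
    rw [principalIndex_pow, quadOrder_principalIndex_p, ← pow_mul, two_mul]
    have := (QuadraticAlgebra.algebraMap_mem_nonZeroDivisors_iff (a := -n) (b := t)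
      (r := (p : ℤ_[p]))).2 (mem_nonZeroDivisors_of_ne_zero prime_padicInt.ne_zero)
    simpa using this
  · obtain ⟨c, hc, hc2⟩ := exists_dvd_not_sq_dvd hm hi
    refine ⟨⟨-c, 1⟩ ^ m, m, ?_, pow_dvd_pow_of_dvd (quadOrder_dvd_p hc hc2) m⟩
    rw [principalIndex_pow (quadOrder_mem_nonZeroDivisors hc2), quadOrder_principalIndex hc hc2]

end QuadraticOrder
end QuatOrder
end

/-! ### Quaternion algebras in terms of structure constants. -/

noncomputable section
namespace QuatOrder

section Quaternion

open scoped Quaternion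

variable {K : Type*} [Field K]

/-- The expression `a w + i w i` equals `2a` times the component of `w` in the span of `1, i`. The
analogous operation with `j` then removes the `i`-component. -/
theorem quaternion_coe_re_mem {a b : K} (I : TwoSidedIdeal ℍ[K,a,b]) {w : ℍ[K,a,b]} (hw : w ∈ I) :
    (⟨4 * a * b * w.re, 0, 0, 0⟩ : ℍ[K,a,b]) ∈ I := by
  have h1 : (a : ℍ[K,a,b]) * w + ⟨0, 1, 0, 0⟩ * w * ⟨0, 1, 0, 0⟩ ∈ I :=
    I.add_mem (I.mul_mem_left _ _ hw) (I.mul_mem_right _ _ (I.mul_mem_left _ _ hw))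
  have h2 := I.add_mem (I.mul_mem_left (b : ℍ[K,a,b]) _ h1)
    (I.mul_mem_right _ ⟨0, 0, 1, 0⟩ (I.mul_mem_left ⟨0, 0, 1, 0⟩ _ h1))
  convert h2 using 1
  ext <;> simp <;> ring

/-- A proper two-sided ideal has only elements of scalar part zero. Applied to the products of `w`
with `i`, `j`, `k`, this kills every coordinate of `w`. -/
theorem quaternion_isSimpleRing {a b : K} (h2 : (2 : K) ≠ 0) (ha : a ≠ 0) (hb : b ≠ 0) :
    IsSimpleRing ℍ[K,a,b] := by
  refine IsSimpleRing.of_eq_bot_or_eq_top fun I => ?_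
  rw [or_iff_not_imp_right]
  intro hI
  have key : ∀ w ∈ I, w.re = 0 := by
    intro w hw
    by_contra h0
    apply hI
    rw [← I.one_mem_iff]
    have h4 : (4 : K) ≠ 0 := by
      have : (4 : K) = 2 * 2 := by norm_num
      rw [this]; exact mul_ne_zero h2 h2
    have hne : 4 * a * b * w.re ≠ 0 := by positivity
    have h1 := quaternion_coe_re_mem I hw
    generalize 4 * a * b * w.re = c at hne h1
    have := I.mul_mem_left ⟨c⁻¹, 0, 0, 0⟩ _ h1
    convert this using 1
    ext <;> simp only [QuaternionAlgebra.re_mul, QuaternionAlgebra.imI_mul,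
      QuaternionAlgebra.imJ_mul, QuaternionAlgebra.imK_mul, QuaternionAlgebra.re_one,
      QuaternionAlgebra.imI_one, QuaternionAlgebra.imJ_one, QuaternionAlgebra.imK_one] <;>
      simp [hne]
  rw [eq_bot_iff]
  intro w hw
  rw [TwoSidedIdeal.mem_bot]
  have hi := key _ (I.mul_mem_right _ ⟨0, 1, 0, 0⟩ hw)
  have hj := key _ (I.mul_mem_right _ ⟨0, 0, 1, 0⟩ hw)
  have hk := key _ (I.mul_mem_right _ ⟨0, 0, 0, 1⟩ hw)
  simp [ha, hb] at hi hj hk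
  exact QuaternionAlgebra.ext (key w hw) hi hj hk

/-- A homomorphism from a simple algebra to an algebra of the same dimension is bijective. -/
theorem bijective_of_finrank_eq {A B : Type*} [Ring A] [Algebra K A] [IsSimpleRing A] [Ring B]
    [Algebra K B] [Module.Finite K A] [Module.Finite K B] [Nontrivial B]
    (h : Module.finrank K A = Module.finrank K B) (f : A →ₐ[K] B) : Function.Bijective f := by
  have hi : Function.Injective f := f.toRingHom.injective
  exact ⟨hi, (LinearMap.injective_iff_surjective_of_finrank_eq_finrank h (f := f.toLinearMap)).1 hi⟩

/-- By Wedderburn the algebra is a matrix ring of size `m` over a division algebra `D` with `m² ·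
dim D = 4`, which leaves `m = 1`, or `m = 2` and `D = K`. -/
theorem unit_or_matrix_of_finrank_eq_four {A : Type*} [Ring A] [Algebra K A] [IsSimpleRing A]
    (h : Module.finrank K A = 4) :
    (∀ x : A, x ≠ 0 → IsUnit x) ∨ Nonempty (A ≃ₐ[K] Matrix (Fin 2) (Fin 2) K) := by
  have : Module.Finite K A := Module.finite_of_finrank_pos (by omega)
  have : IsArtinianRing A := IsArtinianRing.of_finite K A
  obtain ⟨n, hn, D, _, _, _, ⟨e⟩⟩ := IsSimpleRing.exists_algEquiv_matrix_divisionRing_finite K A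
  have hf := e.toLinearEquiv.finrank_eq
  rw [h, Module.finrank_matrix] at hf
  simp only [Fintype.card_fin] at hf
  have hn0 : n ≠ 0 := NeZero.ne n
  have hn2 : n ≤ 2 := by
    by_contra hn
    have hD : Module.finrank K D ≠ 0 := by rintro h0; simp [h0] at hf
    have : 3 * 3 * 1 ≤ n * n * Module.finrank K D := by gcongr <;> omega
    omega
  interval_cases n
  · exact absurd rfl hn0
  · left
    intro x hx
    have hu : IsUnit (e x) := by
      have hz : (e x) 0 0 ≠ 0 := by
        intro h0
        apply hx
        apply e.injective
        rw [map_zero]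
        ext i j
        fin_cases i; fin_cases j; exact h0
      refine ⟨⟨e x, !![((e x) 0 0)⁻¹], ?_, ?_⟩, rfl⟩
      · ext i j
        fin_cases i; fin_cases j
        simp [Matrix.mul_apply, hz]
      · ext i j
        fin_cases i; fin_cases j
        simp [Matrix.mul_apply, hz]
    exact (MulEquiv.isUnit_map e).1 hu
  · right
    have hD : Module.finrank K D = 1 := by omega
    have hb : Function.Bijective (algebraMap K D) :=
      Subalgebra.bot_eq_top_iff_finrank_eq_one.2 hD |> fun h =>
        ⟨(algebraMap K D).injective, fun x => by
          have : x ∈ (⊥ : Subalgebra K D) := h ▸ Algebra.mem_top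
          exact Algebra.mem_bot.1 this⟩
    let e2 : K ≃ₐ[K] D := AlgEquiv.ofBijective (Algebra.ofId K D) hb
    exact ⟨e.trans e2.symm.mapMatrix⟩

theorem matrix_equiv_quaternion (h2 : (2 : K) ≠ 0) :
    Nonempty (Matrix (Fin 2) (Fin 2) K ≃ₐ[K] ℍ[K,1,1]) := by
  have := quaternion_isSimpleRing (a := 1) (b := 1) h2 one_ne_zero one_ne_zero
  let q : QuaternionAlgebra.Basis (Matrix (Fin 2) (Fin 2) K) (1 : K) 0 1 :=
    { i := !![1, 0; 0, -1]
      j := !![0, 1; 1, 0]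
      k := !![0, 1; -1, 0]
      i_mul_i := by simp [Matrix.one_fin_two]
      j_mul_j := by simp [Matrix.one_fin_two]
      i_mul_j := by simp
      j_mul_i := by simp }
  exact ⟨(AlgEquiv.ofBijective q.liftHom (bijective_of_finrank_eq (by
    rw [QuaternionAlgebra.finrank_eq_four, Module.finrank_matrix]; simp) _)).symm⟩

variable {F : Type*} [Ring F] [Algebra K F]

/-- In a division algebra of dimension four over its center, elements are quadratic. -/
theorem exists_quadratic_eq (hdiv : ∀ x : F, x ≠ 0 → IsUnit x) (h4 : Module.finrank K F = 4)
    {x y : F} (hxy : x * y ≠ y * x) : ∃ s r : K, x * x = s • x + r • (1 : F) := by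
  have : Module.Finite K F := Module.finite_of_finrank_pos (by omega)
  by_contra! hno
  -- `1, x, x², y, xy` are linearly independent
  let v : Fin 5 → F := ![1, x, x * x, y, x * y]
  have hx0 : ∀ c : K, x ≠ c • (1 : F) := by
    rintro c rfl; apply hxy; simp
  have : Nontrivial F := by
    by_contra hn
    rw [not_nontrivial_iff_subsingleton] at hn
    exact hxy (Subsingleton.elim _ _)
  have hv : LinearIndependent K v := by
    rw [Fintype.linearIndependent_iff]
    intro g hg
    simp only [Fin.sum_univ_five, v, Matrix.cons_val] at hg
    have hpoly : ∀ c0 c1 c2 : K, c0 • (1 : F) + c1 • x + c2 • (x * x) = 0 →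
        c0 = 0 ∧ c1 = 0 ∧ c2 = 0 := by
      intro c0 c1 c2 h
      have h2 : c2 = 0 := by
        by_contra h2
        apply hno (-(c2⁻¹ * c1)) (-(c2⁻¹ * c0))
        have := congrArg (fun z => c2⁻¹ • z) h
        simp only [smul_add, smul_smul, inv_mul_cancel₀ h2, smul_zero, one_smul] at this
        rw [neg_smul, neg_smul, ← sub_eq_zero, ← this]
        abel
      subst h2
      have h1 : c1 = 0 := by
        by_contra h1
        apply hx0 (-(c1⁻¹ * c0))
        have := congrArg (fun z => c1⁻¹ • z) h
        simp only [smul_add, smul_smul, inv_mul_cancel₀ h1, smul_zero, one_smul,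
          zero_smul, add_zero] at this
        rw [neg_smul, ← sub_eq_zero, ← this]
        abel
      subst h1
      simpa using h
    -- The relation puts `z y` into `K[x]` with `z = g 3 + g 4 x`. If `z` were nonzero, it would be
    -- invertible and commute with `x`, so `y` would commute with `x`.
    have h34 : g 3 = 0 ∧ g 4 = 0 := by
      by_contra hne
      set z : F := g 3 • (1 : F) + g 4 • x with hz
      have hz0 : z ≠ 0 := by
        intro h0
        have := hpoly (g 3) (g 4) 0 (by simpa using h0)
        exact hne ⟨this.1, this.2.1⟩
      obtain ⟨u, hu⟩ := hdiv z hz0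
      have hc : Commute x z := by
        apply Commute.add_right
        · exact (Commute.one_right x).smul_right _
        · exact (Commute.refl x).smul_right _
      have hzy : z * y = -(g 0 • (1 : F) + g 1 • x + g 2 • (x * x)) := by
        rw [hz, add_mul, smul_mul_assoc, smul_mul_assoc, one_mul, eq_neg_iff_add_eq_zero, ← hg]
        abel
      have hc2 : Commute x (z * y) := by
        rw [hzy]
        apply Commute.neg_right
        refine Commute.add_right (Commute.add_right ?_ ?_) ?_
        · exact (Commute.one_right x).smul_right _
        · exact (Commute.refl x).smul_right _
        · exact ((Commute.refl x).mul_right (Commute.refl x)).smul_right _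
      apply hxy
      have h1 : z * (x * y) = z * (y * x) := by
        rw [← mul_assoc, ← hc.eq, mul_assoc, hc2.eq, mul_assoc]
      rw [← hu] at h1
      exact u.isUnit.mul_left_cancel h1
    rw [h34.1, h34.2] at hg
    have := hpoly (g 0) (g 1) (g 2) (by simpa using hg)
    intro i
    fin_cases i
    · exact this.1
    · exact this.2.1
    · exact this.2.2
    · exact h34.1
    · exact h34.2
  have := hv.fintype_card_le_finrank
  rw [h4] at this
  simp at this

/-- Completing the square in a non-central `x` gives `i` with scalar square. A nonzero commutator `j
= i y - y i` anticommutes with `i`, and since `j²` commutes with `i`, its linear term in `j`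
vanishes, so `j²` is scalar as well. -/
theorem exists_quaternion_equiv_of_division (h2 : (2 : K) ≠ 0) [Algebra.IsCentral K F]
    (hdiv : ∀ x : F, x ≠ 0 → IsUnit x) (h4 : Module.finrank K F = 4) :
    ∃ a b : K, a ≠ 0 ∧ b ≠ 0 ∧ Nonempty (F ≃ₐ[K] ℍ[K,a,b]) := by
  have : Module.Finite K F := Module.finite_of_finrank_pos (by omega)
  have : Nontrivial F := Module.nontrivial_of_finrank_pos (R := K) (by omega)
  have hcen : ∀ x : F, (∀ y, x * y = y * x) → ∃ c : K, x = c • (1 : F) := by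
    intro x hx
    have := Algebra.IsCentral.out (K := K) (D := F)
      (show x ∈ Subalgebra.center K F from Subalgebra.mem_center_iff.2 fun y => (hx y).symm)
    obtain ⟨c, hc⟩ := Algebra.mem_bot.1 this
    exact ⟨c, by rw [← hc, Algebra.algebraMap_eq_smul_one]⟩
  have hmul0 : ∀ x y : F, x * y = 0 → x = 0 ∨ y = 0 := by
    intro x y h
    by_contra! hne
    obtain ⟨u, rfl⟩ := hdiv x hne.1
    exact hne.2 ((Units.mul_right_eq_zero u).1 h)
  have hex : ∃ x y : F, x * y ≠ y * x := by
    by_contra! hcomm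
    have : (⊥ : Subalgebra K F) = ⊤ := by
      rw [eq_top_iff]
      intro x _
      obtain ⟨c, rfl⟩ := hcen x (hcomm x)
      exact Subalgebra.smul_mem _ (Subalgebra.one_mem _) c
    rw [Subalgebra.bot_eq_top_iff_finrank_eq_one] at this
    omega
  obtain ⟨x, y, hxy⟩ := hex
  obtain ⟨s, r, hx⟩ := exists_quadratic_eq hdiv h4 hxy
  -- complete the square
  obtain ⟨i, hi⟩ : ∃ i : F, i = x - (s / 2) • (1 : F) := ⟨_, rfl⟩
  set a : K := r + (s / 2) ^ 2 with ha
  have hii : i * i = a • (1 : F) := by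
    rw [hi, ha, sub_mul, mul_sub, hx]
    simp only [mul_smul_comm, mul_one, smul_mul_assoc, one_mul, add_smul, smul_sub, smul_smul]
    have : s • x = (s / 2) • x + (s / 2) • x := by rw [← add_smul]; congr 1; field_simp; ring
    rw [this, sq]
    abel
  have hiy : i * y - y * i ≠ 0 := by
    rw [sub_ne_zero, hi, sub_mul, mul_sub]
    intro h
    apply hxy
    simpa using h
  have ha0 : a ≠ 0 := by
    rintro h0
    rw [h0, zero_smul] at hii
    have : i = 0 := by rcases hmul0 _ _ hii with h | h <;> exact h
    simp [this] at hiy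
  obtain ⟨j, hj⟩ : ∃ j : F, j = i * y - y * i := ⟨_, rfl⟩
  rw [← hj] at hiy
  have hij : i * j = -(j * i) := by
    rw [hj, mul_sub, sub_mul, ← mul_assoc, hii, mul_assoc y, hii]
    simp [mul_assoc]
  have hji0 : j * i ≠ 0 := by
    intro h
    rcases hmul0 _ _ h with h | h
    · exact hiy h
    · rw [h, mul_zero, eq_comm, smul_eq_zero] at hii
      exact hii.elim ha0 one_ne_zero
  have h2F : ∀ z : F, z ≠ 0 → z ≠ -z := by
    intro z hz h
    have : (2 : K) • z = 0 := by
      rw [two_smul]; nth_rewrite 1 [h]; simp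
    exact (smul_eq_zero.1 this).elim h2 hz
  have hncomm : j * i ≠ i * j := by rw [hij]; exact h2F _ hji0
  obtain ⟨s', b, hjj⟩ := exists_quadratic_eq hdiv h4 hncomm
  have hs' : s' = 0 := by
    have h1 : i * (j * j) = (j * j) * i := by
      rw [← mul_assoc, hij, neg_mul, mul_assoc j, hij]; simp [mul_assoc]
    rw [hjj, mul_add, add_mul, mul_smul_comm, mul_smul_comm, smul_mul_assoc, smul_mul_assoc, mul_one,
      one_mul, hij, smul_neg] at h1
    by_contra hs
    apply h2F (s' • (j * i))
    · exact fun h => (smul_eq_zero.1 h).elim hs hji0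
    · exact (add_right_cancel h1).symm
  rw [hs', zero_smul, zero_add] at hjj
  have hb0 : b ≠ 0 := by
    rintro h0
    rw [h0, zero_smul] at hjj
    have : j = 0 := by rcases hmul0 _ _ hjj with h | h <;> exact h
    exact hiy this
  let q : QuaternionAlgebra.Basis F a 0 b :=
    { i := i
      j := j
      k := i * j
      i_mul_i := by rw [hii]; simp
      j_mul_j := hjj
      i_mul_j := rfl
      j_mul_i := by rw [hij]; simp }
  have := quaternion_isSimpleRing h2 ha0 hb0
  exact ⟨a, b, ha0, hb0, ⟨(AlgEquiv.ofBijective q.liftHom (bijective_of_finrank_eq (by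
    rw [QuaternionAlgebra.finrank_eq_four, h4]) _)).symm⟩⟩

theorem IsQuaternionAlgebra.exists_equiv (h2 : (2 : K) ≠ 0) (hF : IsQuaternionAlgebra K F) :
    ∃ a b : K, a ≠ 0 ∧ b ≠ 0 ∧ Nonempty (F ≃ₐ[K] ℍ[K,a,b]) := by
  obtain ⟨_, _, h4⟩ := hF
  rcases unit_or_matrix_of_finrank_eq_four (K := K) (A := F) h4 with h | ⟨⟨e⟩⟩
  · exact exists_quaternion_equiv_of_division h2 h h4
  · obtain ⟨e'⟩ := matrix_equiv_quaternion h2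
    exact ⟨1, 1, one_ne_zero, one_ne_zero, ⟨e.trans e'⟩⟩

/-- Base change of a quaternion algebra. -/
theorem baseChange_quaternion_equiv (h2 : (2 : K) ≠ 0) {L : Type*} [Field L] [Algebra K L] {a b : K}
    (ha : a ≠ 0) (hb : b ≠ 0) (e : F ≃ₐ[K] ℍ[K,a,b]) :
    Nonempty ((L ⊗[K] F) ≃ₐ[L] ℍ[L,algebraMap K L a,algebraMap K L b]) := by
  have hl2 : (2 : L) ≠ 0 := by
    rw [← map_ofNat (algebraMap K L) 2]
    exact (map_ne_zero (algebraMap K L)).2 h2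
  have := quaternion_isSimpleRing hl2 ((map_ne_zero (algebraMap K L)).2 ha)
    ((map_ne_zero (algebraMap K L)).2 hb)
  have hfin : Module.Finite K F := Module.Finite.equiv e.symm.toLinearEquiv
  have h4 : Module.finrank K F = 4 := by
    rw [e.toLinearEquiv.finrank_eq, QuaternionAlgebra.finrank_eq_four]
  have : Nontrivial F := Module.nontrivial_of_finrank_pos (R := K) (by omega)
  have hal : ∀ c : K, (1 : L) ⊗ₜ[K] (c • (1 : F)) = algebraMap K L c • (1 : L ⊗[K] F) := by
    intro c
    rw [TensorProduct.tmul_smul, Algebra.TensorProduct.one_def, TensorProduct.smul_tmul',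
      TensorProduct.smul_tmul', Algebra.smul_def, smul_eq_mul]
  let i := e.symm ⟨0, 1, 0, 0⟩
  let j := e.symm ⟨0, 0, 1, 0⟩
  have hii : i * i = a • (1 : F) := by
    rw [← map_one e.symm, ← map_smul, ← map_mul]; congr 1; ext <;> simp
  have hjj : j * j = b • (1 : F) := by
    rw [← map_one e.symm, ← map_smul, ← map_mul]; congr 1; ext <;> simp
  have hij : j * i = -(i * j) := by
    rw [← map_mul, ← map_mul, ← map_neg]; congr 1; ext <;> simp
  let q : QuaternionAlgebra.Basis (L ⊗[K] F) (algebraMap K L a) 0 (algebraMap K L b) :=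
    { i := 1 ⊗ₜ i
      j := 1 ⊗ₜ j
      k := 1 ⊗ₜ (i * j)
      i_mul_i := by rw [Algebra.TensorProduct.tmul_mul_tmul, hii, one_mul, hal]; simp
      j_mul_j := by rw [Algebra.TensorProduct.tmul_mul_tmul, hjj, one_mul, hal]
      i_mul_j := by rw [Algebra.TensorProduct.tmul_mul_tmul, one_mul]
      j_mul_i := by
        rw [Algebra.TensorProduct.tmul_mul_tmul, hij, one_mul, TensorProduct.tmul_neg]; simp }
  exact ⟨(AlgEquiv.ofBijective q.liftHom (bijective_of_finrank_eq (by
    rw [QuaternionAlgebra.finrank_eq_four, Module.finrank_baseChange, h4]) _)).symm⟩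

end Quaternion
end QuatOrder
end

/-! ### Reduced norm and reduced trace. -/

noncomputable section
namespace QuatOrder

section ReducedNorm

open scoped Quaternion

variable {K : Type*} [Field K] {a b : K}

/-- The reduced norm of a quaternion. -/
def nrd (x : ℍ[K,a,b]) : K := x.re ^ 2 - a * x.imI ^ 2 - b * x.imJ ^ 2 + a * b * x.imK ^ 2

/-- The reduced trace of a quaternion. -/
def trd (x : ℍ[K,a,b]) : K := 2 * x.re

theorem nrd_mul (x y : ℍ[K,a,b]) : nrd (x * y) = nrd x * nrd y := by
  simp [nrd]; ring

theorem nrd_one : nrd (1 : ℍ[K,a,b]) = 1 := by simp [nrd]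

theorem nrd_zero : nrd (0 : ℍ[K,a,b]) = 0 := by simp [nrd]

theorem nrd_smul (c : K) (x : ℍ[K,a,b]) : nrd (c • x) = c ^ 2 * nrd x := by
  simp [nrd]; ring

theorem nrd_star (x : ℍ[K,a,b]) : nrd (star x) = nrd x := by simp [nrd]

theorem nrd_neg (x : ℍ[K,a,b]) : nrd (-x) = nrd x := by simp [nrd]

theorem nrd_add (x y : ℍ[K,a,b]) : nrd (x + y) = nrd x + nrd y + trd (x * star y) := by
  simp [nrd, trd]; ring

theorem trd_add (x y : ℍ[K,a,b]) : trd (x + y) = trd x + trd y := by simp [trd]; ring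

theorem trd_smul (c : K) (x : ℍ[K,a,b]) : trd (c • x) = c * trd x := by simp [trd]; ring

theorem trd_one : trd (1 : ℍ[K,a,b]) = 2 := by simp [trd]

theorem trd_mul_comm (x y : ℍ[K,a,b]) : trd (x * y) = trd (y * x) := by
  simp only [trd, QuaternionAlgebra.re_mul]; ring

theorem mul_self_eq (x : ℍ[K,a,b]) : x * x = trd x • x - nrd x • (1 : ℍ[K,a,b]) := by
  ext <;> simp [trd, nrd] <;> ring

theorem star_eq_trd (x : ℍ[K,a,b]) : star x = trd x • (1 : ℍ[K,a,b]) - x := by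
  ext <;> simp [trd]; ring

theorem mul_star_eq (x : ℍ[K,a,b]) : x * star x = nrd x • (1 : ℍ[K,a,b]) := by
  ext <;> simp [nrd] <;> ring

theorem star_mul_eq (x : ℍ[K,a,b]) : star x * x = nrd x • (1 : ℍ[K,a,b]) := by
  ext <;> simp [nrd] <;> ring

theorem nrd_sub_smul (x : ℍ[K,a,b]) (c : K) :
    nrd (x - c • (1 : ℍ[K,a,b])) = c ^ 2 - trd x * c + nrd x := by
  simp [nrd, trd]; ring

theorem nrd_eq_zero_of_division (hdiv : ∀ x : ℍ[K,a,b], x ≠ 0 → IsUnit x) {x : ℍ[K,a,b]}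
    (h : nrd x = 0) : x = 0 := by
  by_contra hx
  obtain ⟨u, rfl⟩ := hdiv x hx
  have := nrd_mul (u : ℍ[K,a,b]) (↑u⁻¹ : ℍ[K,a,b])
  rw [Units.mul_inv, nrd_one, h, zero_mul] at this
  exact one_ne_zero this

theorem trd_nrd_eq_of_not_scalar {x : ℍ[K,a,b]} (hx : ∀ c : K, x ≠ c • (1 : ℍ[K,a,b])) {t n : K}
    (h : x * x = t • x - n • (1 : ℍ[K,a,b])) : trd x = t ∧ nrd x = n := by
  rw [mul_self_eq] at h
  have h1 : (trd x - t) • x = (nrd x - n) • (1 : ℍ[K,a,b]) := by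
    rw [sub_smul, sub_smul]
    rw [sub_eq_sub_iff_sub_eq_sub]
    exact h
  by_cases ht : trd x = t
  · refine ⟨ht, ?_⟩
    rw [ht, sub_self, zero_smul, eq_comm, smul_eq_zero] at h1
    simpa [sub_eq_zero] using h1
  · exfalso
    apply hx ((trd x - t)⁻¹ * (nrd x - n))
    rw [mul_smul, ← h1, smul_smul, inv_mul_cancel₀ (sub_ne_zero.2 ht), one_smul]

theorem eq_smul_one_of_commute (h2 : (2 : K) ≠ 0) (ha : a ≠ 0) {x : ℍ[K,a,b]}
    (h : ∀ y : ℍ[K,a,b], x * y = y * x) : x = x.re • (1 : ℍ[K,a,b]) := by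
  have h1 := h ⟨0, 1, 0, 0⟩
  have h3 := h ⟨0, 0, 1, 0⟩
  rw [QuaternionAlgebra.ext_iff] at h1 h3
  simp at h1 h3
  have e : ∀ z : K, z = -z → z = 0 := by
    intro z hz
    have : 2 * z = 0 := by linear_combination hz
    exact (mul_eq_zero.1 this).resolve_left h2
  have hI : x.imI = 0 := e _ h3.2
  have hJ : x.imJ = 0 := e _ h1.2.symm
  have hK : x.imK = 0 := by
    have := e (a * x.imK) h1.1.symm
    exact (mul_eq_zero.1 this).resolve_left ha
  ext <;> simp [hI, hJ, hK]

/-- Two elements with the same reduced norm and reduced trace are conjugate. -/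
theorem exists_conj (h2 : (2 : K) ≠ 0) (ha : a ≠ 0) {x x' : ℍ[K,a,b]}
    (ht : trd x = trd x') (hn : nrd x = nrd x') (hx' : ∀ c : K, x' ≠ c • (1 : ℍ[K,a,b])) :
    ∃ u : ℍ[K,a,b], u ≠ 0 ∧ u * x = x' * u := by
  -- Every `x' y - y x̄` intertwines `x` and `x'`, because both satisfy the same quadratic equation.
  -- If all of these vanished, `y = 1` would give `x' = x̄`, and then `x'` would be central.
  have key : ∀ y : ℍ[K,a,b], (x' * y - y * star x) * x = x' * (x' * y - y * star x) := by
    intro y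
    rw [sub_mul, mul_sub, mul_assoc y, star_mul_eq, ← mul_assoc x' x', mul_self_eq, ← ht, ← hn,
      star_eq_trd]
    simp only [sub_mul, mul_sub, mul_smul_comm, smul_mul_assoc, mul_one, one_mul, mul_assoc]
    abel
  by_contra! hno
  have hz : ∀ y : ℍ[K,a,b], x' * y = y * star x := by
    intro y
    by_contra h
    exact hno _ (sub_ne_zero.2 h) (key y)
  have h1 : x' = star x := by simpa using hz 1
  rw [← h1] at hz
  exact hx' _ (eq_smul_one_of_commute h2 ha hz)

end ReducedNorm

/-! ### Integrality in a quaternion division algebra over `ℚ_p`. -/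

section PadicDivision

open scoped Quaternion

variable {p : ℕ} [Fact p.Prime] {a b : ℚ_[p]}

theorem nrd_inv_mul {x y : ℍ[ℚ_[p],a,b]} (hx : nrd x ≠ 0) :
    x * ((nrd x)⁻¹ • (star x * y)) = y := by
  rw [mul_smul_comm, ← mul_assoc, mul_star_eq, smul_mul_assoc, one_mul, smul_smul,
    inv_mul_cancel₀ hx, one_smul]

theorem exists_mul_eq_of_norm_nrd_le {x y : ℍ[ℚ_[p],a,b]} (hx : nrd x ≠ 0)
    (h : ‖nrd y‖ ≤ ‖nrd x‖) : ∃ z, y = x * z ∧ ‖nrd z‖ ≤ 1 := by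
  refine ⟨(nrd x)⁻¹ • (star x * y), (nrd_inv_mul hx).symm, ?_⟩
  have := congrArg nrd (nrd_inv_mul (y := y) hx)
  rw [nrd_mul] at this
  have h2 : ‖nrd x‖ * ‖nrd ((nrd x)⁻¹ • (star x * y))‖ ≤ ‖nrd x‖ * 1 := by
    rw [← norm_mul, this, mul_one]; exact h
  exact le_of_mul_le_mul_left h2 (norm_pos_iff.2 hx)

/-- If the norm were integral and the trace not, the reduced characteristic polynomial would have a
root in `ℚ_p`. In a division algebra `x` equals that root, whose square is the norm, so the root and
its double are integral after all. -/
theorem norm_trd_le (hdiv : ∀ x : ℍ[ℚ_[p],a,b], x ≠ 0 → IsUnit x)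
    {x : ℍ[ℚ_[p],a,b]} (h : ‖nrd x‖ ≤ 1) : ‖trd x‖ ≤ 1 := by
  by_contra! ht
  obtain ⟨r, hr⟩ := exists_root_of_one_lt_norm (trd x) (nrd x) h ht
  have h0 : nrd (x - r • (1 : ℍ[ℚ_[p],a,b])) = 0 := by
    rw [nrd_sub_smul]; exact hr
  have hx := nrd_eq_zero_of_division hdiv h0
  rw [sub_eq_zero] at hx
  rw [hx, nrd_smul, nrd_one, mul_one, norm_pow] at h
  rw [hx, trd_smul, trd_one, norm_mul] at ht
  have h1 : ‖r‖ ≤ 1 := by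
    by_contra! h1
    exact absurd h (not_le.2 (one_lt_pow₀ h1 two_ne_zero))
  have h2 : ‖(2 : ℚ_[p])‖ ≤ 1 := by
    exact_mod_cast Padic.norm_int_le_one (p := p) 2
  exact absurd (mul_le_one₀ h1 (norm_nonneg _) h2) (not_le.2 ht)

end PadicDivision
end QuatOrder
end

/-! ### The valuation ring of a quaternion division algebra over `ℚ_p`. -/

noncomputable section
namespace QuatOrder

section PadicDivisionOrder

open scoped Quaternion

variable {p : ℕ} [Fact p.Prime]

theorem padic_norm_le_inv_of_lt_one {x : ℚ_[p]} (h : ‖x‖ < 1) : ‖x‖ ≤ ‖(p : ℚ_[p])‖ := by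
  obtain ⟨z, rfl⟩ : ∃ z : ℤ_[p], (z : ℚ_[p]) = x := ⟨⟨x, h.le⟩, rfl⟩
  rw [← PadicInt.norm_def, PadicInt.norm_lt_one_iff_dvd] at h
  obtain ⟨y, hy⟩ := h
  have : (z : ℚ_[p]) = p * y := by
    have := congrArg (fun z : ℤ_[p] => (z : ℚ_[p])) hy
    simpa using this
  rw [this, norm_mul]
  exact mul_le_of_le_one_right (norm_nonneg _) y.2

theorem padic_smul_eq {M : Type*} [AddCommGroup M] [Module ℚ_[p] M] [Module ℤ_[p] M]
    [IsScalarTower ℤ_[p] ℚ_[p] M] (c : ℤ_[p]) (x : M) : c • x = (c : ℚ_[p]) • x := by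
  have h1 : (c • (1 : ℚ_[p])) = (c : ℚ_[p]) := by
    rw [Algebra.smul_def, mul_one]; rfl
  rw [← h1, smul_assoc, one_smul]

theorem padic_nakayama {M : Type*} [AddCommGroup M] [Module ℤ_[p] M] {B N : Submodule ℤ_[p] M}
    (hB : B.FG) (h : ∀ x ∈ B, ∃ y ∈ N, ∃ z ∈ B, x = y + (p : ℤ_[p]) • z) : B ≤ N := by
  apply Submodule.le_of_le_smul_of_le_jacobson_bot (I := Ideal.span {(p : ℤ_[p])}) hB
  · rw [← PadicInt.maximalIdeal_eq_span_p, IsLocalRing.jacobson_eq_maximalIdeal ⊥ bot_ne_top]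
  · intro x hx
    obtain ⟨y, hy, z, hz, rfl⟩ := h x hx
    exact Submodule.add_mem_sup hy
      (Submodule.smul_mem_smul (Ideal.mem_span_singleton_self _) hz)

variable {a b : ℚ_[p]}

/-- This ultrametric inequality makes the elements of integral norm a ring. Dividing by the summand
of larger norm reduces it to `nrd (1 + z) = 1 + nrd z + trd z`, where the trace is integral by
`norm_trd_le`. -/
theorem norm_nrd_add_le (hdiv : ∀ x : ℍ[ℚ_[p],a,b], x ≠ 0 → IsUnit x) {C : ℝ}
    {x y : ℍ[ℚ_[p],a,b]} (hx : ‖nrd x‖ ≤ C) (hy : ‖nrd y‖ ≤ C) : ‖nrd (x + y)‖ ≤ C := by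
  wlog h : ‖nrd x‖ ≤ ‖nrd y‖ generalizing x y
  · rw [add_comm]; exact this hy hx (not_le.1 h).le
  by_cases h0 : nrd y = 0
  · rw [nrd_eq_zero_of_division hdiv h0, add_zero]; exact hx
  obtain ⟨z, rfl, hz⟩ := exists_mul_eq_of_norm_nrd_le h0 h
  have e : y * z + y = y * (1 + z) := by rw [mul_add, mul_one, add_comm]
  rw [e, nrd_mul, norm_mul]
  refine (mul_le_of_le_one_right (norm_nonneg _) ?_).trans hy
  have e2 : nrd (1 + z) = 1 + nrd z + trd z := by
    rw [nrd_add, nrd_one, one_mul]; congr 1; simp [trd]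
  rw [e2]
  refine (Padic.nonarchimedean _ _).trans (max_le ((Padic.nonarchimedean _ _).trans
    (max_le (by simp) hz)) (norm_trd_le hdiv hz))

theorem norm_nrd_add_lt (hdiv : ∀ x : ℍ[ℚ_[p],a,b], x ≠ 0 → IsUnit x)
    {x y : ℍ[ℚ_[p],a,b]} (hx : ‖nrd x‖ < 1) (hy : ‖nrd y‖ < 1) : ‖nrd (x + y)‖ < 1 :=
  (norm_nrd_add_le hdiv (padic_norm_le_inv_of_lt_one hx) (padic_norm_le_inv_of_lt_one hy)).trans_lt
    Padic.norm_p_lt_one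

theorem nrd_padicInt_smul (c : ℤ_[p]) (x : ℍ[ℚ_[p],a,b]) :
    nrd (c • x) = (c : ℚ_[p]) ^ 2 * nrd x := by
  rw [padic_smul_eq, nrd_smul]

theorem norm_nrd_smul_le (c : ℤ_[p]) (x : ℍ[ℚ_[p],a,b]) : ‖nrd (c • x)‖ ≤ ‖nrd x‖ := by
  rw [nrd_padicInt_smul, norm_mul, norm_pow]
  exact mul_le_of_le_one_left (norm_nonneg _) (pow_le_one₀ (norm_nonneg _) c.2)

/-- The valuation ring of a quaternion division algebra over `ℚ_p`. -/
def valuationOrder (hdiv : ∀ x : ℍ[ℚ_[p],a,b], x ≠ 0 → IsUnit x) :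
    Subalgebra ℤ_[p] ℍ[ℚ_[p],a,b] where
  carrier := {x | ‖nrd x‖ ≤ 1}
  mul_mem' := fun {x y} hx hy => by
    rw [Set.mem_ofPred_eq, nrd_mul, norm_mul]; exact mul_le_one₀ hx (norm_nonneg _) hy
  add_mem' := fun {x y} hx hy => norm_nrd_add_le hdiv hx hy
  algebraMap_mem' := fun c => by
    rw [Set.mem_ofPred_eq, Algebra.algebraMap_eq_smul_one]
    exact (norm_nrd_smul_le c 1).trans (by simp [nrd_one])

theorem mem_valuationOrder (hdiv : ∀ x : ℍ[ℚ_[p],a,b], x ≠ 0 → IsUnit x) {x : ℍ[ℚ_[p],a,b]} :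
    x ∈ valuationOrder hdiv ↔ ‖nrd x‖ ≤ 1 := Iff.rfl

/-- The norm is bounded on a finitely generated module by the ultrametric inequality, whereas the
powers of an element of norm greater than one have unbounded norms. -/
theorem le_valuationOrder (hdiv : ∀ x : ℍ[ℚ_[p],a,b], x ≠ 0 → IsUnit x)
    {B : Subalgebra ℤ_[p] ℍ[ℚ_[p],a,b]} (hB : (Subalgebra.toSubmodule B).FG) :
    B ≤ valuationOrder hdiv := by
  obtain ⟨s, hs⟩ := hB
  obtain ⟨C, hC⟩ : ∃ C : ℝ, ∀ x ∈ s, ‖nrd x‖ ≤ C :=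
    ⟨∑ x ∈ s, ‖nrd x‖, fun x hx =>
      Finset.single_le_sum (f := fun x => ‖nrd x‖) (fun _ _ => norm_nonneg _) hx⟩
  have hC' : ∀ x ∈ B, ‖nrd x‖ ≤ max C 0 := by
    intro x hx
    rw [← Subalgebra.mem_toSubmodule, ← hs] at hx
    induction hx using Submodule.span_induction with
    | mem x hx => exact (hC x hx).trans (le_max_left _ _)
    | zero => simp [nrd_zero]
    | add x y _ _ hx hy => exact norm_nrd_add_le hdiv hx hy
    | smul c x _ hx => exact (norm_nrd_smul_le c x).trans hx
  intro x hx
  rw [mem_valuationOrder]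
  by_contra! h
  obtain ⟨k, hk⟩ := pow_unbounded_of_one_lt (max C 0) h
  have h1 := hC' (x ^ k) (pow_mem hx k)
  have h2 : nrd (x ^ k) = nrd x ^ k := by
    clear hk h1
    induction k with
    | zero => simp [nrd_one]
    | succ k ih => rw [pow_succ, nrd_mul, ih, pow_succ]
  rw [h2, norm_pow] at h1
  exact absurd hk (not_lt.2 h1)

theorem exists_scale (s : Finset ℚ_[p]) : ∃ c : ℚ_[p], c ≠ 0 ∧ ∀ x ∈ s, ‖c * x‖ ≤ 1 := by
  classical
  induction s using Finset.induction_on with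
  | empty => exact ⟨1, one_ne_zero, by simp⟩
  | insert y s _ ih =>
    obtain ⟨c, hc, h⟩ := ih
    obtain ⟨k, hk⟩ : ∃ k : ℕ, ‖(p : ℚ_[p]) ^ k * (c * y)‖ ≤ 1 := by
      have hp0 : (0 : ℝ) < ‖(p : ℚ_[p])‖ :=
        norm_pos_iff.2 (by exact_mod_cast (Fact.out : p.Prime).ne_zero)
      obtain ⟨k, hk⟩ := exists_pow_lt_of_lt_one (y := ‖(p : ℚ_[p])‖)
        (x := (‖c * y‖ + 1)⁻¹) (by positivity) Padic.norm_p_lt_one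
      refine ⟨k, ?_⟩
      rw [norm_mul, norm_pow]
      calc ‖(p : ℚ_[p])‖ ^ k * ‖c * y‖ ≤ (‖c * y‖ + 1)⁻¹ * (‖c * y‖ + 1) := by
            gcongr; linarith
        _ = 1 := inv_mul_cancel₀ (by positivity)
    have hpk : (p : ℚ_[p]) ^ k ≠ 0 :=
      pow_ne_zero _ (by exact_mod_cast (Fact.out : p.Prime).ne_zero)
    refine ⟨p ^ k * c, mul_ne_zero hpk hc, fun x hx => ?_⟩
    rcases Finset.mem_insert.1 hx with rfl | hx
    · rw [mul_assoc]; exact hk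
    · rw [mul_assoc, norm_mul]
      refine mul_le_one₀ ?_ (norm_nonneg _) (h x hx)
      rw [norm_pow]
      exact pow_le_one₀ (norm_nonneg _) Padic.norm_p_lt_one.le

theorem fg_of_coordinates_bounded {C : ℚ_[p]} (hC : C ≠ 0) {B : Submodule ℤ_[p] ℍ[ℚ_[p],a,b]}
    (h : ∀ x ∈ B, ‖C * x.re‖ ≤ 1 ∧ ‖C * x.imI‖ ≤ 1 ∧ ‖C * x.imJ‖ ≤ 1 ∧ ‖C * x.imK‖ ≤ 1) :
    B.FG := by
  let v : Fin 4 → ℍ[ℚ_[p],a,b] :=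
    ![⟨C⁻¹, 0, 0, 0⟩, ⟨0, C⁻¹, 0, 0⟩, ⟨0, 0, C⁻¹, 0⟩, ⟨0, 0, 0, C⁻¹⟩]
  have hfg : (Submodule.span ℤ_[p] (Set.range v)).FG :=
    Submodule.fg_span (Set.finite_range v)
  refine hfg.of_le fun x hx => ?_
  obtain ⟨h0, h1, h2, h3⟩ := h x hx
  obtain ⟨c0, h0⟩ : ∃ c : ℤ_[p], (c : ℚ_[p]) = C * x.re := ⟨⟨_, h0⟩, rfl⟩
  obtain ⟨c1, h1⟩ : ∃ c : ℤ_[p], (c : ℚ_[p]) = C * x.imI := ⟨⟨_, h1⟩, rfl⟩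
  obtain ⟨c2, h2⟩ : ∃ c : ℤ_[p], (c : ℚ_[p]) = C * x.imJ := ⟨⟨_, h2⟩, rfl⟩
  obtain ⟨c3, h3⟩ : ∃ c : ℤ_[p], (c : ℚ_[p]) = C * x.imK := ⟨⟨_, h3⟩, rfl⟩
  have : x = c0 • v 0 + c1 • v 1 + c2 • v 2 + c3 • v 3 := by
    rw [padic_smul_eq, padic_smul_eq, padic_smul_eq, padic_smul_eq, h0, h1, h2, h3]
    ext <;> simp [v] <;> field_simp
  have hv : ∀ i, v i ∈ Submodule.span ℤ_[p] (Set.range v) := fun i =>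
    Submodule.subset_span (Set.mem_range_self i)
  rw [this]
  exact add_mem (add_mem (add_mem (Submodule.smul_mem _ _ (hv 0)) (Submodule.smul_mem _ _ (hv 1)))
    (Submodule.smul_mem _ _ (hv 2))) (Submodule.smul_mem _ _ (hv 3))

/-- Trace pairings with integral multiples of `1, i, j, k` recover the coordinates of an element up
to fixed factors, so the coordinates are bounded. -/
theorem valuationOrder_fg (ha : a ≠ 0) (hb : b ≠ 0)
    (hdiv : ∀ x : ℍ[ℚ_[p],a,b], x ≠ 0 → IsUnit x) :
    (Subalgebra.toSubmodule (valuationOrder hdiv)).FG := by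
  classical
  obtain ⟨c, hc, h⟩ := exists_scale ({1, a, b, a * b} : Finset ℚ_[p])
  simp only [Finset.mem_insert, Finset.mem_singleton, forall_eq_or_imp, forall_eq, mul_one] at h
  obtain ⟨h1, h2, h3, h4⟩ := h
  have m2 : ∀ {x y : ℚ_[p]}, ‖x‖ ≤ 1 → ‖y‖ ≤ 1 → ‖x * y‖ ≤ 1 := fun hx hy => by
    rw [norm_mul]; exact mul_le_one₀ hx (norm_nonneg _) hy
  have hab : a * b ≠ 0 := mul_ne_zero ha hb
  have mem : ∀ x ∈ Subalgebra.toSubmodule (valuationOrder hdiv), ∀ y : ℍ[ℚ_[p],a,b], ‖nrd y‖ ≤ 1 →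
      ‖trd (x * y)‖ ≤ 1 := fun x hx y hy =>
    norm_trd_le hdiv (by rw [nrd_mul]; exact m2 hx hy)
  refine fg_of_coordinates_bounded (C := 2 * c * (c * a) * (c * b) * (c * (a * b)))
    (by simp [ha, hb, hc]) fun x hx => ?_
  have e0 := mem x hx ⟨1, 0, 0, 0⟩ (by simp [nrd])
  have e1 := mem x hx ⟨0, c, 0, 0⟩ (by
    have := m2 h1 h2
    simp only [nrd]
    rw [← norm_neg]; ring_nf at this ⊢; exact this)
  have e2 := mem x hx ⟨0, 0, c, 0⟩ (by
    have := m2 h1 h3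
    simp only [nrd]
    rw [← norm_neg]; ring_nf at this ⊢; exact this)
  have e3 := mem x hx ⟨0, 0, 0, c⟩ (by
    have := m2 h1 h4
    simp only [nrd]
    ring_nf at this ⊢; exact this)
  have f0 : trd (x * ⟨1, 0, 0, 0⟩) = 2 * x.re := by simp [trd]
  have f1 : trd (x * ⟨0, c, 0, 0⟩) = 2 * (a * x.imI * c) := by simp [trd]
  have f2 : trd (x * ⟨0, 0, c, 0⟩) = 2 * (b * x.imJ * c) := by simp [trd]
  have f3 : trd (x * ⟨0, 0, 0, c⟩) = -(2 * (a * b * x.imK * c)) := by simp [trd]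
  rw [f0] at e0
  rw [f1] at e1
  rw [f2] at e2
  rw [f3, norm_neg] at e3
  refine ⟨?_, ?_, ?_, ?_⟩
  · have := m2 (m2 (m2 (m2 e0 h1) h2) h3) h4
    ring_nf at this ⊢; exact this
  · have := m2 (m2 (m2 e1 h1) h3) h4
    ring_nf at this ⊢; exact this
  · have := m2 (m2 (m2 e2 h1) h2) h4
    ring_nf at this ⊢; exact this
  · have := m2 (m2 (m2 e3 h1) h2) h3
    ring_nf at this ⊢; exact this

end PadicDivisionOrder
end QuatOrder
end

/-! ### Residue field and uniformizer of the valuation ring. -/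

noncomputable section
namespace QuatOrder

section PadicDivisionStructure

open scoped Quaternion

variable {p : ℕ} [Fact p.Prime]

theorem padic_p_ne_zero : (p : ℚ_[p]) ≠ 0 := by exact_mod_cast (Fact.out : p.Prime).ne_zero

theorem exists_padicInt_eq {x : ℚ_[p]} (h : ‖x‖ ≤ 1) : ∃ z : ℤ_[p], (z : ℚ_[p]) = x := ⟨⟨x, h⟩, rfl⟩

variable {a b : ℚ_[p]}

/-- Elements whose norm is divisible by `p ^ 2` are divisible by `p`. -/
theorem exists_eq_p_smul {x : ℍ[ℚ_[p],a,b]} (h : ‖nrd x‖ ≤ ‖(p : ℚ_[p])‖ ^ 2) :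
    ∃ y : ℍ[ℚ_[p],a,b], ‖nrd y‖ ≤ 1 ∧ x = (p : ℤ_[p]) • y := by
  refine ⟨(p : ℚ_[p])⁻¹ • x, ?_, ?_⟩
  · rw [nrd_smul, norm_mul, norm_pow, norm_inv]
    have : 0 < ‖(p : ℚ_[p])‖ := norm_pos_iff.2 padic_p_ne_zero
    rw [inv_pow, inv_mul_le_iff₀ (by positivity), mul_one]
    exact h
  · rw [padic_smul_eq, smul_smul]
    simp [mul_inv_cancel₀ padic_p_ne_zero]

/-- By Nakayama the valuation ring would be `ℤ_p + ℤ_p g` and hence commutative, although it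
contains nonzero multiples of `i` and `j`. -/
theorem not_forall_exists_generator (ha : a ≠ 0) (hb : b ≠ 0)
    (hdiv : ∀ x : ℍ[ℚ_[p],a,b], x ≠ 0 → IsUnit x) (g : ℍ[ℚ_[p],a,b]) :
    ¬ ∀ x : ℍ[ℚ_[p],a,b], ‖nrd x‖ ≤ 1 → ∃ c0 c1 : ℤ_[p], ∃ y : ℍ[ℚ_[p],a,b], ‖nrd y‖ ≤ 1 ∧
      x = c0 • (1 : ℍ[ℚ_[p],a,b]) + c1 • g + (p : ℤ_[p]) • y := by
  classical
  intro h
  have hle := padic_nakayama (N := Submodule.span ℤ_[p] {1, g}) (valuationOrder_fg ha hb hdiv) (by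
    intro x hx
    obtain ⟨c0, c1, y, hy, rfl⟩ := h x hx
    exact ⟨_, add_mem (Submodule.smul_mem _ _ (Submodule.subset_span (by simp)))
      (Submodule.smul_mem _ _ (Submodule.subset_span (by simp))), y, hy, rfl⟩)
  have hcomm : ∀ x y : ℍ[ℚ_[p],a,b], ‖nrd x‖ ≤ 1 → ‖nrd y‖ ≤ 1 → x * y = y * x := by
    intro x y hx hy
    obtain ⟨x0, x1, rfl⟩ := Submodule.mem_span_pair.1 (hle hx)
    obtain ⟨y0, y1, rfl⟩ := Submodule.mem_span_pair.1 (hle hy)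
    have hg : Commute g (y0 • 1 + y1 • g) :=
      ((Commute.one_right g).smul_right y0).add_right ((Commute.refl g).smul_right y1)
    exact ((Commute.one_left _).smul_left x0).add_left (hg.smul_left x1)
  obtain ⟨c, hc, hs⟩ := exists_scale ({1, a, b} : Finset ℚ_[p])
  simp only [Finset.mem_insert, Finset.mem_singleton, forall_eq_or_imp, forall_eq, mul_one] at hs
  obtain ⟨h1, h2, h3⟩ := hs
  have m2 : ∀ {x y : ℚ_[p]}, ‖x‖ ≤ 1 → ‖y‖ ≤ 1 → ‖x * y‖ ≤ 1 := fun hx hy => by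
    rw [norm_mul]; exact mul_le_one₀ hx (norm_nonneg _) hy
  have := hcomm ⟨0, c, 0, 0⟩ ⟨0, 0, c, 0⟩ (by
      have := m2 h1 h2
      simp only [nrd]
      rw [← norm_neg]; ring_nf at this ⊢; exact this) (by
      have := m2 h1 h3
      simp only [nrd]
      rw [← norm_neg]; ring_nf at this ⊢; exact this)
  have := congrArg QuaternionAlgebra.imK this
  simp at this
  have h2c : 2 * c ^ 2 = 0 := by linear_combination this
  simp [hc] at h2c

/-- The residue field of the valuation ring is not `𝔽_p`. -/
theorem exists_residue_generator (ha : a ≠ 0) (hb : b ≠ 0)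
    (hdiv : ∀ x : ℍ[ℚ_[p],a,b], x ≠ 0 → IsUnit x) :
    ∃ (w : ℍ[ℚ_[p],a,b]) (s r : ℤ_[p]), trd w = s ∧ nrd w = r ∧ IsInertPoly s r := by
  by_contra hno
  -- If no reduced polynomial is irreducible modulo `p`, every integral element is congruent to a
  -- `p`-adic integer modulo the elements of norm less than one.
  have hres : ∀ w : ℍ[ℚ_[p],a,b], ‖nrd w‖ ≤ 1 → ∃ c : ℤ_[p], ‖nrd (w - c • 1)‖ < 1 := by
    intro w hw
    obtain ⟨s, hs⟩ := exists_padicInt_eq (norm_trd_le hdiv hw)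
    obtain ⟨r, hr⟩ := exists_padicInt_eq hw
    by_contra! hc
    apply hno
    refine ⟨w, s, r, hs.symm, hr.symm, fun c hdvd => ?_⟩
    rw [padicInt_dvd_iff_norm_lt_one] at hdvd
    have := hc c
    rw [padic_smul_eq, nrd_sub_smul, ← hs, ← hr] at this
    exact absurd hdvd (not_lt.2 (by exact_mod_cast this))
  -- With `g` of norm valuation one, expanding twice gives `x = c0 + c1 g + g² z`, and `g² z` is
  -- divisible by `p`. Without such a `g`, a norm of positive valuation is divisible by `p²`, so `x
  -- = c0 + p y` already. Both contradict `not_forall_exists_generator`.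
  by_cases hpi : ∃ g : ℍ[ℚ_[p],a,b], ‖nrd g‖ = ‖(p : ℚ_[p])‖
  · obtain ⟨g, hg⟩ := hpi
    have hg0 : nrd g ≠ 0 := by
      rw [← norm_ne_zero_iff, hg, norm_ne_zero_iff]; exact padic_p_ne_zero
    have step : ∀ x : ℍ[ℚ_[p],a,b], ‖nrd x‖ ≤ 1 → ∃ (c : ℤ_[p]) (y : ℍ[ℚ_[p],a,b]),
        ‖nrd y‖ ≤ 1 ∧ x = c • 1 + g * y := by
      intro x hx
      obtain ⟨c, hc⟩ := hres x hx
      obtain ⟨y, hy, hy1⟩ := exists_mul_eq_of_norm_nrd_le hg0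
        ((padic_norm_le_inv_of_lt_one hc).trans hg.ge)
      exact ⟨c, y, hy1, by rw [← hy]; abel⟩
    apply not_forall_exists_generator ha hb hdiv g
    intro x hx
    obtain ⟨c0, y, hy, rfl⟩ := step x hx
    obtain ⟨c1, z, hz, rfl⟩ := step y hy
    obtain ⟨z', hz', hzz⟩ := exists_eq_p_smul (x := g * (g * z)) (by
      rw [nrd_mul, nrd_mul, norm_mul, norm_mul, hg, ← mul_assoc, ← sq]
      exact mul_le_of_le_one_right (by positivity) hz)
    refine ⟨c0, c1, z', hz', ?_⟩
    rw [← hzz, mul_add, mul_smul_comm, mul_one, add_assoc]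
  · apply not_forall_exists_generator ha hb hdiv 0
    intro x hx
    obtain ⟨c, hc⟩ := hres x hx
    have hlt : ‖nrd (x - c • 1)‖ ≤ ‖(p : ℚ_[p])‖ ^ 2 := by
      obtain ⟨z, hz⟩ := exists_padicInt_eq hc.le
      rw [← hz, ← PadicInt.norm_def, PadicInt.norm_lt_one_iff_dvd] at hc
      obtain ⟨z', rfl⟩ := hc
      rw [← hz]
      push_cast
      rw [norm_mul, sq]
      refine mul_le_mul_of_nonneg_left ?_ (norm_nonneg _)
      apply padic_norm_le_inv_of_lt_one
      refine lt_of_le_of_ne z'.2 fun h1 => hpi ⟨x - c • 1, ?_⟩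
      rw [← hz]; push_cast
      rw [norm_mul, ← PadicInt.norm_def] at *
      rw [h1, mul_one]
    obtain ⟨y, hy, hxy⟩ := exists_eq_p_smul hlt
    exact ⟨c, 0, y, hy, by rw [← hxy]; simp⟩

theorem not_scalar_of_inert {w : ℍ[ℚ_[p],a,b]} {s r : ℤ_[p]} (hs : trd w = s) (hr : nrd w = r)
    (h : IsInertPoly s r) (c : ℚ_[p]) : w ≠ c • (1 : ℍ[ℚ_[p],a,b]) := by
  rintro rfl
  rw [nrd_smul, nrd_one, mul_one] at hr
  rw [trd_smul, trd_one] at hs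
  have hc : ‖c‖ ≤ 1 := by
    by_contra! hc
    have h1 : ‖c ^ 2‖ ≤ 1 := by rw [hr]; exact r.2
    rw [norm_pow] at h1
    exact absurd h1 (not_le.2 (one_lt_pow₀ hc two_ne_zero))
  obtain ⟨c, rfl⟩ := exists_padicInt_eq hc
  apply h c
  have : c ^ 2 - s * c + r = 0 := by
    have h1 : s = c * 2 := PadicInt.ext (by rw [← hs]; push_cast; rfl)
    have h2 : r = c ^ 2 := PadicInt.ext (by rw [← hr]; push_cast; rfl)
    rw [h1, h2]; ring
  rw [this]; exact dvd_zero _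

/-- The norm form of the unramified extension only takes values of even valuation. -/
theorem norm_normForm {s r : ℤ_[p]} (h : IsInertPoly s r) (x y : ℚ_[p]) :
    ‖x ^ 2 + s * x * y + r * y ^ 2‖ = max ‖x‖ ‖y‖ ^ 2 := by
  have unit : ∀ u v : ℤ_[p], ¬ ((p : ℤ_[p]) ∣ u ∧ (p : ℤ_[p]) ∣ v) →
      ‖(u : ℚ_[p]) ^ 2 + s * u * v + r * v ^ 2‖ = 1 := by
    intro u v huv
    have : ¬ (p : ℤ_[p]) ∣ u ^ 2 + s * u * v + r * v ^ 2 :=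
      fun hd => huv (h.dvd_of_dvd_norm hd)
    rw [← padicInt_isUnit_iff_not_dvd, PadicInt.isUnit_iff, PadicInt.norm_def] at this
    exact_mod_cast this
  have hone : ¬ (p : ℤ_[p]) ∣ 1 := by
    rw [← padicInt_isUnit_iff_not_dvd]; exact isUnit_one
  rcases le_total ‖y‖ ‖x‖ with hxy | hxy
  · rw [max_eq_left hxy]
    by_cases hx : x = 0
    · have : y = 0 := by simpa [hx] using hxy
      simp [hx, this]
    obtain ⟨c, hc⟩ := exists_padicInt_eq (x := y / x) (by
      rw [norm_div]; exact div_le_one_of_le₀ hxy (norm_nonneg _))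
    have hy : y = x * c := by rw [hc]; field_simp
    have := unit 1 c (fun h => hone h.1)
    push_cast at this
    rw [hy, ← norm_pow, show x ^ 2 + s * x * (x * c) + r * (x * c) ^ 2
      = x ^ 2 * (1 ^ 2 + s * 1 * c + r * (c : ℚ_[p]) ^ 2) by ring, norm_mul, this, mul_one]
  · rw [max_eq_right hxy]
    by_cases hy : y = 0
    · have : x = 0 := by simpa [hy] using hxy
      simp [hy, this]
    obtain ⟨c, hc⟩ := exists_padicInt_eq (x := x / y) (by
      rw [norm_div]; exact div_le_one_of_le₀ hxy (norm_nonneg _))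
    have hx : x = y * c := by rw [hc]; field_simp
    have := unit c 1 (fun h => hone h.2)
    push_cast at this
    rw [hx, ← norm_pow, show (y * c) ^ 2 + s * (y * c) * y + r * y ^ 2
      = y ^ 2 * ((c : ℚ_[p]) ^ 2 + s * c * 1 + r * 1 ^ 2) by ring, norm_mul, this, mul_one]

/-- A uniformizer `j` acting on the unramified extension `ℚ_p(w)` by conjugation. -/
structure IsTwist (w j : ℍ[ℚ_[p],a,b]) : Prop where
  mul_eq : j * w = star w * j
  norm_nrd : ‖nrd j‖ = ‖(p : ℚ_[p])‖
  trd_eq : trd j = 0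

/-- Conjugation by `w - w̄`, which is nonzero and anticommutes with `j`, preserves the trace but
negates `j`. -/
theorem trd_eq_zero_of_mul_eq {w j : ℍ[ℚ_[p],a,b]} (hw : ∀ c : ℚ_[p], w ≠ c • (1 : ℍ[ℚ_[p],a,b]))
    (hdiv : ∀ x : ℍ[ℚ_[p],a,b], x ≠ 0 → IsUnit x) (h : j * w = star w * j) : trd j = 0 := by
  have hd : nrd (w - star w) ≠ 0 := by
    intro h0
    have := nrd_eq_zero_of_division hdiv h0
    rw [star_eq_trd, sub_eq_zero, eq_sub_iff_add_eq, ← two_smul ℚ_[p]] at this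
    apply hw (2⁻¹ * trd w)
    rw [mul_smul, ← this, smul_smul, inv_mul_cancel₀ two_ne_zero, one_smul]
  have h' : j * star w = w * j := by
    rw [star_eq_trd] at h ⊢
    rw [mul_sub, h, sub_mul, mul_smul_comm, smul_mul_assoc, mul_one, one_mul]; abel
  have hj : (w - star w) * j = -(j * (w - star w)) := by
    rw [sub_mul, mul_sub, h, h']; abel
  have h1 : trd ((w - star w) * j * star (w - star w)) = nrd (w - star w) * trd j := by
    rw [trd_mul_comm, ← mul_assoc, star_mul_eq, smul_mul_assoc, one_mul, trd_smul]
  have h2 : trd ((w - star w) * j * star (w - star w)) = -(nrd (w - star w) * trd j) := by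
    rw [hj, neg_mul, mul_assoc, mul_star_eq, mul_smul_comm, mul_one, ← neg_smul, trd_smul, neg_mul]
  have h3 : 2 * (nrd (w - star w) * trd j) = 0 := by linear_combination h2 - h1
  simpa [hd] using h3

theorem trd_mul_eq_zero {w j : ℍ[ℚ_[p],a,b]} (hj : trd j = 0) (h : j * w = star w * j) :
    trd (w * j) = 0 := by
  have h1 : trd (w * j) = trd (star w * j) := by rw [trd_mul_comm, h]
  rw [star_eq_trd, sub_mul, smul_mul_assoc, one_mul] at h1
  have h2 : trd (trd w • j - w * j) = trd w * trd j - trd (w * j) := by simp [trd]; ring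
  rw [h2, hj, mul_zero, zero_sub] at h1
  have : 2 * trd (w * j) = 0 := by linear_combination h1
  simpa using this

/-- The planes spanned by `1, w` and by `j, wj` are orthogonal for the norm form: the cross terms
are combinations of `trd j` and `trd (w j)`, both zero. -/
theorem nrd_coordinates {w j : ℍ[ℚ_[p],a,b]} (hj : trd j = 0) (h : j * w = star w * j)
    (x y z u : ℚ_[p]) :
    nrd (x • 1 + y • w + z • j + u • (w * j)) = (x ^ 2 + trd w * x * y + nrd w * y ^ 2) +
      nrd j * (z ^ 2 + trd w * z * u + nrd w * u ^ 2) := by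
  have h1 := trd_mul_eq_zero hj h
  have h2 : trd (w * (w * j)) = 0 := by
    rw [← mul_assoc, mul_self_eq, sub_mul, smul_mul_assoc, smul_mul_assoc, one_mul]
    have : trd (trd w • (w * j) - nrd w • j) = trd w * trd (w * j) - nrd w * trd j := by
      simp [trd]; ring
    rw [this, h1, hj]; ring
  rw [trd] at hj
  have hj0 : j.re = 0 := by simpa using hj
  have expand : nrd (x • 1 + y • w + z • j + u • (w * j)) =
      (x ^ 2 + trd w * x * y + nrd w * y ^ 2) + nrd j * (z ^ 2 + trd w * z * u + nrd w * u ^ 2)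
      + (x * z * (2 * j.re) + x * u * trd (w * j) - y * z * (trd (w * j) - trd w * 2 * j.re)
      + y * u * nrd w * 2 * j.re) := by
    simp [nrd, trd]
    ring
  rw [expand, h1, hj0]
  ring

/-- Some `u` conjugates `w` to `w̄`, and scaling by powers of `p` brings the valuation of its norm
to `0` or `1`. In the first case `-nrd j` is a unit, hence the norm of some `α` in `ℤ_p[w]`. Then `α
+ j` has norm zero, so `j = -α` commutes with `w`, which would make `w` scalar. -/
theorem exists_twist (ha : a ≠ 0) (hdiv : ∀ x : ℍ[ℚ_[p],a,b], x ≠ 0 → IsUnit x)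
    {w : ℍ[ℚ_[p],a,b]} {s r : ℤ_[p]} (hs : trd w = s) (hr : nrd w = r) (h : IsInertPoly s r) :
    ∃ j, IsTwist w j := by
  have hw := not_scalar_of_inert hs hr h
  have hsw : ∀ c : ℚ_[p], star w ≠ c • (1 : ℍ[ℚ_[p],a,b]) := by
    intro c hc
    rw [star_eq_trd, sub_eq_iff_eq_add'] at hc
    apply hw (trd w - c)
    rw [sub_smul, hc]; abel
  obtain ⟨u, hu0, hu⟩ := exists_conj (x := w) (x' := star w) two_ne_zero ha (by simp [trd])
    (nrd_star w).symm hsw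
  have hn0 : nrd u ≠ 0 := fun h0 => hu0 (nrd_eq_zero_of_division hdiv h0)
  have hscale : ∀ c : ℚ_[p], (c • u) * w = star w * (c • u) := by
    intro c; rw [smul_mul_assoc, hu, mul_smul_comm]
  -- normalize the valuation
  obtain ⟨k, hk⟩ : ∃ k : ℤ, ‖((p : ℚ_[p]) ^ k) ^ 2 * nrd u‖ = 1 ∨
      ‖((p : ℚ_[p]) ^ k) ^ 2 * nrd u‖ = ‖(p : ℚ_[p])‖ := by
    have hp0 : (p : ℝ) ≠ 0 := by exact_mod_cast (Fact.out : p.Prime).ne_zero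
    obtain ⟨m, hm⟩ := Int.even_or_odd' (nrd u).valuation
    refine ⟨-m, ?_⟩
    rw [norm_mul, norm_pow, Padic.norm_p_zpow, Padic.norm_eq_zpow_neg_valuation hn0, Padic.norm_p,
      ← zpow_natCast, ← zpow_mul, ← zpow_add₀ hp0]
    rcases hm with hm | hm
    · left; rw [hm]; convert zpow_zero _ using 2; push_cast; ring
    · right; rw [hm, ← zpow_neg_one]; congr 1; push_cast; ring
  have hj := hscale ((p : ℚ_[p]) ^ k)
  rw [← nrd_smul] at hk
  generalize (p : ℚ_[p]) ^ k • u = j at hj hk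
  have htj := trd_eq_zero_of_mul_eq hw hdiv hj
  refine ⟨j, hj, hk.resolve_left fun h1 => ?_, htj⟩
  obtain ⟨v, hv⟩ := exists_padicInt_eq (x := -nrd j) (by rw [norm_neg]; exact h1.le)
  have hvu : IsUnit v := by
    rw [PadicInt.isUnit_iff, PadicInt.norm_def, hv, norm_neg]; exact h1
  obtain ⟨x, y, hxy⟩ := h.exists_norm_eq hvu
  have hz := nrd_coordinates htj hj x y 1 0
  have hxy' : (x : ℚ_[p]) ^ 2 + s * x * y + r * y ^ 2 = -nrd j := by
    rw [← hv, ← hxy]; push_cast; rfl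
  rw [hs, hr, hxy'] at hz
  have hz0 := nrd_eq_zero_of_division hdiv (hz.trans (by ring))
  have hjw : j = -((x : ℚ_[p]) • 1 + (y : ℚ_[p]) • w) := by
    rw [eq_neg_iff_add_eq_zero, ← hz0]; simp; abel
  have hcomm : j * w = w * j := by
    rw [hjw]; simp [add_mul, mul_add]
  rw [hcomm] at hj
  have hju : IsUnit j := hdiv j (by rintro rfl; simp [nrd_zero] at h1)
  have := hju.mul_right_cancel hj
  rw [star_eq_trd, eq_sub_iff_add_eq, ← two_smul ℚ_[p]] at this
  apply hw (2⁻¹ * trd w)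
  rw [mul_smul, ← this, smul_smul, inv_mul_cancel₀ two_ne_zero, one_smul]

end PadicDivisionStructure
end QuatOrder
end

/-! ### Quadratic orders inside the division algebra. -/

noncomputable section
namespace QuatOrder

section PadicDivisionTheorems

open scoped Quaternion

variable {p : ℕ} [Fact p.Prime] {a b : ℚ_[p]}

/-- The first summand has even valuation and the second odd valuation, so unless one vanishes their
norms differ and no cancellation occurs. -/
theorem norm_add_eq_max_of_parity {A B c : ℚ_[p]} {M N : ℝ} (hM : ∃ x : ℚ_[p], M = ‖x‖)
    (hN : ∃ x : ℚ_[p], N = ‖x‖) (hA : ‖A‖ = M ^ 2) (hB : ‖B‖ = N ^ 2) (hc : ‖c‖ = ‖(p : ℚ_[p])‖) :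
    ‖A + c * B‖ = max (M ^ 2) (‖(p : ℚ_[p])‖ * N ^ 2) := by
  have hcB : ‖c * B‖ = ‖(p : ℚ_[p])‖ * N ^ 2 := by rw [norm_mul, hc, hB]
  rw [← hA, ← hcB]
  by_cases hB0 : B = 0
  · simp [hB0]
  apply Padic.add_eq_max_of_ne
  rw [hcB, hA]
  obtain ⟨x, rfl⟩ := hM
  obtain ⟨y, rfl⟩ := hN
  have hp0 : (p : ℝ) ≠ 0 := by exact_mod_cast (Fact.out : p.Prime).ne_zero
  have hp1 : (1 : ℝ) < p := by exact_mod_cast (Fact.out : p.Prime).one_lt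
  have hy : y ≠ 0 := by
    rintro rfl
    simp at hB; exact hB0 hB
  intro h
  by_cases hx : x = 0
  · rw [hx, norm_zero, zero_pow two_ne_zero, eq_comm, mul_eq_zero] at h
    rcases h with h | h
    · exact padic_p_ne_zero (norm_eq_zero.1 h)
    · exact hy (norm_eq_zero.1 (pow_eq_zero_iff two_ne_zero |>.1 h))
  · rw [Padic.norm_eq_zpow_neg_valuation hx, Padic.norm_eq_zpow_neg_valuation hy, Padic.norm_p,
      ← zpow_natCast, ← zpow_natCast, ← zpow_mul, ← zpow_mul, ← zpow_neg_one, ← zpow_add₀ hp0,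
      zpow_right_inj₀ (by linarith) hp1.ne'] at h
    push_cast at h
    omega

variable {w j : ℍ[ℚ_[p],a,b]} {s r : ℤ_[p]}

theorem IsTwist.norm_nrd_coordinates (hj : IsTwist w j) (hs : trd w = s) (hr : nrd w = r)
    (h : IsInertPoly s r) (x y z u : ℚ_[p]) :
    ‖nrd (x • 1 + y • w + z • j + u • (w * j))‖ =
      max (max ‖x‖ ‖y‖ ^ 2) (‖(p : ℚ_[p])‖ * max ‖z‖ ‖u‖ ^ 2) := by
  rw [nrd_coordinates hj.trd_eq hj.mul_eq, hs, hr]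
  have hmax : ∀ x y : ℚ_[p], ∃ z : ℚ_[p], max ‖x‖ ‖y‖ = ‖z‖ := fun x y => by
    rcases max_choice ‖x‖ ‖y‖ with h | h
    · exact ⟨x, h⟩
    · exact ⟨y, h⟩
  exact norm_add_eq_max_of_parity (hmax x y) (hmax z u) (norm_normForm h x y) (norm_normForm h z u)
    hj.norm_nrd

/-- The norm formula shows that only the zero combination of `1, w, j, wj` has norm zero, so these
four elements are independent and form a basis. -/
theorem IsTwist.exists_coordinates (hj : IsTwist w j) (hs : trd w = s) (hr : nrd w = r)
    (h : IsInertPoly s r) (v : ℍ[ℚ_[p],a,b]) :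
    ∃ x y z u : ℚ_[p], v = x • 1 + y • w + z • j + u • (w * j) := by
  let f : Fin 4 → ℍ[ℚ_[p],a,b] := ![1, w, j, w * j]
  have hp : 0 < ‖(p : ℚ_[p])‖ := norm_pos_iff.2 padic_p_ne_zero
  have hf : LinearIndependent ℚ_[p] f := by
    rw [Fintype.linearIndependent_iff]
    intro g hg
    simp only [Fin.sum_univ_four, f, Matrix.cons_val] at hg
    have h0 := hj.norm_nrd_coordinates hs hr h (g 0) (g 1) (g 2) (g 3)
    rw [hg, nrd_zero, norm_zero] at h0
    have h1 : max ‖g 0‖ ‖g 1‖ ^ 2 ≤ 0 := (le_max_left _ _).trans h0.symm.le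
    have h2 : ‖(p : ℚ_[p])‖ * max ‖g 2‖ ‖g 3‖ ^ 2 ≤ 0 := (le_max_right _ _).trans h0.symm.le
    have h3 : max ‖g 0‖ ‖g 1‖ = 0 := pow_eq_zero_iff two_ne_zero |>.1 (le_antisymm h1 (by positivity))
    have h4 : max ‖g 2‖ ‖g 3‖ = 0 := by
      have := le_antisymm h2 (by positivity)
      exact pow_eq_zero_iff two_ne_zero |>.1 ((mul_eq_zero.1 this).resolve_left hp.ne')
    have key : ∀ x y : ℚ_[p], max ‖x‖ ‖y‖ = 0 → x = 0 ∧ y = 0 := fun x y hxy =>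
      ⟨norm_le_zero_iff.1 ((le_max_left _ _).trans hxy.le),
        norm_le_zero_iff.1 ((le_max_right _ _).trans hxy.le)⟩
    intro i
    fin_cases i
    · exact (key _ _ h3).1
    · exact (key _ _ h3).2
    · exact (key _ _ h4).1
    · exact (key _ _ h4).2
  have hspan := hf.span_eq_top_of_card_eq_finrank (by
    rw [QuaternionAlgebra.finrank_eq_four, Fintype.card_fin])
  have hv : v ∈ Submodule.span ℚ_[p] (Set.range f) := hspan ▸ Submodule.mem_top
  obtain ⟨c, hc⟩ := (Submodule.mem_span_range_iff_exists_fun ℚ_[p]).1 hv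
  refine ⟨c 0, c 1, c 2, c 3, ?_⟩
  rw [← hc, Fin.sum_univ_four]
  simp only [f, Matrix.cons_val]

theorem IsTwist.exists_integral_coordinates (hj : IsTwist w j) (hs : trd w = s) (hr : nrd w = r)
    (h : IsInertPoly s r) {v : ℍ[ℚ_[p],a,b]} (hv : ‖nrd v‖ ≤ 1) :
    ∃ x y z u : ℤ_[p], v = x • (1 : ℍ[ℚ_[p],a,b]) + y • w + z • j + u • (w * j) := by
  obtain ⟨x, y, z, u, rfl⟩ := hj.exists_coordinates hs hr h v
  rw [hj.norm_nrd_coordinates hs hr h] at hv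
  have h1 := (le_max_left _ _).trans hv
  have h2 := (le_max_right _ _).trans hv
  have h1' : max ‖x‖ ‖y‖ ≤ 1 := (sq_le_one_iff₀ (by positivity)).1 h1
  -- The valuation `2 v(z) + 1` is odd, so it is nonnegative only if `v(z)` is.
  have hlow : ∀ z : ℚ_[p], ‖(p : ℚ_[p])‖ * ‖z‖ ^ 2 ≤ 1 → ‖z‖ ≤ 1 := by
    intro z hz
    by_contra! hz1
    have hpz : ‖(p : ℚ_[p]) * z‖ < 1 := by
      rw [norm_mul]
      have h3 : ‖(p : ℚ_[p])‖ * ‖z‖ < ‖(p : ℚ_[p])‖ * ‖z‖ ^ 2 := by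
        have hp : 0 < ‖(p : ℚ_[p])‖ := norm_pos_iff.2 padic_p_ne_zero
        gcongr
        nlinarith
      linarith
    have := padic_norm_le_inv_of_lt_one hpz
    rw [norm_mul] at this
    have hp : 0 < ‖(p : ℚ_[p])‖ := norm_pos_iff.2 padic_p_ne_zero
    exact absurd ((mul_le_iff_le_one_right hp).1 this) (not_le.2 hz1)
  have h2' : ‖z‖ ≤ 1 ∧ ‖u‖ ≤ 1 := by
    constructor
    · refine hlow z (le_trans ?_ h2); gcongr; exact le_max_left _ _
    · refine hlow u (le_trans ?_ h2); gcongr; exact le_max_right _ _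
  obtain ⟨x, rfl⟩ := exists_padicInt_eq ((le_max_left _ _).trans h1')
  obtain ⟨y, rfl⟩ := exists_padicInt_eq ((le_max_right _ _).trans h1')
  obtain ⟨z, rfl⟩ := exists_padicInt_eq h2'.1
  obtain ⟨u, rfl⟩ := exists_padicInt_eq h2'.2
  exact ⟨x, y, z, u, by simp only [padic_smul_eq]⟩

theorem IsTwist.norm_nrd_lt (hj : IsTwist w j) (hr : nrd w = r) (z u : ℤ_[p])
    (hdiv : ∀ x : ℍ[ℚ_[p],a,b], x ≠ 0 → IsUnit x) :
    ‖nrd (z • j + u • (w * j))‖ < 1 := by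
  have hjlt : ‖nrd j‖ < 1 := by rw [hj.norm_nrd]; exact Padic.norm_p_lt_one
  refine norm_nrd_add_lt hdiv ((norm_nrd_smul_le z j).trans_lt hjlt)
    ((norm_nrd_smul_le u _).trans_lt ?_)
  rw [nrd_mul, norm_mul, hr]
  exact (mul_le_of_le_one_left (norm_nonneg _) r.2).trans_lt hjlt

/-- Squares of commutators of integral elements are divisible by `p`. -/
theorem commutator_sq_dvd (ha : a ≠ 0) (hb : b ≠ 0)
    (hdiv : ∀ x : ℍ[ℚ_[p],a,b], x ≠ 0 → IsUnit x) {x y : ℍ[ℚ_[p],a,b]} (hx : ‖nrd x‖ ≤ 1)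
    (hy : ‖nrd y‖ ≤ 1) :
    ∃ z : ℍ[ℚ_[p],a,b], ‖nrd z‖ ≤ 1 ∧ (x * y - y * x) * (x * y - y * x) = (p : ℤ_[p]) • z := by
  obtain ⟨w, s, r, hs, hr, h⟩ := exists_residue_generator ha hb hdiv
  obtain ⟨j, hj⟩ := exists_twist ha hdiv hs hr h
  -- The residue ring is commutative: modulo elements of norm less than one, `x` and `y` lie in
  -- `ℤ_p[w]`.
  have hlt : ‖nrd (x * y - y * x)‖ < 1 := by
    obtain ⟨x0, x1, x2, x3, hx'⟩ := hj.exists_integral_coordinates hs hr h hx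
    obtain ⟨y0, y1, y2, y3, hy'⟩ := hj.exists_integral_coordinates hs hr h hy
    have hX := hj.norm_nrd_lt hr x2 x3 hdiv
    have hY := hj.norm_nrd_lt hr y2 y3 hdiv
    rw [add_assoc] at hx' hy'
    generalize x2 • j + x3 • (w * j) = X at hx' hX
    generalize y2 • j + y3 • (w * j) = Y at hy' hY
    have hA : ‖nrd (x0 • 1 + x1 • w)‖ ≤ 1 := by
      have : x0 • 1 + x1 • w = x + -X := by rw [hx']; abel
      rw [this]
      exact norm_nrd_add_le hdiv hx (by rw [nrd_neg]; exact hX.le)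
    have hg : Commute w (y0 • 1 + y1 • w) :=
      ((Commute.one_right w).smul_right y0).add_right ((Commute.refl w).smul_right y1)
    have hc : Commute (x0 • 1 + x1 • w) (y0 • 1 + y1 • w) :=
      ((Commute.one_left _).smul_left x0).add_left (hg.smul_left x1)
    generalize x0 • 1 + x1 • w = A at hx' hA hc
    have : x * y - y * x = (A * Y + -(Y * A)) + (X * y + -(y * X)) := by
      have h1 : x * y = A * y + X * y := by nth_rewrite 1 [hx']; rw [add_mul]
      have h2 : y * x = y * A + y * X := by nth_rewrite 1 [hx']; rw [mul_add]
      have h3 : A * y = A * (y0 • 1 + y1 • w) + A * Y := by rw [hy', mul_add]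
      have h4 : y * A = (y0 • 1 + y1 • w) * A + Y * A := by rw [hy', add_mul]
      rw [h1, h2, h3, h4, hc.eq]; abel
    rw [this]
    have m1 : ∀ {u v : ℍ[ℚ_[p],a,b]}, ‖nrd u‖ ≤ 1 → ‖nrd v‖ < 1 → ‖nrd (u * v)‖ < 1 := by
      intro u v hu hv
      rw [nrd_mul, norm_mul]
      exact (mul_le_of_le_one_left (norm_nonneg _) hu).trans_lt hv
    have m2 : ∀ {u v : ℍ[ℚ_[p],a,b]}, ‖nrd u‖ ≤ 1 → ‖nrd v‖ < 1 → ‖nrd (v * u)‖ < 1 := by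
      intro u v hu hv
      rw [nrd_mul, norm_mul]
      exact (mul_le_of_le_one_right (norm_nonneg _) hu).trans_lt hv
    exact norm_nrd_add_lt hdiv (norm_nrd_add_lt hdiv (m1 hA hY) (by rw [nrd_neg]; exact m2 hA hY))
      (norm_nrd_add_lt hdiv (m2 hy hX) (by rw [nrd_neg]; exact m1 hy hX))
  apply exists_eq_p_smul
  rw [nrd_mul, norm_mul, sq]
  have := padic_norm_le_inv_of_lt_one hlt
  gcongr

/-- Inert discriminants differ by a square `m²`, so a combination of `1` and `w`, with `w` scaled by
`m`, has the prescribed trace and norm. -/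
theorem exists_root_of_division_inert (ha : a ≠ 0) (hb : b ≠ 0)
    (hdiv : ∀ x : ℍ[ℚ_[p],a,b], x ≠ 0 → IsUnit x) {t n : ℤ_[p]} (hi : IsInertPoly t n) :
    ∃ θ : ℍ[ℚ_[p],a,b], trd θ = t ∧ nrd θ = n ∧ ∀ c : ℚ_[p], θ ≠ c • (1 : ℍ[ℚ_[p],a,b]) := by
  obtain ⟨w, s, r, hs, hr, h⟩ := exists_residue_generator ha hb hdiv
  have hw := not_scalar_of_inert hs hr h
  obtain ⟨m, hm⟩ := h.exists_disc_eq hi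
  have hm' : (m : ℚ_[p]) ^ 2 * (s ^ 2 - 4 * r) = t ^ 2 - 4 * n := by
    exact_mod_cast congrArg (fun z : ℤ_[p] => (z : ℚ_[p])) hm
  have hm0 : (m : ℚ_[p]) ≠ 0 := by
    intro h0
    apply hi.not_dvd_disc
    have : m = 0 := PadicInt.ext (by rw [h0]; rfl)
    rw [← hm, this]; simp
  refine ⟨(((t : ℚ_[p]) - m * s) / 2) • 1 + (m : ℚ_[p]) • w, ?_, ?_, fun c hc => ?_⟩
  · rw [trd_add, trd_smul, trd_smul, trd_one, hs]; ring
  · have : nrd ((((t : ℚ_[p]) - m * s) / 2) • 1 + (m : ℚ_[p]) • w) =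
      (((t : ℚ_[p]) - m * s) / 2) ^ 2 + (((t : ℚ_[p]) - m * s) / 2) * m * trd w
        + m ^ 2 * nrd w := by simp [nrd, trd]; ring
    rw [this, hs, hr]
    linear_combination (-1 / 4 : ℚ_[p]) * hm'
  · apply hw ((m : ℚ_[p])⁻¹ * (c - ((t : ℚ_[p]) - m * s) / 2))
    rw [mul_smul, sub_smul, ← hc, add_sub_cancel_left, smul_smul, inv_mul_cancel₀ hm0, one_smul]

/-- The root is sought as `c + p(x + yw) + γ j` with `γ` in `ℤ_p[w]`. With `2c - t = p d`, the trace
condition is `trd (x + yw) = -d`. The norm condition then prescribes `nrd γ` to be a unit, and every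
unit is a norm from `ℤ_p[w]`. -/
theorem exists_root_of_division_ramified (ha : a ≠ 0) (hb : b ≠ 0)
    (hdiv : ∀ x : ℍ[ℚ_[p],a,b], x ≠ 0 → IsUnit x) {t n : ℤ_[p]} (hm : IsMaximalPoly t n)
    (hi : ¬ IsInertPoly t n) (hsp : ¬ IsSplitPoly t n) :
    ∃ θ : ℍ[ℚ_[p],a,b], trd θ = t ∧ nrd θ = n ∧ ∀ c : ℚ_[p], θ ≠ c • (1 : ℍ[ℚ_[p],a,b]) := by
  obtain ⟨w, s, r, hs, hr, h⟩ := exists_residue_generator ha hb hdiv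
  obtain ⟨c, hc, hc2⟩ := exists_dvd_not_sq_dvd hm hi
  have hd : (p : ℤ_[p]) ∣ 2 * c - t := by
    by_contra h; exact hsp ⟨c, hc, h⟩
  obtain ⟨u, hu, huc⟩ := exists_eq_p_mul_unit hc hc2
  obtain ⟨j, hj⟩ := exists_twist ha hdiv hs hr h
  obtain ⟨d, hd⟩ := hd
  -- The trace of `ℤ_p[w]` is surjective: `2` is a unit for odd `p`, and `s` is a unit for `p = 2`.
  obtain ⟨x, y, hxy⟩ : ∃ x y : ℤ_[p], 2 * x + s * y = -d := by
    by_cases hp : p = 2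
    · subst hp
      have hsu := (padicInt_isUnit_iff_not_dvd s).2 (by
        exact_mod_cast (exists_norm_mod_two_odd h).1)
      obtain ⟨v, hv⟩ := hsu.exists_right_inv
      exact ⟨0, -d * v, by linear_combination (-d) * hv⟩
    · obtain ⟨v, hv⟩ := ((padicInt_isUnit_iff_not_dvd 2).2
        (not_dvd_two_of_odd hp)).exists_right_inv
      exact ⟨-d * v, 0, by linear_combination (-d) * hv⟩
  -- it remains to solve `N(γ) nrd j = f(c) - N(α)`
  obtain ⟨v, hv⟩ := exists_padicInt_eq (x := nrd j / (p : ℚ_[p])) (by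
    rw [norm_div, hj.norm_nrd, div_self (norm_ne_zero_iff.2 padic_p_ne_zero)])
  have hvu : IsUnit v := by
    rw [PadicInt.isUnit_iff, PadicInt.norm_def, hv, norm_div, hj.norm_nrd,
      div_self (norm_ne_zero_iff.2 padic_p_ne_zero)]
  obtain ⟨v', hv'⟩ := hvu.exists_right_inv
  have hv'u : IsUnit v' := IsUnit.of_mul_eq_one v (by rw [mul_comm]; exact hv')
  have hN : IsUnit ((u - (p : ℤ_[p]) * (x ^ 2 + s * x * y + r * y ^ 2)) * v') := by
    refine IsUnit.mul ?_ hv'u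
    rw [padicInt_isUnit_iff_not_dvd] at hu ⊢
    intro hdv
    exact hu ((dvd_sub_left (dvd_mul_right _ _)).1 hdv)
  obtain ⟨z, z', hz⟩ := h.exists_norm_eq hN
  have hnj : nrd j = (p : ℚ_[p]) * v := by rw [hv]; field_simp [padic_p_ne_zero (p := p)]
  have e1 : (2 : ℚ_[p]) * x + s * y = -d := by
    exact_mod_cast congrArg (fun z : ℤ_[p] => (z : ℚ_[p])) hxy
  have e2 : (2 : ℚ_[p]) * c - t = p * d := by
    exact_mod_cast congrArg (fun z : ℤ_[p] => (z : ℚ_[p])) hd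
  have e3 : (c : ℚ_[p]) ^ 2 - t * c + n = p * u := by
    exact_mod_cast congrArg (fun z : ℤ_[p] => (z : ℚ_[p])) huc
  have e4 : (z : ℚ_[p]) ^ 2 + s * z * z' + r * z' ^ 2 =
      (u - (p : ℚ_[p]) * (x ^ 2 + s * x * y + r * y ^ 2)) * v' := by
    exact_mod_cast congrArg (fun z : ℤ_[p] => (z : ℚ_[p])) hz
  have e5 : (v : ℚ_[p]) * v' = 1 := by
    exact_mod_cast congrArg (fun z : ℤ_[p] => (z : ℚ_[p])) hv'
  have ht : trd (((c : ℚ_[p]) + (p : ℚ_[p]) * x) • (1 : ℍ[ℚ_[p],a,b])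
      + ((p : ℚ_[p]) * y) • w + (z : ℚ_[p]) • j + (z' : ℚ_[p]) • (w * j)) = t := by
    rw [trd_add, trd_add, trd_add, trd_smul, trd_smul, trd_smul, trd_smul, trd_one, hs,
      hj.trd_eq, trd_mul_eq_zero hj.trd_eq hj.mul_eq]
    linear_combination (p : ℚ_[p]) * e1 + e2
  have hn : nrd (((c : ℚ_[p]) + (p : ℚ_[p]) * x) • (1 : ℍ[ℚ_[p],a,b])
      + ((p : ℚ_[p]) * y) • w + (z : ℚ_[p]) • j + (z' : ℚ_[p]) • (w * j)) = n := by
    rw [nrd_coordinates hj.trd_eq hj.mul_eq, hs, hr, e4, hnj]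
    linear_combination ((p : ℚ_[p]) * (u - (p : ℚ_[p]) * (x ^ 2 + s * x * y + r * y ^ 2))) * e5 - e3
      + (c : ℚ_[p]) * e2 + (c : ℚ_[p]) * p * e1
  refine ⟨_, ht, hn, fun e he => ?_⟩
  rw [he, trd_smul, trd_one] at ht
  rw [he, nrd_smul, nrd_one, mul_one] at hn
  -- a scalar root has even valuation
  have h1 : ((c : ℚ_[p]) - e) ^ 2 = (p : ℚ_[p]) * u := by
    linear_combination e3 + hn - (c : ℚ_[p]) * ht
  have hu1 : ‖(u : ℚ_[p])‖ = 1 := by rw [← PadicInt.norm_def]; exact PadicInt.isUnit_iff.1 hu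
  have h3 := norm_add_eq_max_of_parity (A := ((c : ℚ_[p]) - e) ^ 2) (B := 1)
    (c := -((p : ℚ_[p]) * (u : ℚ_[p]))) (M := ‖(c : ℚ_[p]) - e‖) (N := 1) ⟨_, rfl⟩ ⟨1, by simp⟩ (by simp) (by simp)
    (by rw [norm_neg, norm_mul, hu1, mul_one])
  rw [h1] at h3
  have : (p : ℚ_[p]) * u + -((p : ℚ_[p]) * u) * 1 = 0 := by ring
  rw [this, norm_zero] at h3
  have h4 := (le_max_right _ _).trans h3.symm.le
  have hp : 0 < ‖(p : ℚ_[p])‖ := norm_pos_iff.2 padic_p_ne_zero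
  simp only [one_pow, mul_one] at h4
  exact absurd h4 (not_le.2 hp)

/-- A quadratic field extension of `ℚ_p` embeds in the quaternion division algebra. -/
theorem exists_root_of_division (ha : a ≠ 0) (hb : b ≠ 0)
    (hdiv : ∀ x : ℍ[ℚ_[p],a,b], x ≠ 0 → IsUnit x) {t n : ℤ_[p]} (hm : IsMaximalPoly t n)
    (hsp : ¬ IsSplitPoly t n) :
    ∃ θ : ℍ[ℚ_[p],a,b], trd θ = t ∧ nrd θ = n ∧ ∀ c : ℚ_[p], θ ≠ c • (1 : ℍ[ℚ_[p],a,b]) := by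
  by_cases hi : IsInertPoly t n
  · exact exists_root_of_division_inert ha hb hdiv hi
  · exact exists_root_of_division_ramified ha hb hdiv hm hi hsp

/-- The valuation ring is generated by two elements over the maximal order of a quadratic
subfield. -/
theorem exists_cyclic_generator_of_division (ha : a ≠ 0) (hb : b ≠ 0)
    (hdiv : ∀ x : ℍ[ℚ_[p],a,b], x ≠ 0 → IsUnit x) {t n : ℤ_[p]} (hm : IsMaximalPoly t n)
    {θ : ℍ[ℚ_[p],a,b]} (ht : trd θ = t) (hn : nrd θ = n) :
    ∃ y : ℍ[ℚ_[p],a,b], ‖nrd y‖ ≤ 1 ∧ ∀ x : ℍ[ℚ_[p],a,b], ‖nrd x‖ ≤ 1 → ∃ c0 c1 c2 c3 : ℤ_[p],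
      x = c0 • (1 : ℍ[ℚ_[p],a,b]) + c1 • θ + c2 • y + c3 • (θ * y) := by
  by_cases hi : IsInertPoly t n
  · obtain ⟨j, hj⟩ := exists_twist ha hdiv ht hn hi
    refine ⟨j, by rw [hj.norm_nrd]; exact Padic.norm_p_lt_one.le, fun x hx => ?_⟩
    exact hj.exists_integral_coordinates ht hn hi hx
  · obtain ⟨w, s, r, hs, hr, h⟩ := exists_residue_generator ha hb hdiv
    obtain ⟨j, hj⟩ := exists_twist ha hdiv hs hr h
    obtain ⟨c, hc, hc2⟩ := exists_dvd_not_sq_dvd hm hi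
    obtain ⟨u, hu, huc⟩ := exists_eq_p_mul_unit hc hc2
    have hg : ‖nrd (θ - c • 1)‖ = ‖(p : ℚ_[p])‖ := by
      rw [padic_smul_eq, nrd_sub_smul, ht, hn]
      have e3 : (c : ℚ_[p]) ^ 2 - t * c + n = p * u := by
        exact_mod_cast congrArg (fun z : ℤ_[p] => (z : ℚ_[p])) huc
      have hu1 : ‖(u : ℚ_[p])‖ = 1 := by rw [← PadicInt.norm_def]; exact PadicInt.isUnit_iff.1 hu
      rw [e3, norm_mul, hu1, mul_one]
    have hg0 : nrd (θ - c • 1) ≠ 0 := by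
      rw [← norm_ne_zero_iff, hg, norm_ne_zero_iff]; exact padic_p_ne_zero
    have step : ∀ x : ℍ[ℚ_[p],a,b], ‖nrd x‖ ≤ 1 → ∃ (x0 x1 : ℤ_[p]) (y : ℍ[ℚ_[p],a,b]),
        ‖nrd y‖ ≤ 1 ∧ x = x0 • 1 + x1 • w + (θ - c • 1) * y := by
      intro x hx
      obtain ⟨x0, x1, x2, x3, rfl⟩ := hj.exists_integral_coordinates hs hr h hx
      obtain ⟨y, hy, hy1⟩ := exists_mul_eq_of_norm_nrd_le hg0
        ((padic_norm_le_inv_of_lt_one (hj.norm_nrd_lt hr x2 x3 hdiv)).trans hg.ge)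
      exact ⟨x0, x1, y, hy1, by rw [← hy, add_assoc]⟩
    refine ⟨w, by rw [hr]; exact r.2, ?_⟩
    -- The element `θ - c` has norm valuation one and the residue field is generated by `w`. Two
    -- expansions in powers of `θ - c` therefore exhaust the valuation ring modulo `p`.
    have hle := padic_nakayama (N := Submodule.span ℤ_[p] (Set.range ![1, θ, w, θ * w]))
      (valuationOrder_fg ha hb hdiv) (by
      intro x hx
      obtain ⟨x0, x1, y, hy, rfl⟩ := step x hx
      obtain ⟨y0, y1, z, hz, rfl⟩ := step y hy
      obtain ⟨z', hz', hzz⟩ := exists_eq_p_smul (x := (θ - c • 1) * ((θ - c • 1) * z)) (by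
        rw [nrd_mul, nrd_mul, norm_mul, norm_mul, hg, ← mul_assoc, ← sq]
        exact mul_le_of_le_one_right (by positivity) hz)
      refine ⟨(x0 - y0 * c) • (1 : ℍ[ℚ_[p],a,b]) + y0 • θ + (x1 - y1 * c) • w + y1 • (θ * w),
        ?_, z', hz', ?_⟩
      · have hv : ∀ i, ![1, θ, w, θ * w] i ∈
            Submodule.span ℤ_[p] (Set.range ![1, θ, w, θ * w]) := fun i =>
          Submodule.subset_span (Set.mem_range_self i)
        exact add_mem (add_mem (add_mem (Submodule.smul_mem _ _ (hv 0))
          (Submodule.smul_mem _ _ (hv 1))) (Submodule.smul_mem _ _ (hv 2)))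
          (Submodule.smul_mem _ _ (hv 3))
      · rw [← hzz]
        simp only [mul_add, sub_mul, mul_smul_comm, smul_mul_assoc, mul_one, one_mul]
        module)
    intro x hx
    obtain ⟨c, hc⟩ := (Submodule.mem_span_range_iff_exists_fun ℤ_[p]).1 (hle hx)
    refine ⟨c 0, c 1, c 2, c 3, ?_⟩
    rw [← hc, Fin.sum_univ_four]
    simp only [Matrix.cons_val]

/-- In a split quadratic algebra there are zero divisors. -/
theorem exists_roots_of_split {t n : ℤ_[p]} (h : IsSplitPoly t n) :
    ∃ z : ℤ_[p], z ^ 2 - t * z + n = 0 ∧ ¬ (p : ℤ_[p]) ∣ 2 * z - t := by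
  obtain ⟨c, hc, hd⟩ := h
  obtain ⟨z, hz, hzc⟩ := exists_root_quadratic 1 (-t) n c (by convert hc using 1; ring)
    (by convert hd using 2; ring)
  refine ⟨z, by linear_combination hz, fun h => hd ?_⟩
  have := dvd_sub h (hzc.mul_left 2)
  convert this using 1; ring

theorem isScalar_of_split (hdiv : ∀ x : ℍ[ℚ_[p],a,b], x ≠ 0 → IsUnit x) {t n : ℤ_[p]}
    (h : IsSplitPoly t n) {θ : ℍ[ℚ_[p],a,b]} (ht : trd θ = t) (hn : nrd θ = n) :
    ∃ c : ℚ_[p], θ = c • (1 : ℍ[ℚ_[p],a,b]) := by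
  obtain ⟨z, hz, -⟩ := exists_roots_of_split h
  refine ⟨z, ?_⟩
  rw [← sub_eq_zero]
  apply nrd_eq_zero_of_division hdiv
  rw [nrd_sub_smul, ht, hn]
  exact_mod_cast congrArg (fun z : ℤ_[p] => (z : ℚ_[p])) hz

end PadicDivisionTheorems
end QuatOrder
end

/-! ### Maximal orders in the matrix algebra over `ℚ_p`. -/

noncomputable section
namespace QuatOrder

section PadicMatrixOrder

variable {p : ℕ} [Fact p.Prime]
variable {A : Type*} [Ring A] [Algebra ℚ_[p] A]

theorem exists_conj_equiv (σ : A ≃ₐ[ℚ_[p]] Matrix (Fin 2) (Fin 2) ℚ_[p])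
    {h h' : Matrix (Fin 2) (Fin 2) ℚ_[p]} (h1 : h * h' = 1) (h2 : h' * h = 1) :
    ∃ σ' : A ≃ₐ[ℚ_[p]] Matrix (Fin 2) (Fin 2) ℚ_[p], ∀ x, σ' x = h' * σ x * h :=
  ⟨σ.trans (MulSemiringAction.toAlgEquiv ℚ_[p] (Matrix (Fin 2) (Fin 2) ℚ_[p])
    (ConjAct.toConjAct (⟨h', h, h2, h1⟩ : (Matrix (Fin 2) (Fin 2) ℚ_[p])ˣ))), fun _ => rfl⟩

theorem root_of_companion {σ : A ≃ₐ[ℚ_[p]] Matrix (Fin 2) (Fin 2) ℚ_[p]} {t n : ℚ_[p]} {θ : A}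
    (hθ : σ θ = !![0, -n; 1, t]) :
    θ * θ = t • θ - n • (1 : A) ∧ ∀ c : ℚ_[p], θ ≠ c • (1 : A) := by
  refine ⟨σ.injective ?_, fun c hc => ?_⟩
  · rw [map_mul, map_sub, map_smul, map_smul, map_one, hθ]
    ext i j; fin_cases i <;> fin_cases j <;> simp <;> ring
  · rw [hc, map_smul, map_one] at hθ
    simpa using congrFun (congrFun hθ 1) 0

variable [Algebra ℤ_[p] A] [IsScalarTower ℤ_[p] ℚ_[p] A]

/-- The sum of the `M b_i` is a lattice stable under `M`. It is free over `ℤ_p`, and `M` acts on a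
basis of it by integral matrices. -/
theorem exists_stable_basis {V : Type*} [AddCommGroup V] [Module ℚ_[p] V] [Module ℤ_[p] V]
    [IsScalarTower ℤ_[p] ℚ_[p] V] {k : ℕ} (b : Module.Basis (Fin k) ℚ_[p] V)
    {M : Subalgebra ℤ_[p] A} (hM : (Subalgebra.toSubmodule M).FG)
    (e : A →ₐ[ℚ_[p]] Module.End ℚ_[p] V) :
    ∃ v : Module.Basis (Fin k) ℚ_[p] V, ∀ x ∈ M, ∀ i j, ‖v.repr (e x (v j)) i‖ ≤ 1 := by
  let φ : Fin k → A →ₗ[ℤ_[p]] V := fun i =>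
    ((LinearMap.applyₗ (b i)).comp e.toLinearMap).restrictScalars ℤ_[p]
  have hφ : ∀ i x, φ i x = e x (b i) := fun _ _ => rfl
  set L : Submodule ℤ_[p] V := ⨆ i, (Subalgebra.toSubmodule M).map (φ i) with hL
  have hfg : L.FG := Submodule.fg_iSup _ fun i => hM.map _
  have hstab : ∀ x ∈ M, ∀ v ∈ L, e x v ∈ L := by
    intro x hx v hv
    let ψ : V →ₗ[ℤ_[p]] V := (e x).restrictScalars ℤ_[p]
    have : L ≤ L.comap ψ := by
      refine iSup_le fun i => ?_
      rintro _ ⟨y, hy, rfl⟩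
      refine Submodule.mem_iSup_of_mem i ⟨x * y, M.mul_mem hx hy, ?_⟩
      rw [hφ, map_mul]; rfl
    exact this hv
  have hb : ∀ i, b i ∈ L := fun i =>
    Submodule.mem_iSup_of_mem i ⟨1, M.one_mem, by rw [hφ, map_one]; rfl⟩
  have : Module.Finite ℤ_[p] L := Module.Finite.iff_fg.2 hfg
  have : Module.IsTorsionFree ℤ_[p] V := Module.IsTorsionFree.trans ℚ_[p]
  have : Module.Free ℤ_[p] L := Module.free_of_finite_type_torsion_free'
  let c := Module.finBasis ℤ_[p] L
  have hli : LinearIndependent ℚ_[p] (fun i => (c i : V)) := by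
    rw [← LinearIndependent.iff_fractionRing (R := ℤ_[p])]
    exact c.linearIndependent.map' L.subtype (Submodule.ker_subtype L)
  have hsp : ∀ x (hx : x ∈ L), x = ∑ i, ((c.repr ⟨x, hx⟩ i : ℤ_[p]) : ℚ_[p]) • (c i : V) := by
    intro x hx
    have h := congrArg Subtype.val (c.sum_repr ⟨x, hx⟩)
    refine h.symm.trans ?_
    rw [AddSubmonoidClass.coe_finsetSum]
    refine Finset.sum_congr rfl fun i _ => ?_
    rw [Submodule.coe_smul, ← algebraMap_smul ℚ_[p] (c.repr _ i)]; rfl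
  have htop : ⊤ ≤ Submodule.span ℚ_[p] (Set.range fun i => (c i : V)) := by
    rw [← b.span_eq, Submodule.span_le]
    rintro _ ⟨i, rfl⟩
    rw [hsp (b i) (hb i)]
    exact Submodule.sum_mem _ fun j _ => Submodule.smul_mem _ _
      (Submodule.subset_span (Set.mem_range_self j))
  let v := Module.Basis.mk hli htop
  have hcard : Module.finrank ℤ_[p] L = k := by
    have h1 := Module.finrank_eq_card_basis v
    have h2 := Module.finrank_eq_card_basis b
    simpa [h2] using h1.symm
  refine ⟨v.reindex (finCongr hcard), fun x hx i j => ?_⟩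
  rw [Module.Basis.repr_reindex_apply, Module.Basis.reindex_apply]
  generalize (finCongr hcard).symm i = i
  generalize (finCongr hcard).symm j = j
  have hv : ∀ j, v j = c j := fun j => by simp [v]
  rw [hv, hsp _ (hstab x hx _ (c j).2)]
  simp only [← hv, map_sum, map_smul, Module.Basis.repr_self]
  rw [Finsupp.finsetSum_apply, Finset.sum_eq_single i]
  · simp only [Finsupp.smul_apply, Finsupp.single_eq_same, smul_eq_mul, mul_one]
    exact PadicInt.norm_le_one _
  · intro l _ hl
    simp [hl]
  · simp

/-- `σ` identifies `M` with the ring of integral matrices. -/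
def IsMatrixModel (M : Subalgebra ℤ_[p] A) (σ : A ≃ₐ[ℚ_[p]] Matrix (Fin 2) (Fin 2) ℚ_[p]) : Prop :=
  ∀ x, x ∈ M ↔ ∀ i j, ‖σ x i j‖ ≤ 1

/-- A stable lattice puts `M` into a conjugate of the integral matrices, which is itself finitely
generated; maximality forces equality. -/
theorem exists_isMatrixModel (e : A ≃ₐ[ℚ_[p]] Matrix (Fin 2) (Fin 2) ℚ_[p])
    {M : Subalgebra ℤ_[p] A}
    (hM : Maximal (fun B : Subalgebra ℤ_[p] A => (Subalgebra.toSubmodule B).FG) M) :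
    ∃ σ, IsMatrixModel M σ := by
  let e' := e.trans Matrix.toLinAlgEquiv'
  obtain ⟨v, hv⟩ := exists_stable_basis (Pi.basisFun ℚ_[p] (Fin 2)) hM.prop
    (e' : A →ₐ[ℚ_[p]] Module.End ℚ_[p] (Fin 2 → ℚ_[p]))
  let σ := e'.trans (LinearMap.toMatrixAlgEquiv v)
  have hσ : ∀ x i j, σ x i j = v.repr (e' x (v j)) i := fun x i j =>
    LinearMap.toMatrixAlgEquiv_apply _ _ _ _
  let B : Subalgebra ℤ_[p] A :=
    { carrier := {x | ∀ i j, ‖σ x i j‖ ≤ 1}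
      mul_mem' := by
        intro x y hx hy i j
        rw [map_mul, Matrix.mul_apply, Fin.sum_univ_two]
        refine (Padic.nonarchimedean _ _).trans (max_le ?_ ?_) <;>
        · rw [norm_mul]; exact mul_le_one₀ (hx _ _) (norm_nonneg _) (hy _ _)
      add_mem' := by
        intro x y hx hy i j
        rw [map_add, Matrix.add_apply]
        exact (Padic.nonarchimedean _ _).trans (max_le (hx _ _) (hy _ _))
      algebraMap_mem' := by
        intro r i j
        rw [Algebra.algebraMap_eq_smul_one, ← algebraMap_smul ℚ_[p] r, map_smul, map_one,
          Matrix.smul_apply, smul_eq_mul, norm_mul]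
        refine mul_le_one₀ (PadicInt.norm_le_one r) (norm_nonneg _) ?_
        rw [Matrix.one_apply]; split_ifs <;> simp }
  have hBfg : (Subalgebra.toSubmodule B).FG := by
    refine ⟨(Set.toFinite (Set.range fun ij : Fin 2 × Fin 2 =>
      σ.symm (Matrix.single ij.1 ij.2 1))).toFinset, ?_⟩
    rw [Set.Finite.coe_toFinset]
    apply le_antisymm
    · rw [Submodule.span_le]
      rintro _ ⟨⟨i, j⟩, rfl⟩ k l
      rw [AlgEquiv.apply_symm_apply, Matrix.single_apply]
      split_ifs <;> simp
    · intro x hx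
      rw [Submodule.mem_span_range_iff_exists_fun]
      choose z hz using fun ij : Fin 2 × Fin 2 => exists_padicInt_eq (hx ij.1 ij.2)
      refine ⟨z, σ.injective ?_⟩
      simp only [map_sum, ← algebraMap_smul ℚ_[p] (z _), map_smul, AlgEquiv.apply_symm_apply]
      ext i j
      have hz' : ∀ ij, algebraMap ℤ_[p] ℚ_[p] (z ij) = σ x ij.1 ij.2 := hz
      fin_cases i <;> fin_cases j <;> simp [Fintype.sum_prod_type, hz']
  have := hM.eq_of_le hBfg (fun x hx i j => by rw [hσ]; exact hv x hx i j)
  exact ⟨σ, fun x => by rw [this]; rfl⟩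

theorem norm_matrix_mul_le {x y : Matrix (Fin 2) (Fin 2) ℚ_[p]} (hx : ∀ i j, ‖x i j‖ ≤ 1)
    (hy : ∀ i j, ‖y i j‖ ≤ 1) (i j : Fin 2) : ‖(x * y) i j‖ ≤ 1 := by
  rw [Matrix.mul_apply, Fin.sum_univ_two]
  refine (Padic.nonarchimedean _ _).trans (max_le ?_ ?_) <;>
  · rw [norm_mul]; exact mul_le_one₀ (hx _ _) (norm_nonneg _) (hy _ _)

/-- Conjugation by a matrix in `GL₂(ℤ_p)` preserves integrality. The intertwining relation allows
conjugates to be computed without writing the inverse. -/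
theorem IsMatrixModel.conj {M : Subalgebra ℤ_[p] A} {σ} (hσ : IsMatrixModel M σ)
    {x r y s : ℤ_[p]} (hu : IsUnit (x * s - y * r)) :
    ∃ σ', IsMatrixModel M σ' ∧ ∀ z w, σ z * !![(x : ℚ_[p]), r; y, s] = !![(x : ℚ_[p]), r; y, s] * w →
      σ' z = w := by
  obtain ⟨v, hv⟩ := hu.exists_right_inv
  have hv' : ((x : ℚ_[p]) * s - y * r) * v = 1 := by
    exact_mod_cast congrArg (fun z : ℤ_[p] => (z : ℚ_[p])) hv
  have h1 : !![(x : ℚ_[p]), r; y, s] * !![(v : ℚ_[p]) * s, -v * r; -v * y, v * x] = 1 := by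
    ext i j; fin_cases i <;> fin_cases j <;> simp <;>
      first | ring1 | linear_combination hv'
  have h2 : !![(v : ℚ_[p]) * s, -v * r; -v * y, v * x] * !![(x : ℚ_[p]), r; y, s] = 1 := by
    ext i j; fin_cases i <;> fin_cases j <;> simp <;>
      first | ring1 | linear_combination hv'
  have hh : ∀ i j, ‖!![(x : ℚ_[p]), r; y, s] i j‖ ≤ 1 := by
    intro i j; fin_cases i <;> fin_cases j <;> simp [PadicInt.norm_le_one]
  have hh' : ∀ i j, ‖!![(v : ℚ_[p]) * s, -v * r; -v * y, v * x] i j‖ ≤ 1 := by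
    intro i j; fin_cases i <;> fin_cases j
    · exact (v * s).2
    · exact (-v * r).2
    · exact (-v * y).2
    · exact (v * x).2
  generalize !![(x : ℚ_[p]), r; y, s] = h at h1 h2 hh ⊢
  generalize !![(v : ℚ_[p]) * s, -v * r; -v * y, v * x] = h' at h1 h2 hh'
  obtain ⟨σ', h3⟩ := exists_conj_equiv σ h1 h2
  refine ⟨σ', fun x => ?_, fun z w hzw => ?_⟩
  · rw [hσ x]
    refine ⟨fun hx => ?_, fun hx => ?_⟩
    · rw [h3]; exact norm_matrix_mul_le (norm_matrix_mul_le hh' hx) hh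
    · have : σ x = h * σ' x * h' := by
        rw [h3]
        calc σ x = (h * h') * σ x * (h * h') := by rw [h1, one_mul, mul_one]
          _ = _ := by simp only [mul_assoc]
      rw [this]; exact norm_matrix_mul_le (norm_matrix_mul_le hh hx) hh'
  · rw [h3, mul_assoc, hzw, ← mul_assoc, h2, one_mul]

theorem matrix_trace_det_eq {K : Type*} [Field K] {a b c d t n : K}
    (h : !![a, b; c, d] * !![a, b; c, d] = t • !![a, b; c, d] - n • 1)
    (hs : ∀ z : K, !![a, b; c, d] ≠ z • (1 : Matrix (Fin 2) (Fin 2) K)) :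
    a + d = t ∧ a * d - b * c = n := by
  have h00 := congrFun (congrFun h 0) 0
  have h01 := congrFun (congrFun h 0) 1
  have h10 := congrFun (congrFun h 1) 0
  have h11 := congrFun (congrFun h 1) 1
  simp [Matrix.mul_apply, Fin.sum_univ_two] at h00 h01 h10 h11
  have ht : a + d = t := by
    by_cases hb : b = 0
    · by_cases hc : c = 0
      · have had : a - d ≠ 0 := by
          intro h0
          apply hs a
          rw [sub_eq_zero.1 h0, hb, hc]
          ext i j; fin_cases i <;> fin_cases j <;> simp
        apply mul_left_cancel₀ had
        rw [hb] at h00 h11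
        linear_combination h00 - h11
      · apply mul_left_cancel₀ hc; linear_combination h10
    · apply mul_left_cancel₀ hb; linear_combination h01
  refine ⟨ht, ?_⟩
  rw [← ht] at h00
  linear_combination -h00

/-- The expression is the determinant of a vector `(x, y)` and its image. If `(1,0)`, `(0,1)` and
`(1,1)` all fail, the matrix is scalar modulo `p`; then `p ∣ 2a - t` and `f(a) = -bc` is divisible
by `p²`, against maximality. -/
theorem exists_cyclic_vector {t n a b c d : ℤ_[p]} (hm : IsMaximalPoly t n) (h1 : a + d = t)
    (h2 : a * d - b * c = n) :
    ∃ x y : ℤ_[p], IsUnit (x * (c * x + d * y) - y * (a * x + b * y)) := by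
  simp only [padicInt_isUnit_iff_not_dvd]
  by_cases hc : (p : ℤ_[p]) ∣ c
  · by_cases hb : (p : ℤ_[p]) ∣ b
    · refine ⟨1, 1, fun h => hm a ?_ ?_⟩
      · have := (hc.sub hb).sub h
        convert this using 1; rw [← h1]; ring
      · have := (mul_dvd_mul hb hc).neg_right
        rw [sq]
        convert this using 1; rw [← h1, ← h2]; ring
    · exact ⟨0, 1, fun h => hb (by simpa using h)⟩
  · exact ⟨1, 0, fun h => hc (by simpa using h)⟩

/-- A non-scalar integral element is conjugate to the companion matrix. -/
theorem IsMatrixModel.exists_companion {M : Subalgebra ℤ_[p] A} {σ} (hσ : IsMatrixModel M σ)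
    {t n : ℤ_[p]} (hm : IsMaximalPoly t n) {θ : A} (hθ : θ ∈ M)
    (hq : θ * θ = (t : ℚ_[p]) • θ - (n : ℚ_[p]) • (1 : A))
    (hs : ∀ c : ℚ_[p], θ ≠ c • (1 : A)) :
    ∃ σ', IsMatrixModel M σ' ∧ σ' θ = !![0, -(n : ℚ_[p]); 1, (t : ℚ_[p])] := by
  obtain ⟨a, ha⟩ := exists_padicInt_eq ((hσ θ).1 hθ 0 0)
  obtain ⟨b, hb⟩ := exists_padicInt_eq ((hσ θ).1 hθ 0 1)
  obtain ⟨c, hc⟩ := exists_padicInt_eq ((hσ θ).1 hθ 1 0)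
  obtain ⟨d, hd⟩ := exists_padicInt_eq ((hσ θ).1 hθ 1 1)
  have hT : σ θ = !![(a : ℚ_[p]), b; c, d] := by
    ext i j; fin_cases i <;> fin_cases j <;> simp [ha, hb, hc, hd]
  have hq' := congrArg σ hq
  rw [map_mul, map_sub, map_smul, map_smul, map_one, hT] at hq'
  obtain ⟨e1, e2⟩ := matrix_trace_det_eq hq' (fun z hz => hs z (σ.injective (by
    rw [hT, hz, map_smul, map_one])))
  obtain ⟨x, y, hu⟩ := exists_cyclic_vector hm (a := a) (b := b) (c := c) (d := d)
    (PadicInt.ext (by push_cast; exact e1)) (PadicInt.ext (by push_cast; exact e2))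
  obtain ⟨σ', h1, h2⟩ := hσ.conj hu
  refine ⟨σ', h1, h2 _ _ ?_⟩
  rw [hT, ← e1, ← e2]
  ext i j; fin_cases i <;> fin_cases j <;> simp <;> ring

/-- A generator of a split order can be diagonalised. -/
theorem IsMatrixModel.exists_diagonal {M : Subalgebra ℤ_[p] A} {σ} (hσ : IsMatrixModel M σ)
    {t n z : ℤ_[p]} (hz : z ^ 2 - t * z + n = 0) (hd : ¬ (p : ℤ_[p]) ∣ 2 * z - t) {θ : A}
    (hθ : σ θ = !![0, -(n : ℚ_[p]); 1, (t : ℚ_[p])]) :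
    ∃ σ', IsMatrixModel M σ' ∧ σ' θ = !![(z : ℚ_[p]), 0; 0, (t : ℚ_[p]) - z] := by
  -- The columns `(z - t, 1)` and `(-z, 1)` are eigenvectors of the companion matrix for `z` and `t
  -- - z`; their determinant is the unit `2z - t`.
  have hu : IsUnit ((z - t) * 1 - 1 * (-z)) := by
    rw [padicInt_isUnit_iff_not_dvd]; convert hd using 2; ring
  have hz' : (z : ℚ_[p]) ^ 2 - t * z + n = 0 := by
    exact_mod_cast congrArg (fun z : ℤ_[p] => (z : ℚ_[p])) hz
  obtain ⟨σ', h1, h2⟩ := hσ.conj hu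
  refine ⟨σ', h1, h2 _ _ ?_⟩
  rw [hθ]
  ext i j; fin_cases i <;> fin_cases j <;> simp <;>
    first | ring1 | linear_combination hz' | linear_combination -hz'

theorem IsMatrixModel.exists_root {M : Subalgebra ℤ_[p] A} {σ} (hσ : IsMatrixModel M σ)
    (t n : ℤ_[p]) : ∃ θ ∈ M, σ θ = !![0, -(n : ℚ_[p]); 1, (t : ℚ_[p])] := by
  refine ⟨σ.symm !![0, -(n : ℚ_[p]); 1, (t : ℚ_[p])], (hσ _).2 fun i j => ?_, by simp⟩
  rw [AlgEquiv.apply_symm_apply]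
  fin_cases i <;> fin_cases j <;> simp [PadicInt.norm_le_one]

/-- The integral matrices are generated by two elements over a maximal quadratic order. -/
theorem IsMatrixModel.exists_cyclic_generator {M : Subalgebra ℤ_[p] A} {σ}
    (hσ : IsMatrixModel M σ) {t n : ℤ_[p]} {θ : A}
    (hθ : σ θ = !![0, -(n : ℚ_[p]); 1, (t : ℚ_[p])]) :
    ∃ y ∈ M, ∀ x ∈ M, ∃ c0 c1 c2 c3 : ℤ_[p],
      x = c0 • (1 : A) + c1 • θ + c2 • y + c3 • (θ * y) := by
  -- For `y = E₁₂` the product `θ y` is `E₂₂`, and `1, θ, E₁₂, E₂₂` is a basis of the integral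
  -- matrices.
  have hy : σ (σ.symm !![0, 1; 0, 0]) = !![0, 1; 0, 0] := σ.apply_symm_apply _
  refine ⟨σ.symm !![0, 1; 0, 0], (hσ _).2 fun i j => ?_, fun x hx => ?_⟩
  · rw [hy]; fin_cases i <;> fin_cases j <;> simp
  · obtain ⟨a, ha⟩ := exists_padicInt_eq ((hσ x).1 hx 0 0)
    obtain ⟨b, hb⟩ := exists_padicInt_eq ((hσ x).1 hx 0 1)
    obtain ⟨c, hc⟩ := exists_padicInt_eq ((hσ x).1 hx 1 0)
    obtain ⟨d, hd⟩ := exists_padicInt_eq ((hσ x).1 hx 1 1)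
    refine ⟨a, c, b + n * c, d - a - t * c, σ.injective ?_⟩
    simp only [← algebraMap_smul ℚ_[p] (_ : ℤ_[p]) (_ : A), map_add, map_smul, map_mul, map_one,
      hy, hθ]
    have h : ∀ z : ℤ_[p], algebraMap ℤ_[p] ℚ_[p] z = z := fun _ => rfl
    ext i j; fin_cases i <;> fin_cases j <;> simp [h, ← ha, ← hb, ← hc, ← hd] <;> ring

end PadicMatrixOrder
end QuatOrder
end

/-! ### Maximal local orders, division and matrix case together. -/

noncomputable section
namespace QuatOrder

section PadicOrder

open scoped Quaternion

variable {p : ℕ} [Fact p.Prime]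

/-- `A` is a quaternion algebra over `ℚ_p`, given by structure constants. -/
def IsPadicQuaternion (A : Type*) [Ring A] [Algebra ℚ_[p] A] : Prop :=
  ∃ a b : ℚ_[p], a ≠ 0 ∧ b ≠ 0 ∧ Nonempty (A ≃ₐ[ℚ_[p]] ℍ[ℚ_[p],a,b])

theorem IsPadicQuaternion.cases {A : Type*} [Ring A] [Algebra ℚ_[p] A]
    (h : IsPadicQuaternion (p := p) A) :
    (∃ a b : ℚ_[p], a ≠ 0 ∧ b ≠ 0 ∧ (∀ x : ℍ[ℚ_[p],a,b], x ≠ 0 → IsUnit x) ∧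
      (∀ x : A, x ≠ 0 → IsUnit x) ∧ Nonempty (A ≃ₐ[ℚ_[p]] ℍ[ℚ_[p],a,b])) ∨
    Nonempty (A ≃ₐ[ℚ_[p]] Matrix (Fin 2) (Fin 2) ℚ_[p]) := by
  obtain ⟨a, b, ha, hb, ⟨e⟩⟩ := h
  have : IsSimpleRing ℍ[ℚ_[p],a,b] := quaternion_isSimpleRing two_ne_zero ha hb
  rcases unit_or_matrix_of_finrank_eq_four (K := ℚ_[p]) (A := ℍ[ℚ_[p],a,b])
    (QuaternionAlgebra.finrank_eq_four _ _ _) with h | ⟨⟨f⟩⟩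
  · refine .inl ⟨a, b, ha, hb, h, fun x hx => ?_, ⟨e⟩⟩
    have := (h (e x) (by simpa using hx)).map e.symm
    simpa using this
  · exact .inr ⟨e.trans f⟩

theorem IsPadicQuaternion.finrank_eq {A : Type*} [Ring A] [Algebra ℚ_[p] A]
    (h : IsPadicQuaternion (p := p) A) : Module.finrank ℚ_[p] A = 4 := by
  obtain ⟨a, b, ha, hb, ⟨e⟩⟩ := h
  rw [e.toLinearEquiv.finrank_eq, QuaternionAlgebra.finrank_eq_four]

/-- A non-scalar root of `X² - tX + n`. -/
structure IsQuadRoot {A : Type*} [Ring A] [Algebra ℚ_[p] A] (t n : ℤ_[p]) (θ : A) : Prop where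
  sq : θ * θ = (t : ℚ_[p]) • θ - (n : ℚ_[p]) • (1 : A)
  not_scalar : ∀ c : ℚ_[p], θ ≠ c • (1 : A)

variable {A : Type*} [Ring A] [Algebra ℚ_[p] A]

theorem IsQuadRoot.map {B : Type*} [Ring B] [Algebra ℚ_[p] B] {t n : ℤ_[p]} {θ : A}
    (h : IsQuadRoot t n θ) (e : A ≃ₐ[ℚ_[p]] B) : IsQuadRoot t n (e θ) where
  sq := by rw [← map_mul, h.sq]; simp
  not_scalar c hc := h.not_scalar c (e.injective (by rw [hc]; simp))

theorem IsQuadRoot.trd_nrd_eq {a b : ℚ_[p]} {t n : ℤ_[p]} {θ : ℍ[ℚ_[p],a,b]}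
    (h : IsQuadRoot t n θ) : trd θ = t ∧ nrd θ = n :=
  trd_nrd_eq_of_not_scalar h.not_scalar h.sq

theorem isQuadRoot_of_trd_nrd {a b : ℚ_[p]} {t n : ℤ_[p]} {θ : ℍ[ℚ_[p],a,b]}
    (ht : trd θ = t) (hn : nrd θ = n) (h : ∀ c : ℚ_[p], θ ≠ c • (1 : ℍ[ℚ_[p],a,b])) :
    IsQuadRoot t n θ :=
  ⟨by rw [mul_self_eq, ht, hn], h⟩

/-- In a division algebra, `X² - tX + n` has no non-scalar root if it splits. -/
theorem IsPadicQuaternion.not_isSplitPoly (hA : IsPadicQuaternion (p := p) A)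
    (hdiv : ∀ x : A, x ≠ 0 → IsUnit x) {t n : ℤ_[p]} {θ : A} (h : IsQuadRoot t n θ) :
    ¬ IsSplitPoly t n := by
  intro hs
  obtain ⟨a, b, ha, hb, ⟨e⟩⟩ := hA
  have hdiv' : ∀ x : ℍ[ℚ_[p],a,b], x ≠ 0 → IsUnit x := fun x hx => by
    have := (hdiv (e.symm x) (by simpa using hx)).map e
    simpa using this
  have h' := h.map e
  obtain ⟨c, hc⟩ := isScalar_of_split hdiv' hs h'.trd_nrd_eq.1 h'.trd_nrd_eq.2
  exact h'.not_scalar c hc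

variable [Algebra ℤ_[p] A] [IsScalarTower ℤ_[p] ℚ_[p] A]

/-- A maximal `ℤ_p`-order. -/
def IsMaximalPadicOrder (M : Subalgebra ℤ_[p] A) : Prop :=
  Maximal (fun B : Subalgebra ℤ_[p] A => (Subalgebra.toSubmodule B).FG) M

/-- The valuation ring is finitely generated and contains every order, so it is the only maximal
one. -/
theorem IsMaximalPadicOrder.mem_iff {a b : ℚ_[p]} (ha : a ≠ 0) (hb : b ≠ 0)
    (hdiv : ∀ x : ℍ[ℚ_[p],a,b], x ≠ 0 → IsUnit x) (e : A ≃ₐ[ℚ_[p]] ℍ[ℚ_[p],a,b])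
    {M : Subalgebra ℤ_[p] A} (hM : IsMaximalPadicOrder M) (x : A) :
    x ∈ M ↔ ‖nrd (e x)‖ ≤ 1 := by
  let e' : A →ₐ[ℤ_[p]] ℍ[ℚ_[p],a,b] := (e : A →ₐ[ℚ_[p]] ℍ[ℚ_[p],a,b]).restrictScalars ℤ_[p]
  let f' : ℍ[ℚ_[p],a,b] →ₐ[ℤ_[p]] A :=
    (e.symm : ℍ[ℚ_[p],a,b] →ₐ[ℚ_[p]] A).restrictScalars ℤ_[p]
  have h1 : M ≤ (valuationOrder hdiv).comap e' := by
    rw [← Subalgebra.map_le]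
    exact le_valuationOrder hdiv (hM.prop.map e'.toLinearMap)
  have h2 : (Subalgebra.toSubmodule ((valuationOrder hdiv).comap e')).FG := by
    have : (valuationOrder hdiv).comap e' = (valuationOrder hdiv).map f' := by
      ext x
      constructor
      · intro hx; exact ⟨e x, hx, e.symm_apply_apply x⟩
      · rintro ⟨y, hy, rfl⟩
        change e (e.symm y) ∈ valuationOrder hdiv
        rwa [e.apply_symm_apply]
    rw [this]
    exact (valuationOrder_fg ha hb hdiv).map f'.toLinearMap
  rw [hM.eq_of_le h2 h1]
  rfl

variable {M M' : Subalgebra ℤ_[p] A}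

theorem exists_norm_pow_mul_le (C : ℝ) : ∃ N : ℕ, ‖(p : ℚ_[p]) ^ N‖ * C ≤ 1 := by
  by_cases hC : C ≤ 0
  · exact ⟨0, by simpa using hC.trans zero_le_one⟩
  · push Not at hC
    obtain ⟨N, hN⟩ := exists_pow_lt_of_lt_one (inv_pos.2 hC) (Padic.norm_p_lt_one (p := p))
    refine ⟨N, ?_⟩
    rw [norm_pow]
    have := mul_le_mul_of_nonneg_right hN.le hC.le
    rwa [inv_mul_cancel₀ hC.ne'] at this

/-- Every element of `A` has a multiple in a maximal order. -/
theorem IsMaximalPadicOrder.exists_smul_mem (hA : IsPadicQuaternion (p := p) A)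
    (hM : IsMaximalPadicOrder M) (x : A) : ∃ N : ℕ, ((p : ℤ_[p]) ^ N) • x ∈ M := by
  have key : ∀ N : ℕ, ((p : ℤ_[p]) ^ N) • x = ((p : ℚ_[p]) ^ N) • x := by
    intro N
    rw [← algebraMap_smul ℚ_[p] ((p : ℤ_[p]) ^ N)]
    simp
  rcases hA.cases with ⟨a, b, ha, hb, hdiv, -, ⟨e⟩⟩ | ⟨⟨e⟩⟩
  · obtain ⟨N, hN⟩ := exists_norm_pow_mul_le (p := p) ‖nrd (e x)‖
    refine ⟨N, ?_⟩
    rw [hM.mem_iff ha hb hdiv e, key, map_smul, nrd_smul, norm_mul, norm_pow, sq, mul_assoc]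
    refine mul_le_one₀ ?_ (by positivity) hN
    rw [norm_pow]; exact pow_le_one₀ (norm_nonneg _) Padic.norm_p_lt_one.le
  · obtain ⟨σ, hσ⟩ := exists_isMatrixModel e hM
    obtain ⟨N, hN⟩ := exists_norm_pow_mul_le (p := p) (∑ i, ∑ j, ‖σ x i j‖)
    refine ⟨N, (hσ _).2 fun i j => ?_⟩
    rw [key, map_smul, Matrix.smul_apply, smul_eq_mul, norm_mul]
    refine (mul_le_mul_of_nonneg_left ?_ (norm_nonneg _)).trans hN
    refine (Finset.single_le_sum (f := fun j => ‖σ x i j‖) (fun _ _ => norm_nonneg _)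
      (Finset.mem_univ j)).trans ?_
    exact Finset.single_le_sum (f := fun i => ∑ j, ‖σ x i j‖)
      (fun _ _ => Finset.sum_nonneg fun _ _ => norm_nonneg _) (Finset.mem_univ i)

theorem IsMaximalPadicOrder.exists_equiv (hA : IsPadicQuaternion (p := p) A)
    (hM : IsMaximalPadicOrder M) (hM' : IsMaximalPadicOrder M') :
    ∃ σ : A ≃ₐ[ℚ_[p]] A, ∀ x, x ∈ M ↔ σ x ∈ M' := by
  rcases hA.cases with ⟨a, b, ha, hb, hdiv, -, ⟨e⟩⟩ | ⟨⟨e⟩⟩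
  · exact ⟨AlgEquiv.refl, fun x => by
      rw [hM.mem_iff ha hb hdiv e, hM'.mem_iff ha hb hdiv e]; rfl⟩
  · obtain ⟨σ, hσ⟩ := exists_isMatrixModel e hM
    obtain ⟨τ, hτ⟩ := exists_isMatrixModel e hM'
    exact ⟨σ.trans τ.symm, fun x => by rw [hσ x, hτ]; simp⟩

/-- The companion matrix always supplies a root in the matrix case, so only a division algebra
imposes a condition on the polynomial. -/
theorem IsMaximalPadicOrder.exists_root (hA : IsPadicQuaternion (p := p) A)
    (hM : IsMaximalPadicOrder M) {t n : ℤ_[p]} (hm : IsMaximalPoly t n)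
    (h : (∀ x : A, x ≠ 0 → IsUnit x) → ¬ IsSplitPoly t n) : ∃ θ ∈ M, IsQuadRoot t n θ := by
  rcases hA.cases with ⟨a, b, ha, hb, hdiv, hdiv', ⟨e⟩⟩ | ⟨⟨e⟩⟩
  · obtain ⟨θ, h1, h2, h3⟩ := exists_root_of_division ha hb hdiv hm (h hdiv')
    refine ⟨e.symm θ, ?_, (isQuadRoot_of_trd_nrd h1 h2 h3).map e.symm⟩
    rw [hM.mem_iff ha hb hdiv e, e.apply_symm_apply, h2]
    exact n.2
  · obtain ⟨σ, hσ⟩ := exists_isMatrixModel e hM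
    obtain ⟨θ, h1, h2⟩ := hσ.exists_root t n
    obtain ⟨h3, h4⟩ := root_of_companion h2
    exact ⟨θ, h1, h3, h4⟩

theorem IsMaximalPadicOrder.exists_cyclic_generator (hA : IsPadicQuaternion (p := p) A)
    (hM : IsMaximalPadicOrder M) {t n : ℤ_[p]} (hm : IsMaximalPoly t n) {θ : A} (hθ : θ ∈ M)
    (h : IsQuadRoot t n θ) : ∃ y ∈ M, ∀ x ∈ M, ∃ c0 c1 c2 c3 : ℤ_[p],
      x = c0 • (1 : A) + c1 • θ + c2 • y + c3 • (θ * y) := by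
  rcases hA.cases with ⟨a, b, ha, hb, hdiv, hdiv', ⟨e⟩⟩ | ⟨⟨e⟩⟩
  · obtain ⟨ht, hn⟩ := (h.map e).trd_nrd_eq
    obtain ⟨y, hy, h1⟩ := exists_cyclic_generator_of_division ha hb hdiv hm ht hn
    refine ⟨e.symm y, by rwa [hM.mem_iff ha hb hdiv e, e.apply_symm_apply], fun x hx => ?_⟩
    rw [hM.mem_iff ha hb hdiv e] at hx
    obtain ⟨c0, c1, c2, c3, hc⟩ := h1 _ hx
    refine ⟨c0, c1, c2, c3, e.injective ?_⟩
    rw [hc]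
    simp only [← algebraMap_smul ℚ_[p] (_ : ℤ_[p]) (_ : A), padic_smul_eq, map_add, map_smul,
      map_mul, map_one, e.apply_symm_apply]
    rfl
  · obtain ⟨σ, hσ⟩ := exists_isMatrixModel e hM
    obtain ⟨σ', h1, h2⟩ := hσ.exists_companion hm hθ h.sq h.not_scalar
    exact h1.exists_cyclic_generator h2

/-- In the division case the roots are conjugate and conjugation preserves the norm, hence the
maximal order. In the matrix case both pairs are brought to the integral matrices with the companion
matrix. -/
theorem IsMaximalPadicOrder.exists_equiv_of_root (hA : IsPadicQuaternion (p := p) A)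
    (hM : IsMaximalPadicOrder M) (hM' : IsMaximalPadicOrder M') {t n : ℤ_[p]}
    (hm : IsMaximalPoly t n) {θ θ' : A} (hθ : θ ∈ M) (h : IsQuadRoot t n θ) (hθ' : θ' ∈ M')
    (h' : IsQuadRoot t n θ') :
    ∃ σ : A ≃ₐ[ℚ_[p]] A, (∀ x, x ∈ M ↔ σ x ∈ M') ∧ σ θ = θ' := by
  rcases hA.cases with ⟨a, b, ha, hb, hdiv, hdiv', ⟨e⟩⟩ | ⟨⟨e⟩⟩
  · obtain ⟨ht, hn⟩ := (h.map e).trd_nrd_eq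
    obtain ⟨ht', hn'⟩ := (h'.map e).trd_nrd_eq
    obtain ⟨u, hu, hc⟩ := exists_conj two_ne_zero ha (ht.trans ht'.symm) (hn.trans hn'.symm)
      (h'.map e).not_scalar
    have hu' := hdiv u hu
    obtain ⟨v, rfl⟩ := hu'
    let τ : ℍ[ℚ_[p],a,b] ≃ₐ[ℚ_[p]] ℍ[ℚ_[p],a,b] := MulSemiringAction.toAlgEquiv ℚ_[p] _
      (ConjAct.toConjAct v)
    have hτ : ∀ x, τ x = v * x * ((v⁻¹ : (ℍ[ℚ_[p],a,b])ˣ) : ℍ[ℚ_[p],a,b]) := fun _ => rfl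
    refine ⟨(e.trans τ).trans e.symm, fun x => ?_, ?_⟩
    · rw [hM.mem_iff ha hb hdiv e, hM'.mem_iff ha hb hdiv e]
      simp only [AlgEquiv.trans_apply, AlgEquiv.apply_symm_apply, hτ]
      rw [nrd_mul, nrd_mul, mul_right_comm, ← nrd_mul, Units.mul_inv, nrd_one, one_mul]
    · simp only [AlgEquiv.trans_apply, hτ]
      rw [hc, mul_assoc, Units.mul_inv, mul_one, AlgEquiv.symm_apply_apply]
  · obtain ⟨σ, hσ⟩ := exists_isMatrixModel e hM
    obtain ⟨τ, hτ⟩ := exists_isMatrixModel e hM'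
    obtain ⟨σ', h1, h2⟩ := hσ.exists_companion hm hθ h.sq h.not_scalar
    obtain ⟨τ', h3, h4⟩ := hτ.exists_companion hm hθ' h'.sq h'.not_scalar
    refine ⟨σ'.trans τ'.symm, fun x => by rw [h1 x, h3]; simp, ?_⟩
    rw [AlgEquiv.trans_apply, h2, ← h4, AlgEquiv.symm_apply_apply]

end PadicOrder
end QuatOrder
end

/-! ### Orders between `ℤ_p[θ]` and a maximal order. -/

noncomputable section
namespace QuatOrder

section PadicSuborder

variable {p : ℕ} [Fact p.Prime]
variable {A : Type*} [Ring A] [Algebra ℚ_[p] A] [Algebra ℤ_[p] A] [IsScalarTower ℤ_[p] ℚ_[p] A]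
variable {t n : ℤ_[p]} {θ : A}

/-- The index of `G ∩ M` in `M`. -/
abbrev padicIndex (M G : Subalgebra ℤ_[p] A) : ℕ :=
  (Subalgebra.toSubmodule G).toAddSubgroup.relIndex (Subalgebra.toSubmodule M).toAddSubgroup

/-- Evaluation at a root of `X² - tX + n`. -/
def IsQuadRoot.eval (h : IsQuadRoot t n θ) : QuadOrder t n →ₐ[ℤ_[p]] A :=
  QuadraticAlgebra.lift ⟨θ, by
    rw [h.sq, ← algebraMap_smul ℚ_[p] (-n), ← algebraMap_smul ℚ_[p] t, map_neg, neg_smul,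
      neg_add_eq_sub]; rfl⟩

theorem IsQuadRoot.eval_apply (h : IsQuadRoot t n θ) (r : QuadOrder t n) :
    h.eval r = r.re • (1 : A) + r.im • θ := by
  simp [IsQuadRoot.eval]

theorem IsQuadRoot.eval_mem (h : IsQuadRoot t n θ) {G : Subalgebra ℤ_[p] A} (hθ : θ ∈ G)
    (r : QuadOrder t n) : h.eval r ∈ G := by
  rw [h.eval_apply]
  exact add_mem (G.smul_mem G.one_mem _) (G.smul_mem hθ _)

/-- `M` is generated by `y` over the quadratic order `ℤ_p[θ]`, modulo `ℤ_p[θ]`. -/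
structure IsCyclicOver (h : IsQuadRoot t n θ) (M : Subalgebra ℤ_[p] A) (y : A) : Prop where
  root_mem : θ ∈ M
  gen_mem : y ∈ M
  exists_eq : ∀ x ∈ M, ∃ r s, x = h.eval r + h.eval s * y

theorem IsMaximalPadicOrder.exists_isCyclicOver (hA : IsPadicQuaternion (p := p) A)
    {M : Subalgebra ℤ_[p] A} (hM : IsMaximalPadicOrder M) (hm : IsMaximalPoly t n) (hθ : θ ∈ M)
    (h : IsQuadRoot t n θ) : ∃ y, IsCyclicOver h M y := by
  obtain ⟨y, hy, hc⟩ := hM.exists_cyclic_generator hA hm hθ h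
  refine ⟨y, hθ, hy, fun x hx => ?_⟩
  obtain ⟨c0, c1, c2, c3, rfl⟩ := hc x hx
  refine ⟨⟨c0, c1⟩, ⟨c2, c3⟩, ?_⟩
  rw [h.eval_apply, h.eval_apply, add_mul, smul_mul_assoc, smul_mul_assoc, one_mul, add_assoc,
    add_assoc]

/-- The elements `r` with `r y ∈ G`. -/
def conductorIdeal (h : IsQuadRoot t n θ) {G : Subalgebra ℤ_[p] A} (hθ : θ ∈ G) (y : A) :
    Ideal (QuadOrder t n) where
  carrier := {r | h.eval r * y ∈ G}
  add_mem' := by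
    intro a b ha hb
    simp only [Set.mem_ofPred_eq, map_add, add_mul] at *
    exact add_mem ha hb
  zero_mem' := by simp [G.zero_mem]
  smul_mem' := by
    intro c x hx
    simp only [Set.mem_ofPred_eq, smul_eq_mul, map_mul, mul_assoc] at *
    exact G.mul_mem (h.eval_mem hθ c) hx

theorem mem_conductorIdeal (h : IsQuadRoot t n θ) {G : Subalgebra ℤ_[p] A} (hθ : θ ∈ G) (y : A)
    (r : QuadOrder t n) : r ∈ conductorIdeal h hθ y ↔ h.eval r * y ∈ G := Iff.rfl

variable {M G G' : Subalgebra ℤ_[p] A} {y : A}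

/-- The map `s ↦ s y` induces an isomorphism from the quotient by the conductor ideal onto `M / G`,
because `ℤ_p[θ]` lies in `G`. -/
theorem IsCyclicOver.padicIndex_eq {h : IsQuadRoot t n θ} (hM : IsCyclicOver h M y)
    (hθ : θ ∈ G) (hG : G ≤ M) :
    padicIndex M G = (conductorIdeal h hθ y).toAddSubgroup.index := by
  let f : QuadOrder t n →+ A := (AddMonoidHom.mulRight y).comp h.eval.toRingHom.toAddMonoidHom
  have h1 : (conductorIdeal h hθ y).toAddSubgroup =
      (Subalgebra.toSubmodule G).toAddSubgroup.comap f := rfl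
  have h2 : (Subalgebra.toSubmodule M).toAddSubgroup =
      f.range ⊔ (Subalgebra.toSubmodule G).toAddSubgroup := by
    apply le_antisymm
    · intro x hx
      obtain ⟨r, s, rfl⟩ := hM.exists_eq x hx
      rw [add_comm]
      exact AddSubgroup.add_mem_sup ⟨s, rfl⟩ (h.eval_mem hθ r)
    · refine sup_le ?_ hG
      rintro _ ⟨s, rfl⟩
      exact M.mul_mem (h.eval_mem hM.root_mem s) hM.gen_mem
  rw [h1, AddSubgroup.index_comap, padicIndex, h2, AddSubgroup.relIndex_sup_right]

theorem IsCyclicOver.le_of_conductorIdeal_le {h : IsQuadRoot t n θ} (hM : IsCyclicOver h M y)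
    (hθ : θ ∈ G) (hθ' : θ ∈ G') (hG : G ≤ M)
    (hle : conductorIdeal h hθ y ≤ conductorIdeal h hθ' y) : G ≤ G' := by
  intro x hx
  obtain ⟨r, s, rfl⟩ := hM.exists_eq x (hG hx)
  refine add_mem (h.eval_mem hθ' r) (hle (x := s) ?_)
  have := sub_mem hx (h.eval_mem hθ r)
  rwa [add_sub_cancel_left] at this

theorem ideal_le_total_of_dvd_total {S : Type*} [CommRing S] (h : ∀ x y : S, x ∣ y ∨ y ∣ x)
    (I J : Ideal S) : I ≤ J ∨ J ≤ I := by
  by_contra! hc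
  obtain ⟨x, hx, hxJ⟩ := SetLike.not_le_iff_exists.1 hc.1
  obtain ⟨y, hy, hyI⟩ := SetLike.not_le_iff_exists.1 hc.2
  rcases h x y with h | h
  · exact hyI (I.mem_of_dvd h hx)
  · exact hxJ (J.mem_of_dvd h hy)

/-- The conductor ideal determines the order, two such ideals are comparable in the non-split case,
and nested ideals of the same finite index are equal. -/
theorem IsCyclicOver.eq_of_padicIndex_eq {h : IsQuadRoot t n θ} (hM : IsCyclicOver h M y)
    (hm : IsMaximalPoly t n) (hs : ¬ IsSplitPoly t n)
    (hθ : θ ∈ G) (hθ' : θ ∈ G') (hG : G ≤ M) (hG' : G' ≤ M)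
    (hi : padicIndex M G = padicIndex M G') (h0 : padicIndex M G ≠ 0) : G = G' := by
  wlog hle : conductorIdeal h hθ y ≤ conductorIdeal h hθ' y generalizing G G'
  · exact (this hθ' hθ hG' hG hi.symm (hi ▸ h0) ((ideal_le_total_of_dvd_total
      (quadOrder_dvd_total hm hs) _ _).resolve_left hle)).symm
  refine le_antisymm (hM.le_of_conductorIdeal_le hθ hθ' hG hle) ?_
  apply hM.le_of_conductorIdeal_le hθ' hθ hG'
  rw [hM.padicIndex_eq hθ hG] at hi h0
  rw [hM.padicIndex_eq hθ' hG'] at hi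
  have h1 := AddSubgroup.relIndex_mul_index (H := (conductorIdeal h hθ y).toAddSubgroup)
    (K := (conductorIdeal h hθ' y).toAddSubgroup) hle
  rw [← hi] at h1
  exact AddSubgroup.relIndex_eq_one.1 (Nat.eq_of_mul_eq_mul_right (Nat.pos_of_ne_zero h0)
    (h1.trans (one_mul _).symm))

/-- The elements `1, θ, y, θy` span a space of dimension four, so they are independent and `M` is
free over `ℤ_p[θ]`. -/
theorem IsCyclicOver.eval_injective {h : IsQuadRoot t n θ} (hM : IsCyclicOver h M y)
    (hr : Module.finrank ℚ_[p] A = 4) (hsp : ∀ x : A, ∃ N : ℕ, ((p : ℤ_[p]) ^ N) • x ∈ M)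
    {r s : QuadOrder t n} (he : h.eval r + h.eval s * y = 0) : s = 0 := by
  have hspan : ⊤ ≤ Submodule.span ℚ_[p] (Set.range ![1, θ, y, θ * y]) := by
    intro x _
    obtain ⟨N, hN⟩ := hsp x
    obtain ⟨r, s, hx⟩ := hM.exists_eq _ hN
    have hx' : x = ((p : ℚ_[p]) ^ N)⁻¹ • ((p : ℤ_[p]) ^ N) • x := by
      rw [← algebraMap_smul ℚ_[p] ((p : ℤ_[p]) ^ N), smul_smul]
      simp
    rw [hx', hx, h.eval_apply, h.eval_apply, add_mul, smul_mul_assoc, smul_mul_assoc, one_mul]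
    simp only [← algebraMap_smul ℚ_[p] (_ : ℤ_[p]) (_ : A)]
    have hv : ∀ i, ![1, θ, y, θ * y] i ∈
        Submodule.span ℚ_[p] (Set.range ![1, θ, y, θ * y]) := fun i =>
      Submodule.subset_span (Set.mem_range_self i)
    exact Submodule.smul_mem _ _ (add_mem (add_mem (Submodule.smul_mem _ _ (hv 0))
      (Submodule.smul_mem _ _ (hv 1))) (add_mem (Submodule.smul_mem _ _ (hv 2))
      (Submodule.smul_mem _ _ (hv 3))))
  have hli := linearIndependent_of_top_le_span_of_card_eq_finrank hspan (by simp [hr])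
  rw [h.eval_apply, h.eval_apply, add_mul, smul_mul_assoc, smul_mul_assoc, one_mul] at he
  simp only [← algebraMap_smul ℚ_[p] (_ : ℤ_[p]) (_ : A)] at he
  have := Fintype.linearIndependent_iff.1 hli ![(r.re : ℚ_[p]), r.im, s.re, s.im] (by
    rw [Fin.sum_univ_four, ← he]
    simp only [Matrix.cons_val, add_assoc]; rfl)
  ext
  · exact PadicInt.ext (this 2)
  · exact PadicInt.ext (this 3)

/-- The order `ℤ_p[θ] + ρ M`. -/
def suborder (h : IsQuadRoot t n θ) (M : Subalgebra ℤ_[p] A) (hθ : θ ∈ M) (ρ : QuadOrder t n) :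
    Subalgebra ℤ_[p] A where
  carrier := {x | ∃ r, ∃ m ∈ M, x = h.eval r + h.eval ρ * m}
  mul_mem' := by
    rintro _ _ ⟨r, m, hm, rfl⟩ ⟨r', m', hm', rfl⟩
    refine ⟨r * r', h.eval r * m' + (m * h.eval r' + m * (h.eval ρ * m')), ?_, ?_⟩
    · have := h.eval_mem hθ
      exact add_mem (M.mul_mem (this r) hm') (add_mem (M.mul_mem hm (this r'))
        (M.mul_mem hm (M.mul_mem (this ρ) hm')))
    -- Commutativity of `ℤ_p[θ]` moves `ρ` to the front; the remaining terms stay in the right ideal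
    -- `ρ M`.
    · have : h.eval r * (h.eval ρ * m') = h.eval ρ * (h.eval r * m') := by
        rw [← mul_assoc, ← mul_assoc, ← map_mul, ← map_mul, mul_comm]
      simp only [map_mul, add_mul, mul_add, mul_assoc, this]
      abel
  add_mem' := by
    rintro _ _ ⟨r, m, hm, rfl⟩ ⟨r', m', hm', rfl⟩
    exact ⟨r + r', m + m', add_mem hm hm', by rw [map_add, mul_add]; abel⟩
  algebraMap_mem' c := ⟨algebraMap _ _ c, 0, M.zero_mem, by
    rw [mul_zero, add_zero, AlgHom.commutes]⟩

/-- From `M = R ⊕ R y` one gets `R + ρM = R ⊕ ρR y`, so the conductor ideal is generated by `ρ`. -/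
theorem IsCyclicOver.padicIndex_suborder {h : IsQuadRoot t n θ} (hM : IsCyclicOver h M y)
    (hr : Module.finrank ℚ_[p] A = 4) (hsp : ∀ x : A, ∃ N : ℕ, ((p : ℤ_[p]) ^ N) • x ∈ M)
    (ρ : QuadOrder t n) : padicIndex M (suborder h M hM.root_mem ρ) = principalIndex ρ := by
  have hθ : θ ∈ suborder h M hM.root_mem ρ :=
    ⟨⟨0, 1⟩, 0, M.zero_mem, by rw [h.eval_apply]; simp⟩
  rw [hM.padicIndex_eq hθ, principalIndex]
  · congr 2
    ext r
    rw [mem_conductorIdeal, Ideal.mem_span_singleton]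
    constructor
    · rintro ⟨a, m, hm, hrm⟩
      obtain ⟨b, c, rfl⟩ := hM.exists_eq m hm
      refine ⟨c, ?_⟩
      rw [← sub_eq_zero]
      refine hM.eval_injective hr hsp (r := -(a + ρ * b)) ?_
      rw [map_sub, map_neg, map_add, map_mul, map_mul, sub_mul, hrm, mul_add, ← mul_assoc]
      abel
    · rintro ⟨c, rfl⟩
      exact ⟨0, h.eval c * y, M.mul_mem (h.eval_mem hM.root_mem c) hM.gen_mem, by
        rw [map_zero, zero_add, map_mul, mul_assoc]⟩
  · rintro _ ⟨r, m, hm, rfl⟩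
    exact add_mem (h.eval_mem hM.root_mem r) (M.mul_mem (h.eval_mem hM.root_mem ρ) hm)

/-- Orders of given index containing a quadratic order. -/
theorem IsMaximalPadicOrder.exists_suborder (hA : IsPadicQuaternion (p := p) A)
    (hM : IsMaximalPadicOrder M) (hm : IsMaximalPoly t n) (hθ : θ ∈ M) (h : IsQuadRoot t n θ)
    (m : ℕ) (hi : IsInertPoly t n → Even m) :
    ∃ L : Subalgebra ℤ_[p] A, L ≤ M ∧ θ ∈ L ∧ padicIndex M L = p ^ m ∧
      ∃ N : ℕ, ∀ x ∈ M, ((p : ℤ_[p]) ^ N) • x ∈ L := by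
  obtain ⟨y, hy⟩ := hM.exists_isCyclicOver hA hm hθ h
  obtain ⟨ρ, N, h1, c, h2⟩ := quadOrder_exists_principalIndex hm m hi
  refine ⟨suborder h M hθ ρ, ?_, ⟨⟨0, 1⟩, 0, M.zero_mem, by rw [h.eval_apply]; simp⟩, ?_, N, ?_⟩
  · rintro _ ⟨r, m, hm, rfl⟩
    exact add_mem (h.eval_mem hθ r) (M.mul_mem (h.eval_mem hθ ρ) hm)
  · rw [hy.padicIndex_suborder hA.finrank_eq (hM.exists_smul_mem hA), h1]
  · intro x hx
    refine ⟨0, h.eval c * x, M.mul_mem (h.eval_mem hθ c) hx, ?_⟩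
    rw [map_zero, zero_add, ← mul_assoc, ← map_mul, ← h2, map_pow, map_natCast,
      Algebra.smul_def, map_pow, map_natCast]

end PadicSuborder
end QuatOrder
end

/-! ### Eichler orders and conjugacy of local orders of equal index. -/

noncomputable section
namespace QuatOrder

section PadicConjugacy

variable {p : ℕ} [Fact p.Prime]

theorem padicInt_index_span_pow (k : ℕ) :
    (Ideal.span {(p : ℤ_[p]) ^ k}).toAddSubgroup.index = p ^ k := by
  have := principalIndex_eq_card (r := (p : ℤ_[p]) ^ k)
    (PadicInt.toZModPow (p := p) k).toAddMonoidHom (ZMod.ringHom_surjective _) (fun x => by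
      rw [← Ideal.mem_span_singleton, ← PadicInt.ker_toZModPow, RingHom.mem_ker]; rfl)
  rw [principalIndex] at this
  rw [this, Nat.card_zmod]

theorem padicInt_ideal_eq_span_pow (I : Ideal ℤ_[p]) (hI : I.toAddSubgroup.index ≠ 0) :
    ∃ k : ℕ, I = Ideal.span {(p : ℤ_[p]) ^ k} := by
  apply PadicInt.ideal_eq_span_pow_p
  rintro rfl
  apply hI
  have : (⊥ : Ideal ℤ_[p]).toAddSubgroup = ⊥ := rfl
  rw [this, AddSubgroup.index_bot]
  exact Nat.card_eq_zero_of_infinite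

variable {A : Type*} [Ring A] [Algebra ℚ_[p] A] [Algebra ℤ_[p] A] [IsScalarTower ℤ_[p] ℚ_[p] A]
variable {t n : ℤ_[p]} {θ : A} {M G : Subalgebra ℤ_[p] A}

/-- The eigenvalues differ modulo `p`, so the idempotent `(θ - w) / (z - w)` has coefficients in
`ℤ_p`. -/
theorem matrix_mem_of_entries {σ : A ≃ₐ[ℚ_[p]] Matrix (Fin 2) (Fin 2) ℚ_[p]} {z w : ℤ_[p]}
    (hu : ¬ (p : ℤ_[p]) ∣ z - w) (hθ : θ ∈ G) (h : σ θ = !![(z : ℚ_[p]), 0; 0, (w : ℚ_[p])]) :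
    σ.symm !![1, 0; 0, 0] ∈ G ∧ σ.symm !![0, 0; 0, 1] ∈ G := by
  obtain ⟨v, hv⟩ := ((padicInt_isUnit_iff_not_dvd _).2 hu).exists_right_inv
  have hv' : ((z : ℚ_[p]) - w) * v = 1 := by
    exact_mod_cast congrArg (fun z : ℤ_[p] => (z : ℚ_[p])) hv
  have h1 : σ.symm !![1, 0; 0, 0] ∈ G := by
    have : σ.symm !![1, 0; 0, 0] = v • (θ - w • (1 : A)) := by
      apply σ.injective
      simp only [← algebraMap_smul ℚ_[p] (_ : ℤ_[p]) (_ : A), map_sub, map_smul, map_one, h,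
        AlgEquiv.apply_symm_apply]
      have h : ∀ z : ℤ_[p], algebraMap ℤ_[p] ℚ_[p] z = z := fun _ => rfl
      ext i j; fin_cases i <;> fin_cases j <;> simp [h]
      linear_combination -hv'
    rw [this]
    exact G.smul_mem (sub_mem hθ (G.smul_mem G.one_mem _)) _
  refine ⟨h1, ?_⟩
  have : σ.symm !![0, 0; 0, 1] = 1 - σ.symm !![1, 0; 0, 0] := by
    apply σ.injective
    rw [map_sub, AlgEquiv.apply_symm_apply, AlgEquiv.apply_symm_apply, map_one]
    ext i j; fin_cases i <;> fin_cases j <;> simp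
  rw [this]
  exact sub_mem G.one_mem h1

/-- The multiples of a given matrix lying in an order. -/
def multiplierIdeal (G : Subalgebra ℤ_[p] A) (x : A) : Ideal ℤ_[p] :=
  (Subalgebra.toSubmodule G).comap (LinearMap.toSpanSingleton ℤ_[p] A x)

theorem mem_multiplierIdeal {x : A} {c : ℤ_[p]} : c ∈ multiplierIdeal G x ↔ c • x ∈ G := Iff.rfl

theorem exists_entries {σ : A ≃ₐ[ℚ_[p]] Matrix (Fin 2) (Fin 2) ℚ_[p]}
    (hσ : IsMatrixModel M σ) {x : A} (hx : x ∈ M) : ∃ a b c d : ℤ_[p],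
      σ x = !![(a : ℚ_[p]), b; c, d] ∧
      x = a • σ.symm !![1, 0; 0, 0] + b • σ.symm !![0, 1; 0, 0] + c • σ.symm !![0, 0; 1, 0] +
        d • σ.symm !![0, 0; 0, 1] := by
  obtain ⟨a, ha⟩ := exists_padicInt_eq ((hσ x).1 hx 0 0)
  obtain ⟨b, hb⟩ := exists_padicInt_eq ((hσ x).1 hx 0 1)
  obtain ⟨c, hc⟩ := exists_padicInt_eq ((hσ x).1 hx 1 0)
  obtain ⟨d, hd⟩ := exists_padicInt_eq ((hσ x).1 hx 1 1)
  have h : σ x = !![(a : ℚ_[p]), b; c, d] := by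
    ext i j; fin_cases i <;> fin_cases j <;> simp [ha, hb, hc, hd]
  refine ⟨a, b, c, d, h, σ.injective ?_⟩
  rw [h]
  simp only [← algebraMap_smul ℚ_[p] (_ : ℤ_[p]) (_ : A), map_add, map_smul,
    AlgEquiv.apply_symm_apply]
  have h : ∀ z : ℤ_[p], algebraMap ℤ_[p] ℚ_[p] z = z := fun _ => rfl
  ext i j; fin_cases i <;> fin_cases j <;> simp [h]

/-- An order containing the diagonal idempotents is described by two ideals. -/
theorem mem_iff_multiplierIdeal {σ : A ≃ₐ[ℚ_[p]] Matrix (Fin 2) (Fin 2) ℚ_[p]}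
    (h1 : σ.symm !![1, 0; 0, 0] ∈ G) (h2 : σ.symm !![0, 0; 0, 1] ∈ G) (a b c d : ℤ_[p]) :
    a • σ.symm !![1, 0; 0, 0] + b • σ.symm !![0, 1; 0, 0] + c • σ.symm !![0, 0; 1, 0] +
        d • σ.symm !![0, 0; 0, 1] ∈ G ↔
      b ∈ multiplierIdeal G (σ.symm !![0, 1; 0, 0]) ∧
      c ∈ multiplierIdeal G (σ.symm !![0, 0; 1, 0]) := by
  constructor
  · intro hx
    constructor
    · rw [mem_multiplierIdeal]
      -- Multiplying by an idempotent on each side isolates one off-diagonal entry.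
      convert G.mul_mem (G.mul_mem h1 hx) h2 using 1
      apply σ.injective
      simp only [← algebraMap_smul ℚ_[p] (_ : ℤ_[p]) (_ : A), map_add, map_mul, map_smul,
        AlgEquiv.apply_symm_apply]
      ext i j; fin_cases i <;> fin_cases j <;> simp
    · rw [mem_multiplierIdeal]
      convert G.mul_mem (G.mul_mem h2 hx) h1 using 1
      apply σ.injective
      simp only [← algebraMap_smul ℚ_[p] (_ : ℤ_[p]) (_ : A), map_add, map_mul, map_smul,
        AlgEquiv.apply_symm_apply]
      ext i j; fin_cases i <;> fin_cases j <;> simp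
  · rintro ⟨hb, hc⟩
    exact add_mem (add_mem (add_mem (G.smul_mem h1 _) hb) hc) (G.smul_mem h2 _)

/-- Modulo `G` only the off-diagonal entries matter, and those belonging to `G` form a product of
two ideals of `ℤ_p`. -/
theorem IsMatrixModel.padicIndex_eq {σ} (hσ : IsMatrixModel M σ) (hG : G ≤ M)
    (h1 : σ.symm !![1, 0; 0, 0] ∈ G) (h2 : σ.symm !![0, 0; 0, 1] ∈ G) :
    padicIndex M G = (multiplierIdeal G (σ.symm !![0, 1; 0, 0])).toAddSubgroup.index *
      (multiplierIdeal G (σ.symm !![0, 0; 1, 0])).toAddSubgroup.index := by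
  let f : ℤ_[p] × ℤ_[p] →+ A :=
    (LinearMap.coprod (LinearMap.toSpanSingleton ℤ_[p] A (σ.symm !![0, 1; 0, 0]))
      (LinearMap.toSpanSingleton ℤ_[p] A (σ.symm !![0, 0; 1, 0]))).toAddMonoidHom
  have hf : ∀ b c, f (b, c) = b • σ.symm !![0, 1; 0, 0] + c • σ.symm !![0, 0; 1, 0] :=
    fun _ _ => rfl
  have h3 : (Subalgebra.toSubmodule G).toAddSubgroup.comap f =
      (multiplierIdeal G (σ.symm !![0, 1; 0, 0])).toAddSubgroup.prod
      (multiplierIdeal G (σ.symm !![0, 0; 1, 0])).toAddSubgroup := by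
    ext ⟨b, c⟩
    have := mem_iff_multiplierIdeal h1 h2 0 b c 0
    rw [zero_smul, zero_smul, zero_add, add_zero, ← hf] at this
    exact this
  have h4 : (Subalgebra.toSubmodule M).toAddSubgroup =
      f.range ⊔ (Subalgebra.toSubmodule G).toAddSubgroup := by
    apply le_antisymm
    · intro x hx
      obtain ⟨a, b, c, d, -, rfl⟩ := exists_entries hσ hx
      have : a • σ.symm !![1, 0; 0, 0] + b • σ.symm !![0, 1; 0, 0] + c • σ.symm !![0, 0; 1, 0] +
        d • σ.symm !![0, 0; 0, 1] = f (b, c) +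
          (a • σ.symm !![1, 0; 0, 0] + d • σ.symm !![0, 0; 0, 1]) := by rw [hf]; abel
      rw [this]
      exact AddSubgroup.add_mem_sup ⟨_, rfl⟩ (add_mem (G.smul_mem h1 _) (G.smul_mem h2 _))
    · refine sup_le ?_ hG
      rintro _ ⟨⟨b, c⟩, rfl⟩
      rw [hf]
      refine add_mem (M.smul_mem ((hσ _).2 fun i j => ?_) _) (M.smul_mem ((hσ _).2 fun i j => ?_) _)
      all_goals
        rw [AlgEquiv.apply_symm_apply]; fin_cases i <;> fin_cases j <;> simp
  rw [← AddSubgroup.index_prod, ← h3, AddSubgroup.index_comap, padicIndex, h4,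
    AddSubgroup.relIndex_sup_right]

/-- An order containing the diagonal idempotents is conjugate to an Eichler order. -/
theorem IsMatrixModel.exists_eichler {σ} (hσ : IsMatrixModel M σ) (hG : G ≤ M)
    (h1 : σ.symm !![1, 0; 0, 0] ∈ G) (h2 : σ.symm !![0, 0; 0, 1] ∈ G)
    (h0 : padicIndex M G ≠ 0) :
    ∃ (k : ℕ) (σ' : A ≃ₐ[ℚ_[p]] Matrix (Fin 2) (Fin 2) ℚ_[p]), padicIndex M G = p ^ k ∧
      ∀ x, x ∈ G ↔ (‖σ' x 0 0‖ ≤ 1 ∧ ‖σ' x 0 1‖ ≤ 1 ∧ ‖σ' x 1 0‖ ≤ ‖(p : ℚ_[p]) ^ k‖ ∧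
        ‖σ' x 1 1‖ ≤ 1) := by
  have hi := hσ.padicIndex_eq hG h1 h2
  rw [hi] at h0
  obtain ⟨a, ha⟩ := padicInt_ideal_eq_span_pow _ (left_ne_zero_of_mul h0)
  obtain ⟨b, hb⟩ := padicInt_ideal_eq_span_pow _ (right_ne_zero_of_mul h0)
  have hpa : (p : ℚ_[p]) ^ a ≠ 0 := pow_ne_zero _ padic_p_ne_zero
  -- Conjugation by `diag(p^a, 1)` divides the upper right entry by `p^a` and multiplies the lower
  -- left one by `p^a`, collecting the whole level `p^(a+b)` in the lower left corner.
  obtain ⟨σ', h3⟩ := exists_conj_equiv σ (h := !![(p : ℚ_[p]) ^ a, 0; 0, 1])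
    (h' := !![((p : ℚ_[p]) ^ a)⁻¹, 0; 0, 1])
    (by ext i j; fin_cases i <;> fin_cases j <;> simp [hpa])
    (by ext i j; fin_cases i <;> fin_cases j <;> simp [hpa])
  refine ⟨a + b, σ', ?_, fun x => ?_⟩
  · rw [hi, ha, hb, padicInt_index_span_pow, padicInt_index_span_pow, pow_add]
  have e00 : σ' x 0 0 = σ x 0 0 := by
    rw [h3, Matrix.eta_fin_two (σ x)]; simp [hpa, mul_comm]
  have e01 : σ' x 0 1 = ((p : ℚ_[p]) ^ a)⁻¹ * σ x 0 1 := by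
    rw [h3, Matrix.eta_fin_two (σ x)]; simp
  have e10 : σ' x 1 0 = (p : ℚ_[p]) ^ a * σ x 1 0 := by
    rw [h3, Matrix.eta_fin_two (σ x)]; simp [mul_comm]
  have e11 : σ' x 1 1 = σ x 1 1 := by
    rw [h3, Matrix.eta_fin_two (σ x)]; simp
  have hp1 : ∀ k, ‖(p : ℚ_[p]) ^ k‖ ≤ 1 := fun k => by
    rw [norm_pow]; exact pow_le_one₀ (norm_nonneg _) Padic.norm_p_lt_one.le
  have hn : 0 < ‖(p : ℚ_[p]) ^ a‖ := norm_pos_iff.2 hpa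
  have q01 : ‖σ' x 0 1‖ ≤ 1 ↔ ‖σ x 0 1‖ ≤ ‖(p : ℚ_[p]) ^ a‖ := by
    rw [e01, norm_mul, norm_inv, inv_mul_le_one₀ hn]
  have q10 : ‖σ' x 1 0‖ ≤ ‖(p : ℚ_[p]) ^ (a + b)‖ ↔ ‖σ x 1 0‖ ≤ ‖(p : ℚ_[p]) ^ b‖ := by
    rw [e10, pow_add, norm_mul, norm_mul, mul_le_mul_iff_right₀ hn]
  rw [q01, q10, e00, e11]
  have hdv : ∀ (k : ℕ) (c : ℤ_[p]), c ∈ Ideal.span {(p : ℤ_[p]) ^ k} ↔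
      ‖(c : ℚ_[p])‖ ≤ ‖(p : ℚ_[p]) ^ k‖ := by
    intro k c
    rw [← PadicInt.norm_le_pow_iff_mem_span_pow, ← PadicInt.norm_def]
    simp
  constructor
  · intro hx
    obtain ⟨c1, c2, c3, c4, h, hx'⟩ := exists_entries hσ (hG hx)
    rw [hx'] at hx
    have := (mem_iff_multiplierIdeal h1 h2 _ _ _ _).1 hx
    rw [ha, hb, hdv, hdv] at this
    rw [h]
    simpa [PadicInt.norm_le_one] using this
  · rintro ⟨i1, i2, i3, i4⟩
    have hx : x ∈ M := by
      rw [hσ]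
      intro i j
      fin_cases i <;> fin_cases j
      · exact i1
      · exact i2.trans (hp1 _)
      · exact i3.trans (hp1 _)
      · exact i4
    obtain ⟨c1, c2, c3, c4, h, hx'⟩ := exists_entries hσ hx
    rw [hx', mem_iff_multiplierIdeal h1 h2, ha, hb, hdv, hdv]
    rw [h] at i2 i3
    exact ⟨i2, i3⟩

theorem IsMaximalPadicOrder.exists_eichler (hA : IsPadicQuaternion (p := p) A)
    (hM : IsMaximalPadicOrder M) (hm : IsMaximalPoly t n) (hs : IsSplitPoly t n) (hG : G ≤ M)
    (hθ : θ ∈ G) (h : IsQuadRoot t n θ) (h0 : padicIndex M G ≠ 0) :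
    ∃ (k : ℕ) (σ' : A ≃ₐ[ℚ_[p]] Matrix (Fin 2) (Fin 2) ℚ_[p]), padicIndex M G = p ^ k ∧
      ∀ x, x ∈ G ↔ (‖σ' x 0 0‖ ≤ 1 ∧ ‖σ' x 0 1‖ ≤ 1 ∧ ‖σ' x 1 0‖ ≤ ‖(p : ℚ_[p]) ^ k‖ ∧
        ‖σ' x 1 1‖ ≤ 1) := by
  rcases hA.cases with ⟨-, -, -, -, -, hdiv, -⟩ | ⟨⟨e⟩⟩
  · exact absurd hs (hA.not_isSplitPoly hdiv h)
  · obtain ⟨z, hz, hd⟩ := exists_roots_of_split hs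
    obtain ⟨σ, hσ⟩ := exists_isMatrixModel e hM
    obtain ⟨τ, h1, h2⟩ := hσ.exists_companion hm (hG hθ) h.sq h.not_scalar
    obtain ⟨ρ, h3, h4⟩ := h1.exists_diagonal hz hd h2
    have h5 := matrix_mem_of_entries (z := z) (w := t - z) (by convert hd using 2; ring) hθ
      (by push_cast; exact h4)
    exact h3.exists_eichler hG h5.1 h5.2 h0

/-- Orders of the same index which contain the same quadratic order are conjugate. -/
theorem IsMaximalPadicOrder.exists_equiv_of_padicIndex_eq (hA : IsPadicQuaternion (p := p) A)
    {M' G' : Subalgebra ℤ_[p] A} {θ' : A} (hm : IsMaximalPoly t n)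
    (hM : IsMaximalPadicOrder M) (hG : G ≤ M) (hθ : θ ∈ G) (h : IsQuadRoot t n θ)
    (hM' : IsMaximalPadicOrder M') (hG' : G' ≤ M') (hθ' : θ' ∈ G') (h' : IsQuadRoot t n θ')
    (hi : padicIndex M G = padicIndex M' G') (h0 : padicIndex M G ≠ 0) :
    ∃ σ : A ≃ₐ[ℚ_[p]] A, ∀ x, x ∈ G ↔ σ x ∈ G' := by
  by_cases hs : IsSplitPoly t n
  · obtain ⟨k, σ, h1, h2⟩ := hM.exists_eichler hA hm hs hG hθ h h0
    obtain ⟨l, τ, h3, h4⟩ := hM'.exists_eichler hA hm hs hG' hθ' h' (hi ▸ h0)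
    have hkl : k = l := Nat.pow_right_injective (Fact.out : p.Prime).two_le
      (h1.symm.trans (hi.trans h3))
    subst hkl
    exact ⟨σ.trans τ.symm, fun x => by rw [h2, h4]; simp⟩
  · obtain ⟨σ, h1, h2⟩ := hM.exists_equiv_of_root hA hM' hm (hG hθ) h (hG' hθ') h'
    obtain ⟨y, hy⟩ := hM.exists_isCyclicOver hA hm (hG hθ) h
    let σ' : A →ₐ[ℤ_[p]] A := (σ : A →ₐ[ℚ_[p]] A).restrictScalars ℤ_[p]
    have hσ' : ∀ x, σ' x = σ x := fun _ => rfl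
    -- After matching maximal orders and roots, the pullback of `G'` contains `θ` and has the same
    -- index in `M` as `G`, so it is `G`.
    have e : G = G'.comap σ' := by
      refine hy.eq_of_padicIndex_eq hm hs hθ (by
        rw [Subalgebra.mem_comap, hσ', h2]; exact hθ') hG (fun x hx => ?_) ?_ h0
      · rw [h1]; exact hG' hx
      · rw [hi, padicIndex, padicIndex]
        have h3 : (Subalgebra.toSubmodule (G'.comap σ')).toAddSubgroup =
          (Subalgebra.toSubmodule G').toAddSubgroup.comap (σ' : A →+ A) := rfl
        have h4 : (Subalgebra.toSubmodule M').toAddSubgroup =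
            (Subalgebra.toSubmodule M).toAddSubgroup.map (σ' : A →+ A) := by
          ext x
          constructor
          · intro hx
            refine ⟨σ.symm x, (h1 _).2 ?_, σ.apply_symm_apply x⟩
            rw [σ.apply_symm_apply]; exact hx
          · rintro ⟨y, hy, rfl⟩
            exact (h1 y).1 hy
        rw [h3, h4, AddSubgroup.relIndex_comap]
    exact ⟨σ, fun x => by rw [e]; rfl⟩

/-- An isomorphism of orders from one of the ambient algebras. -/
theorem nonempty_algEquiv_of_mem_iff {G' : Subalgebra ℤ_[p] A} (σ : A ≃ₐ[ℚ_[p]] A)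
    (h : ∀ x, x ∈ G ↔ σ x ∈ G') : Nonempty (G ≃ₐ[ℤ_[p]] G') := by
  let σ' : A →ₐ[ℤ_[p]] A := (σ : A →ₐ[ℚ_[p]] A).restrictScalars ℤ_[p]
  let f : G →ₐ[ℤ_[p]] G' := (σ'.comp G.val).codRestrict G' fun x => (h x).1 x.2
  refine ⟨AlgEquiv.ofBijective f ⟨fun x y hxy => ?_, fun y => ?_⟩⟩
  · exact Subtype.ext (σ.injective (congrArg Subtype.val hxy))
  · exact ⟨⟨σ.symm y, (h _).2 (by rw [σ.apply_symm_apply]; exact y.2)⟩,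
      Subtype.ext (σ.apply_symm_apply _)⟩

end PadicConjugacy
end QuatOrder
end

/-! ### Parity of indices at inert primes. -/

noncomputable section
namespace QuatOrder

section Parity

/-- If `T x` were a multiple `c x`, then `c` would be a root modulo `p`. Hence `x` and `T x` span a
`T`-stable subgroup isomorphic to `𝔽_p²`. -/
theorem index_eq_sq_of_no_root {X : Type*} [AddCommGroup X] (T : X →+ X) {t n : ℤ}
    (hT : ∀ x, T (T x) = t • T x - n • x) {p : ℕ} (hp : p.Prime)
    (h : ∀ c : ℤ, ¬ (p : ℤ) ∣ c ^ 2 - t * c + n) {x : X} (hx : addOrderOf x = p) :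
    ∃ Y : AddSubgroup X, Nat.card Y = p ^ 2 ∧ Y ≤ Y.comap T := by
  let g : ℤ × ℤ →+ X := (AddMonoidHom.coprod (zmultiplesHom X x) (zmultiplesHom X (T x)))
  have hg : ∀ a b, g (a, b) = a • x + b • T x := fun _ _ => rfl
  have hz : ∀ a : ℤ, a • x = 0 ↔ (p : ℤ) ∣ a := fun a => by
    rw [← hx, addOrderOf_dvd_iff_zsmul_eq_zero]
  have hpT : (p : ℤ) • T x = 0 := by rw [← map_zsmul, (hz p).2 dvd_rfl, map_zero]
  have hker : g.ker = (AddSubgroup.zmultiples (p : ℤ)).prod (AddSubgroup.zmultiples (p : ℤ)) := by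
    ext ⟨a, b⟩
    rw [AddMonoidHom.mem_ker, hg, AddSubgroup.mem_prod, Int.mem_zmultiples_iff,
      Int.mem_zmultiples_iff]
    constructor
    · intro h0
      have hb : (p : ℤ) ∣ b := by
        by_contra hb
        have hco : IsCoprime (p : ℤ) b :=
          (Prime.coprime_iff_not_dvd (Nat.prime_iff_prime_int.1 hp)).2 hb
        obtain ⟨k, v, hkv⟩ := hco
        have hTx : T x = (-(v * a)) • x := by
          calc T x = (k * p + v * b) • T x := by rw [hkv, one_smul]
            _ = k • (p : ℤ) • T x + v • (b • T x) := by rw [add_smul, mul_smul, mul_smul]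
            _ = v • (-(a • x)) := by
              rw [hpT, smul_zero, zero_add, eq_neg_of_add_eq_zero_right h0]
            _ = _ := by rw [← neg_smul, smul_smul, mul_neg]
        generalize -(v * a) = c at hTx
        apply h c
        rw [← hz]
        have := hT x
        rw [hTx, map_zsmul, hTx, smul_smul, smul_smul, ← sub_smul, ← sub_eq_zero, ← sub_smul] at this
        rw [← this]; congr 1; ring
      refine ⟨?_, hb⟩
      obtain ⟨b, rfl⟩ := hb
      rw [mul_comm, mul_smul, hpT, smul_zero, add_zero] at h0
      exact (hz a).1 h0
    · rintro ⟨ha, b, rfl⟩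
      rw [(hz a).2 ha, mul_comm, mul_smul, hpT, smul_zero, add_zero]
  refine ⟨g.range, ?_, ?_⟩
  · rw [← AddSubgroup.index_ker, hker, AddSubgroup.index_prod, Int.index_zmultiples,
      Int.natAbs_natCast, sq]
  · rintro _ ⟨⟨a, b⟩, rfl⟩
    refine ⟨(-(b * n), a + b * t), ?_⟩
    rw [hg, hg, map_add, map_zsmul, map_zsmul, hT, smul_sub, smul_smul, smul_smul, neg_smul,
      add_smul]
    abel

/-- A finite abelian group on which `X² - tX + n`, irreducible modulo `p`, has a root as
endomorphism has order with even `p`-adic valuation. -/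
theorem even_factorization_card {p : ℕ} (hp : p.Prime) {t n : ℤ}
    (h : ∀ c : ℤ, ¬ (p : ℤ) ∣ c ^ 2 - t * c + n) (k : ℕ) :
    ∀ (X : Type*) [AddCommGroup X] [Finite X] (T : X →+ X),
      (∀ x, T (T x) = t • T x - n • x) → Nat.card X ≤ k → Even ((Nat.card X).factorization p) := by
  induction k with
  | zero =>
    intro X _ _ T _ hk
    exact absurd hk (not_le.2 Nat.card_pos)
  | succ k ih =>
    intro X _ _ T hT hk
    by_cases hd : p ∣ Nat.card X
    · have := Fact.mk hp
      -- Dividing by the `T`-stable subgroup of order `p²` lowers the valuation by two, and `T`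
      -- descends to the quotient.
      obtain ⟨x, hx⟩ := exists_prime_addOrderOf_dvd_card' p hd
      obtain ⟨Y, hY, hYT⟩ := index_eq_sq_of_no_root T hT hp h hx
      have hc := Y.card_eq_card_quotient_mul_card_addSubgroup
      have h0 : Nat.card (X ⧸ Y) ≠ 0 := Nat.card_pos.ne'
      have := ih (X ⧸ Y) (QuotientAddGroup.map Y Y T hYT) (by
        intro x
        obtain ⟨x, rfl⟩ := QuotientAddGroup.mk_surjective x
        simp only [QuotientAddGroup.map_mk, hT]
        rfl) (by
        have h2 : 2 ≤ p ^ 2 := hp.two_le.trans (Nat.le_self_pow two_ne_zero p)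
        rw [hc, hY] at hk
        have := Nat.mul_le_mul_left (Nat.card (X ⧸ Y)) h2
        omega)
      rw [hc, hY, Nat.factorization_mul h0 (pow_ne_zero _ hp.ne_zero), Finsupp.add_apply,
        hp.factorization_pow, Finsupp.single_eq_same]
      exact this.add even_two
    · rw [Nat.factorization_eq_zero_of_not_dvd hd]; exact Even.zero

theorem even_factorization_relIndex {p : ℕ} (hp : p.Prime) {t n : ℤ}
    (h : ∀ c : ℤ, ¬ (p : ℤ) ∣ c ^ 2 - t * c + n) {X : Type*} [AddCommGroup X] {H K : AddSubgroup X}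
    (T : X →+ X) (hT : ∀ x, T (T x) = t • T x - n • x) (hH : H ≤ H.comap T) (hK : K ≤ K.comap T)
    (h0 : H.relIndex K ≠ 0) : Even ((H.relIndex K).factorization p) := by
  let T' : K →+ K := (T.comp K.subtype).codRestrict K fun x => hK x.2
  have hT' : ∀ x, (T' x : X) = T x := fun _ => rfl
  have : Finite (K ⧸ H.addSubgroupOf K) := Nat.finite_of_card_ne_zero h0
  have hle : H.addSubgroupOf K ≤ (H.addSubgroupOf K).comap T' := by
    intro x hx
    rw [AddSubgroup.mem_comap, AddSubgroup.mem_addSubgroupOf, hT']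
    exact hH (AddSubgroup.mem_addSubgroupOf.1 hx)
  refine even_factorization_card hp h _ (K ⧸ H.addSubgroupOf K) (QuotientAddGroup.map _ _ T' hle)
    (fun x => ?_) le_rfl
  obtain ⟨x, rfl⟩ := QuotientAddGroup.mk_surjective x
  rw [QuotientAddGroup.map_mk, QuotientAddGroup.map_mk]
  have : T' (T' x) = t • T' x - n • x := Subtype.ext (hT x)
  rw [this]; rfl

end Parity

section PadicParity

variable {p : ℕ} [Fact p.Prime]
variable {A : Type*} [Ring A] [Algebra ℚ_[p] A] [Algebra ℤ_[p] A]

theorem even_factorization_padicIndex {t n : ℤ} (h : ∀ c : ℤ, ¬ (p : ℤ) ∣ c ^ 2 - t * c + n)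
    {θ : A} {M G : Subalgebra ℤ_[p] A} (hG : G ≤ M) (hθ : θ ∈ G)
    (hr : IsQuadRoot (t : ℤ_[p]) (n : ℤ_[p]) θ) (h0 : padicIndex M G ≠ 0) :
    Even ((padicIndex M G).factorization p) := by
  refine even_factorization_relIndex (Fact.out : p.Prime) h (AddMonoidHom.mulLeft θ) (fun x => ?_)
    (fun x hx => G.mul_mem hθ hx) (fun x hx => M.mul_mem (hG hθ) hx) h0
  have h1 := hr.sq
  rw [PadicInt.coe_intCast, PadicInt.coe_intCast, Int.cast_smul_eq_zsmul,
    Int.cast_smul_eq_zsmul] at h1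
  change θ * (θ * x) = t • (θ * x) - n • x
  rw [← mul_assoc, h1, sub_mul, smul_mul_assoc, smul_mul_assoc, one_mul]

end PadicParity
end QuatOrder
end

/-! ### Local components of global orders. -/

noncomputable section
namespace QuatOrder

section LocalComponent

theorem gcd_nsmul_mem {X : Type*} [AddCommGroup X] (H : AddSubgroup X) {a b : ℕ} {x : X}
    (ha : a • x ∈ H) (hb : b • x ∈ H) : a.gcd b • x ∈ H := by
  rw [← natCast_zsmul, Nat.gcd_eq_gcd_ab, add_smul, mul_comm, mul_smul, mul_comm (b : ℤ), mul_smul,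
    natCast_zsmul, natCast_zsmul]
  exact add_mem (H.zsmul_mem ha _) (H.zsmul_mem hb _)

variable {p : ℕ} [Fact p.Prime]

theorem mem_of_nsmul_mem {X : Type*} [AddCommGroup X] [Module ℤ_[p] X] (B : Submodule ℤ_[p] X)
    {k : ℕ} (hk : ¬ p ∣ k) {x : X} (h : k • x ∈ B) : x ∈ B := by
  have hu : IsUnit (k : ℤ_[p]) := by
    rw [PadicInt.isUnit_iff]
    simpa [Nat.coprime_comm] using (Nat.Prime.coprime_iff_not_dvd Fact.out).2 hk
  obtain ⟨v, hv⟩ := hu.exists_left_inv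
  have := B.smul_mem v h
  rwa [← Nat.cast_smul_eq_nsmul ℤ_[p], smul_smul, hv, one_smul] at this

theorem exists_pow_nsmul_mem_of_fg {X : Type*} [AddCommGroup X] [Module ℤ_[p] X]
    {B C : Submodule ℤ_[p] X} (hB : B.FG) (h : ∀ z : X, ∃ N : ℕ, p ^ N • z ∈ C) :
    ∃ N : ℕ, ∀ z ∈ B, p ^ N • z ∈ C := by
  obtain ⟨s, rfl⟩ := hB
  classical
  choose N hN using h
  refine ⟨∑ z ∈ s, N z, fun z hz => ?_⟩
  induction hz using Submodule.span_induction with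
  | mem z hz =>
    rw [← Finset.sum_erase_add s N hz, pow_add, mul_smul]
    exact C.nsmul_mem (hN z) _
  | zero => simp
  | add x y _ _ hx hy => rw [smul_add]; exact add_mem hx hy
  | smul a x _ hx => rw [smul_comm]; exact C.smul_mem a hx

variable {F : Type*} [Ring F] [Algebra ℚ F]

variable (p) in
/-- The embedding of `F` into `ℚ_p ⊗ F`. -/
abbrev locEmb : F →ₐ[ℚ] ℚ_[p] ⊗[ℚ] F := Algebra.TensorProduct.includeRight

theorem locEmb_mem {G : Subalgebra ℤ F} {x : F} (hx : x ∈ G) : locEmb p x ∈ localComponent p G :=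
  Algebra.subset_adjoin ⟨x, hx, rfl⟩

theorem localComponent_le_iff {G : Subalgebra ℤ F} {B : Subalgebra ℤ_[p] (ℚ_[p] ⊗[ℚ] F)} :
    localComponent p G ≤ B ↔ ∀ x ∈ G, locEmb p x ∈ B := by
  rw [localComponent, Algebra.adjoin_le_iff]
  exact Set.image_subset_iff

theorem localComponent_mono {G M : Subalgebra ℤ F} (h : G ≤ M) :
    localComponent p G ≤ localComponent p M :=
  localComponent_le_iff.2 fun _ hx => locEmb_mem (h hx)

/-- The integers are dense in `ℤ_p`, hence `M` is `p`-adically dense in its component. -/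
theorem exists_approximation {M : Subalgebra ℤ F} {z : ℚ_[p] ⊗[ℚ] F}
    (hz : z ∈ localComponent p M) (N : ℕ) :
    ∃ m ∈ M, ∃ w ∈ localComponent p M, z = locEmb p m + p ^ N • w := by
  rw [← Subalgebra.mem_toSubmodule, toSubmodule_localComponent] at hz
  induction hz using Submodule.span_induction with
  | mem z hz =>
    obtain ⟨m, hm, rfl⟩ := hz
    exact ⟨m, hm, 0, zero_mem _, by rw [smul_zero, add_zero]⟩
  | zero => exact ⟨0, zero_mem _, 0, zero_mem _, by simp⟩
  | add x y _ _ hx hy =>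
    obtain ⟨m, hm, w, hw, rfl⟩ := hx
    obtain ⟨m', hm', w', hw', rfl⟩ := hy
    exact ⟨m + m', add_mem hm hm', w + w', add_mem hw hw', by rw [map_add, smul_add]; abel⟩
  | smul a x _ hx =>
    obtain ⟨m, hm, w, hw, rfl⟩ := hx
    obtain ⟨b, hb⟩ := Ideal.mem_span_singleton'.1 (PadicInt.appr_spec N a)
    refine ⟨a.appr N • m, M.toSubmodule.nsmul_mem hm _, b • locEmb p m + a • w,
      add_mem (Subalgebra.smul_mem _ (locEmb_mem hm) _) (Subalgebra.smul_mem _ hw _), ?_⟩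
    have ha : a = (a.appr N : ℤ_[p]) + (p ^ N : ℕ) * b := by
      push_cast; rw [mul_comm, hb]; ring
    nth_rewrite 1 [ha]
    rw [smul_add, add_smul, mul_smul, Nat.cast_smul_eq_nsmul, Nat.cast_smul_eq_nsmul, smul_add,
      map_nsmul, ← ha, smul_comm a]
    abel

/-- An order has an integral basis. -/
theorem IsOrder.exists_basis {G : Subalgebra ℤ F} (hG : IsOrder G) :
    ∃ (k : ℕ) (v : Module.Basis (Fin k) ℚ F),
      ∀ x, x ∈ G ↔ ∀ i, ∃ z : ℤ, v.repr x i = z := by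
  have : Module.Finite ℤ (Subalgebra.toSubmodule G) := Module.Finite.iff_fg.2 hG.fg
  have : Module.IsTorsionFree ℤ F := Module.IsTorsionFree.trans ℚ
  have : Module.Free ℤ (Subalgebra.toSubmodule G) := Module.free_of_finite_type_torsion_free'
  let c := Module.finBasis ℤ (Subalgebra.toSubmodule G)
  have hli : LinearIndependent ℚ (fun i => (c i : F)) := by
    rw [← LinearIndependent.iff_fractionRing (R := ℤ)]
    exact c.linearIndependent.map' (Subalgebra.toSubmodule G).subtype (Submodule.ker_subtype _)
  have hsp : ∀ x (hx : x ∈ Subalgebra.toSubmodule G),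
      x = ∑ i, ((c.repr ⟨x, hx⟩ i : ℤ) : ℚ) • (c i : F) := by
    intro x hx
    have h := congrArg Subtype.val (c.sum_repr ⟨x, hx⟩)
    refine h.symm.trans ?_
    rw [AddSubmonoidClass.coe_finsetSum]
    refine Finset.sum_congr rfl fun i _ => ?_
    rw [Submodule.coe_smul, Int.cast_smul_eq_zsmul]
  have htop : ⊤ ≤ Submodule.span ℚ (Set.range fun i => (c i : F)) := by
    rw [← hG.span_eq_top, Submodule.span_le]
    intro x hx
    rw [hsp x hx]
    exact Submodule.sum_mem _ fun j _ => Submodule.smul_mem _ _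
      (Submodule.subset_span (Set.mem_range_self j))
  let v := Module.Basis.mk hli htop
  have hv : ∀ j, v j = c j := fun j => by simp [v]
  refine ⟨_, v, fun x => ⟨fun hx i => ⟨c.repr ⟨x, hx⟩ i, ?_⟩, fun h => ?_⟩⟩
  · conv_lhs => rw [hsp x hx]
    simp only [← hv, map_sum, map_smul, Module.Basis.repr_self]
    rw [Finsupp.finsetSum_apply, Finset.sum_eq_single i]
    · simp
    · intro l _ hl
      simp [hl]
    · simp
  · rw [← v.sum_repr x]
    refine Subalgebra.sum_mem _ fun i _ => ?_
    obtain ⟨z, hz⟩ := h i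
    rw [hz, Int.cast_smul_eq_zsmul, hv]
    exact G.smul_mem (c i).2 z

theorem basis_repr_locEmb {k : ℕ} (v : Module.Basis (Fin k) ℚ F) (x : F) (i : Fin k) :
    (Algebra.TensorProduct.basis ℚ_[p] v).repr (locEmb p x) i = (v.repr x i : ℚ_[p]) := by
  simp [Algebra.TensorProduct.includeRight_apply]

theorem mem_localComponent_iff {G : Subalgebra ℤ F} {k : ℕ} {v : Module.Basis (Fin k) ℚ F}
    (hv : ∀ x, x ∈ G ↔ ∀ i, ∃ z : ℤ, v.repr x i = z) (y : ℚ_[p] ⊗[ℚ] F) :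
    y ∈ localComponent p G ↔
      ∀ i, ‖(Algebra.TensorProduct.basis ℚ_[p] v).repr y i‖ ≤ 1 := by
  constructor
  · intro hy
    rw [← Subalgebra.mem_toSubmodule, toSubmodule_localComponent] at hy
    induction hy using Submodule.span_induction with
    | mem z hz =>
      obtain ⟨m, hm, rfl⟩ := hz
      intro i
      obtain ⟨z, hz⟩ := (hv m).1 hm i
      rw [basis_repr_locEmb, hz, Rat.cast_intCast]
      exact Padic.norm_int_le_one z
    | zero => simp
    | add x y _ _ hx hy =>
      intro i
      rw [map_add, Finsupp.add_apply]
      exact (Padic.nonarchimedean _ _).trans (max_le (hx i) (hy i))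
    | smul a x _ hx =>
      intro i
      rw [← algebraMap_smul ℚ_[p] a, map_smul, Finsupp.smul_apply, smul_eq_mul, norm_mul]
      exact mul_le_one₀ a.2 (norm_nonneg _) (hx i)
  · intro h
    rw [← (Algebra.TensorProduct.basis ℚ_[p] v).sum_repr y]
    refine Subalgebra.sum_mem _ fun i _ => ?_
    obtain ⟨z, hz⟩ := exists_padicInt_eq (h i)
    rw [← hz, Algebra.TensorProduct.basis_apply]
    have : (z : ℚ_[p]) • ((1 : ℚ_[p]) ⊗ₜ[ℚ] v i) = z • locEmb p (v i) :=
      algebraMap_smul ℚ_[p] z _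
    rw [this]
    refine Subalgebra.smul_mem _ (locEmb_mem ((hv _).2 fun j => ?_)) z
    rw [v.repr_self, Finsupp.single_apply]
    split_ifs
    · exact ⟨1, by simp⟩
    · exact ⟨0, by simp⟩

/-- In an integral basis, lying in the component means that the rational coordinates have
denominators prime to `p`; `s` is the product of these denominators. -/
theorem IsOrder.locEmb_mem_iff {G : Subalgebra ℤ F} (hG : IsOrder G) (x : F) :
    locEmb p x ∈ localComponent p G ↔ ∃ s : ℕ, ¬ p ∣ s ∧ s • x ∈ G := by
  constructor
  · intro hx
    obtain ⟨k, v, hv⟩ := hG.exists_basis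
    rw [mem_localComponent_iff hv] at hx
    refine ⟨∏ i, (v.repr x i).den, fun hd => ?_, (hv _).2 fun i => ?_⟩
    · obtain ⟨i, -, hi⟩ := (Nat.prime_iff.1 Fact.out).exists_mem_finset_dvd hd
      have := hx i
      rw [basis_repr_locEmb] at this
      have := PadicInt.isUnit_iff.1 (PadicInt.isUnit_den _ this)
      exact (PadicInt.norm_lt_one_iff_dvd _ |>.not.1 (by rw [this]; exact lt_irrefl _))
        (Nat.cast_dvd_cast hi)
    · obtain ⟨e, he⟩ := Finset.dvd_prod_of_mem (fun i => (v.repr x i).den) (Finset.mem_univ i)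
      refine ⟨e * (v.repr x i).num, ?_⟩
      rw [map_nsmul, Finsupp.smul_apply, he, nsmul_eq_mul]
      push_cast
      rw [mul_comm ((v.repr x i).den : ℚ), mul_assoc, Rat.den_mul_eq_num]
  · rintro ⟨s, hs, hx⟩
    have := locEmb_mem (p := p) hx
    rw [map_nsmul] at this
    exact mem_of_nsmul_mem (Subalgebra.toSubmodule (localComponent p G)) hs this

theorem IsOrder.exists_pow_nsmul_mem {G : Subalgebra ℤ F} (hG : IsOrder G) (y : ℚ_[p] ⊗[ℚ] F) :
    ∃ N : ℕ, p ^ N • y ∈ localComponent p G := by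
  obtain ⟨k, v, hv⟩ := hG.exists_basis
  obtain ⟨N, hN⟩ := exists_norm_pow_mul_le (p := p)
    (∑ i, ‖(Algebra.TensorProduct.basis ℚ_[p] v).repr y i‖)
  refine ⟨N, (mem_localComponent_iff hv _).2 fun i => ?_⟩
  rw [← Nat.cast_smul_eq_nsmul ℚ_[p], map_smul, Finsupp.smul_apply, smul_eq_mul, norm_mul,
    Nat.cast_pow]
  refine (mul_le_mul_of_nonneg_left ?_ (norm_nonneg _)).trans hN
  exact Finset.single_le_sum
    (f := fun i => ‖(Algebra.TensorProduct.basis ℚ_[p] v).repr y i‖)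
    (fun _ _ => norm_nonneg _) (Finset.mem_univ i)

theorem IsOrder.localComponent_fg {G : Subalgebra ℤ F} (hG : IsOrder G) :
    (Subalgebra.toSubmodule (localComponent p G)).FG := by
  obtain ⟨s, hs⟩ := hG.fg
  rw [toSubmodule_localComponent]
  classical
  refine ⟨s.image (locEmb p), le_antisymm (Submodule.span_mono ?_) (Submodule.span_le.2 ?_)⟩
  · rw [Finset.coe_image]
    exact Set.image_mono fun x hx => hs.le (Submodule.subset_span hx)
  · rintro _ ⟨x, hx, rfl⟩
    have hx' : x ∈ Submodule.span ℤ (s : Set F) := hs.ge hx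
    clear hx
    induction hx' using Submodule.span_induction with
    | mem x hx => exact Submodule.subset_span (by simpa using ⟨x, hx, rfl⟩)
    | zero => simp
    | add x y _ _ hx hy => rw [map_add]; exact add_mem hx hy
    | smul a x _ hx =>
      rw [map_zsmul]
      exact zsmul_mem hx a

end LocalComponent
end QuatOrder
end

/-! ### Local and global indices. -/

noncomputable section
namespace QuatOrder

section LocalGlobal

theorem orderIndex_nsmul_mem {F : Type*} [Ring F] {M G : Subalgebra ℤ F} {x : F} (hx : x ∈ M) :
    orderIndex M G • x ∈ G := by
  have := AddSubgroup.nsmul_index_mem ((Subalgebra.toSubmodule G).toAddSubgroup.addSubgroupOf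
    (Subalgebra.toSubmodule M).toAddSubgroup) ⟨x, hx⟩
  exact this

variable {F : Type*} [Ring F] [Algebra ℚ F]

/-- An order containing an order and contained in a multiple of it. -/
theorem IsOrder.of_nsmul_mem {M : Subalgebra ℤ F} (hM : IsOrder M) {M' : Subalgebra ℤ F}
    (h : M ≤ M') {k : ℕ} (hk : k ≠ 0) (hk' : ∀ x ∈ M', k • x ∈ M) : IsOrder M' where
  fg := by
    have : IsNoetherian ℤ (Subalgebra.toSubmodule M) :=
      isNoetherian_of_fg_of_noetherian _ hM.fg
    have : Module.IsTorsionFree ℤ F := Module.IsTorsionFree.trans ℚ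
    let f : Subalgebra.toSubmodule M' →ₗ[ℤ] Subalgebra.toSubmodule M :=
      LinearMap.codRestrict _ ((LinearMap.lsmul ℤ F k).comp (Subalgebra.toSubmodule M').subtype)
        fun x => by
          simp only [LinearMap.comp_apply, LinearMap.lsmul_apply, natCast_zsmul]
          exact hk' x x.2
    have hf : Function.Injective f := by
      intro x y hxy
      have h1 : (k : ℤ) • (x : F) = (k : ℤ) • (y : F) := congrArg Subtype.val hxy
      exact Subtype.ext (smul_right_injective F (Int.natCast_ne_zero.2 hk) h1)
    exact Module.Finite.iff_fg.1 (Module.Finite.of_injective f hf)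
  span_eq_top := by
    rw [← top_le_iff, ← hM.span_eq_top]
    exact Submodule.span_mono h

/-- An order contains a multiple of every element. -/
theorem IsOrder.exists_nsmul_mem {G : Subalgebra ℤ F} (hG : IsOrder G) (x : F) :
    ∃ k : ℕ, k ≠ 0 ∧ k • x ∈ G := by
  obtain ⟨k, v, hv⟩ := hG.exists_basis
  refine ⟨∏ i, (v.repr x i).den, Finset.prod_ne_zero_iff.2 fun i _ => Rat.den_ne_zero _,
    (hv _).2 fun i => ?_⟩
  obtain ⟨e, he⟩ := Finset.dvd_prod_of_mem (fun i => (v.repr x i).den) (Finset.mem_univ i)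
  refine ⟨e * (v.repr x i).num, ?_⟩
  rw [map_nsmul, Finsupp.smul_apply, he, nsmul_eq_mul]
  push_cast
  rw [mul_comm ((v.repr x i).den : ℚ), mul_assoc, Rat.den_mul_eq_num]

theorem IsOrder.orderIndex_ne_zero {M G : Subalgebra ℤ F} (hM : IsOrder M) (hG : IsOrder G) :
    orderIndex M G ≠ 0 := by
  have : Module.Finite ℤ (Subalgebra.toSubmodule M) := Module.Finite.iff_fg.2 hM.fg
  let N := (Subalgebra.toSubmodule G).comap (Subalgebra.toSubmodule M).subtype
  have hfin : Finite (Subalgebra.toSubmodule M ⧸ N) := by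
    apply Module.finite_of_fg_torsion
    intro x
    obtain ⟨x, rfl⟩ := Submodule.Quotient.mk_surjective _ x
    obtain ⟨k, hk, hx⟩ := hG.exists_nsmul_mem (x : F)
    refine ⟨⟨k, mem_nonZeroDivisors_of_ne_zero (Int.natCast_ne_zero.2 hk)⟩, ?_⟩
    rw [Submonoid.mk_smul, ← Submodule.Quotient.mk_smul, Submodule.Quotient.mk_eq_zero]
    simpa [N] using hx
  exact (Nat.card_pos (α := Subalgebra.toSubmodule M ⧸ N)).ne'

variable {p : ℕ} [Fact p.Prime]

theorem exists_rat_smul_eq (N : ℕ) (m : F) : ∃ x : F, p ^ N • x = m := by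
  refine ⟨((p : ℚ) ^ N)⁻¹ • m, ?_⟩
  rw [← Nat.cast_smul_eq_nsmul ℚ, smul_smul, Nat.cast_pow, mul_inv_cancel₀, one_smul]
  exact pow_ne_zero _ (Nat.cast_ne_zero.2 (Fact.out : p.Prime).ne_zero)

theorem pow_nsmul_injective {N : ℕ} {x y : ℚ_[p] ⊗[ℚ] F} (h : p ^ N • x = p ^ N • y) : x = y := by
  have h0 : (p : ℚ_[p]) ^ N ≠ 0 := pow_ne_zero _ padic_p_ne_zero
  rw [← Nat.cast_smul_eq_nsmul ℚ_[p], ← Nat.cast_smul_eq_nsmul ℚ_[p], Nat.cast_pow] at h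
  have := congrArg (fun z => ((p : ℚ_[p]) ^ N)⁻¹ • z) h
  simpa [smul_smul, h0] using this

/-- The elements of `F` which lie in `B` at `p` and in `M` away from `p`. -/
def modifyAt (M : Subalgebra ℤ F) (B : Subalgebra ℤ_[p] (ℚ_[p] ⊗[ℚ] F)) : Subalgebra ℤ F where
  carrier := {x | locEmb p x ∈ B ∧ ∃ k : ℕ, p ^ k • x ∈ M}
  mul_mem' := by
    rintro x y ⟨hx, k, hk⟩ ⟨hy, l, hl⟩
    refine ⟨by rw [map_mul]; exact B.mul_mem hx hy, k + l, ?_⟩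
    rw [pow_add, ← smul_mul_smul_comm]
    exact M.mul_mem hk hl
  add_mem' := by
    rintro x y ⟨hx, k, hk⟩ ⟨hy, l, hl⟩
    refine ⟨by rw [map_add]; exact add_mem hx hy, k + l, ?_⟩
    rw [smul_add]
    refine add_mem ?_ ?_
    · rw [pow_add, mul_comm, mul_smul]; exact M.toSubmodule.nsmul_mem hk _
    · rw [pow_add, mul_smul]; exact M.toSubmodule.nsmul_mem hl _
  algebraMap_mem' c := ⟨by
    have : locEmb p (algebraMap ℤ F c) = c • (1 : ℚ_[p] ⊗[ℚ] F) := by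
      rw [Algebra.algebraMap_eq_smul_one, map_zsmul, map_one]
    rw [this]
    exact (Subalgebra.toSubmodule B).toAddSubgroup.zsmul_mem B.one_mem c,
    0, by simpa using M.algebraMap_mem c⟩

/-- The local components of a maximal order are maximal orders. -/
theorem IsMaximalOrder.localComponent {M : Subalgebra ℤ F} (hM : IsMaximalOrder M) :
    IsMaximalPadicOrder (localComponent p M) := by
  refine ⟨hM.prop.localComponent_fg, fun B hB hMB => ?_⟩
  obtain ⟨N, hN⟩ := exists_pow_nsmul_mem_of_fg
    (C := Subalgebra.toSubmodule (QuatOrder.localComponent p M)) hB hM.prop.exists_pow_nsmul_mem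
  have hle : M ≤ modifyAt M B := fun x hx => ⟨hMB (locEmb_mem hx), 0, by simpa using hx⟩
  have hord : IsOrder (modifyAt M B) := by
    refine hM.prop.of_nsmul_mem hle (pow_ne_zero N (Fact.out : p.Prime).ne_zero) ?_
    rintro x ⟨hx, k, hk⟩
    have h1 := hN _ hx
    rw [← map_nsmul, Subalgebra.mem_toSubmodule, hM.prop.locEmb_mem_iff] at h1
    obtain ⟨s, hs, h1⟩ := h1
    have h2 : p ^ k • p ^ N • x ∈ M := by
      rw [smul_comm]; exact M.toSubmodule.nsmul_mem hk _
    have h3 := gcd_nsmul_mem (Subalgebra.toSubmodule M).toAddSubgroup h1 h2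
    rwa [Nat.Coprime.gcd_eq_one, one_smul] at h3
    exact (((Nat.Prime.coprime_iff_not_dvd Fact.out).2 hs).pow_left k).symm
  have heq : modifyAt M B ≤ M := hM.le_of_ge hord hle
  intro z hz
  -- Approximating `p^N z` by `m = p^N x` makes `x = z - w`: it lies in `B` at `p` and in `M` away
  -- from `p`, hence in `M` by maximality.
  obtain ⟨m, hm, w, hw, hmw⟩ := exists_approximation (hN z hz) N
  obtain ⟨x, rfl⟩ := exists_rat_smul_eq (p := p) N m
  have hzw : locEmb p x = z - w := by
    apply pow_nsmul_injective (N := N)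
    rw [smul_sub, hmw, map_nsmul, add_sub_cancel_right]
  have hx : x ∈ M := heq ⟨by rw [hzw]; exact sub_mem hz (hMB hw), N, hm⟩
  rw [← sub_add_cancel z w, ← hzw]
  exact add_mem (locEmb_mem hx) hw

/-- The elements of `F` which lie in `G` at `p`. -/
def awayFrom (p : ℕ) [Fact p.Prime] (G : Subalgebra ℤ F) : AddSubgroup F :=
  (Subalgebra.toSubmodule (localComponent p G)).toAddSubgroup.comap (locEmb (F := F) p : F →+ ℚ_[p] ⊗[ℚ] F)

theorem orderIndex_nsmul_mem_localComponent {M G : Subalgebra ℤ F} {w : ℚ_[p] ⊗[ℚ] F}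
    (hw : w ∈ localComponent p M) : orderIndex M G • w ∈ localComponent p G := by
  rw [← Subalgebra.mem_toSubmodule, toSubmodule_localComponent] at hw
  induction hw using Submodule.span_induction with
  | mem z hz =>
    obtain ⟨m, hm, rfl⟩ := hz
    rw [← map_nsmul]
    exact locEmb_mem (orderIndex_nsmul_mem hm)
  | zero => rw [smul_zero]; exact zero_mem _
  | add x y _ _ hx hy => rw [smul_add]; exact add_mem hx hy
  | smul a x _ hx => rw [smul_comm]; exact Subalgebra.smul_mem _ hx a

/-- Approximation to the precision of the `p`-part of the index gives `M_p = M + G_p`, whence `M_p /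
G_p` is `M / (M ∩ G_p)`. -/
theorem padicIndex_eq_relIndex {M G : Subalgebra ℤ F} (hGM : G ≤ M) (h0 : orderIndex M G ≠ 0) :
    padicIndex (localComponent p M) (localComponent p G) =
      (awayFrom p G).relIndex (Subalgebra.toSubmodule M).toAddSubgroup := by
  rw [awayFrom, AddSubgroup.relIndex_comap, padicIndex]
  have h4 : (Subalgebra.toSubmodule (localComponent p M)).toAddSubgroup =
      ((Subalgebra.toSubmodule M).toAddSubgroup.map (locEmb (F := F) p : F →+ ℚ_[p] ⊗[ℚ] F)) ⊔
        (Subalgebra.toSubmodule (localComponent p G)).toAddSubgroup := by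
    apply le_antisymm
    · intro z hz
      obtain ⟨k, K, hK, hk⟩ := Nat.exists_eq_pow_mul_and_not_dvd h0 p (Fact.out : p.Prime).ne_one
      obtain ⟨m, hm, w, hw, rfl⟩ := exists_approximation hz k
      refine AddSubgroup.add_mem_sup ⟨m, hm, rfl⟩ ?_
      refine mem_of_nsmul_mem (Subalgebra.toSubmodule (localComponent p G)) hK ?_
      rw [smul_smul, mul_comm, ← hk]
      exact orderIndex_nsmul_mem_localComponent hw
    · refine sup_le ?_ (localComponent_mono hGM)
      rintro _ ⟨m, hm, rfl⟩
      exact locEmb_mem hm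
  rw [h4, AddSubgroup.relIndex_sup_right]

theorem exists_of_prime_dvd_relIndex {X : Type*} [AddCommGroup X] {H K : AddSubgroup X} {q : ℕ}
    (hq : q.Prime) (hd : q ∣ H.relIndex K) (h0 : H.relIndex K ≠ 0) :
    ∃ x ∈ K, x ∉ H ∧ q • x ∈ H := by
  have : Finite (K ⧸ H.addSubgroupOf K) := Nat.finite_of_card_ne_zero h0
  have := Fact.mk hq
  obtain ⟨x, hx⟩ := exists_prime_addOrderOf_dvd_card' (G := K ⧸ H.addSubgroupOf K) q hd
  obtain ⟨x, rfl⟩ := QuotientAddGroup.mk_surjective x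
  refine ⟨x, x.2, fun h => ?_, ?_⟩
  · have h1 : (x : K ⧸ H.addSubgroupOf K) = 0 :=
      (QuotientAddGroup.eq_zero_iff x).2 (AddSubgroup.mem_addSubgroupOf.2 h)
    rw [h1, addOrderOf_zero] at hx
    exact hq.ne_one hx.symm
  · have h1 : ((q • x : K) : K ⧸ H.addSubgroupOf K) = 0 := by
      rw [QuotientAddGroup.mk_nsmul, ← hx, addOrderOf_nsmul_eq_zero]
    exact AddSubgroup.mem_addSubgroupOf.1 ((QuotientAddGroup.eq_zero_iff _).1 h1)

/-- The index of the local components is the `p`-part of the global index. -/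
theorem padicIndex_localComponent {M G : Subalgebra ℤ F} (hM : IsOrder M) (hG : IsOrder G)
    (hGM : G ≤ M) : padicIndex (localComponent p M) (localComponent p G) =
      p ^ (orderIndex M G).factorization p := by
  have hp : p.Prime := Fact.out
  have h0 := hM.orderIndex_ne_zero hG
  rw [padicIndex_eq_relIndex hGM h0]
  set M' := (Subalgebra.toSubmodule M).toAddSubgroup with hM'
  set G' := (Subalgebra.toSubmodule G).toAddSubgroup with hG'
  have hle : G' ≤ awayFrom p G ⊓ M' := fun x hx => ⟨locEmb_mem hx, hGM hx⟩
  have hmul : G'.relIndex (awayFrom p G ⊓ M') * (awayFrom p G).relIndex M' = orderIndex M G := by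
    rw [← AddSubgroup.inf_relIndex_right (awayFrom p G) M',
      AddSubgroup.relIndex_mul_relIndex _ _ _ hle inf_le_right]
    rfl
  have ha := left_ne_zero_of_mul (hmul.trans_ne h0)
  have hb := right_ne_zero_of_mul (hmul.trans_ne h0)
  -- An element of `F` lying in `G_p` has a multiple prime to `p` in `G`, so this factor has no
  -- `p`-torsion quotient.
  have h1 : ¬ p ∣ G'.relIndex (awayFrom p G ⊓ M') := by
    intro hd
    obtain ⟨x, hx, hxG, hpx⟩ := exists_of_prime_dvd_relIndex hp hd ha
    obtain ⟨s, hs, hsx⟩ := (hG.locEmb_mem_iff x).1 hx.1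
    have := gcd_nsmul_mem G' hpx hsx
    rw [((Nat.Prime.coprime_iff_not_dvd hp).2 hs).gcd_eq_one, one_smul] at this
    exact hxG this
  -- A prime `q ≠ p` is invertible in `ℤ_p`, so it cannot divide the index of a subgroup cut out by
  -- a condition at `p`.
  have h2 := Nat.eq_prime_pow_of_unique_prime_dvd (p := p) hb (fun {q} hq hd => by
    by_contra hqp
    obtain ⟨x, hx, hxG, hqx⟩ := exists_of_prime_dvd_relIndex hq hd hb
    apply hxG
    have : q • locEmb p x ∈ localComponent p G := by rw [← map_nsmul]; exact hqx
    exact mem_of_nsmul_mem (Subalgebra.toSubmodule (localComponent p G))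
      (fun h => hqp ((Nat.prime_dvd_prime_iff_eq hp hq).1 h).symm) this)
  generalize List.length _ = j at h2
  rw [← hmul, h2, Nat.factorization_mul ha (pow_ne_zero _ hp.ne_zero), Finsupp.add_apply,
    Nat.factorization_eq_zero_of_not_dvd h1, hp.factorization_pow, Finsupp.single_eq_same, zero_add]

theorem localComponent_eq_of_not_dvd {M G : Subalgebra ℤ F} (hGM : G ≤ M)
    (hd : ¬ p ∣ orderIndex M G) : localComponent p G = localComponent p M := by
  refine le_antisymm (localComponent_mono hGM) fun w hw => ?_
  exact mem_of_nsmul_mem (Subalgebra.toSubmodule (localComponent p G)) hd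
    (orderIndex_nsmul_mem_localComponent hw)

end LocalGlobal

/-! ### Gluing local orders to a global order. -/

section Glue

variable {F : Type*} [Ring F] [Algebra ℚ F]

/-- The elements of `M` which lie in `L p` for all `p`. -/
def glue (M : Subalgebra ℤ F)
    (L : ∀ (p : ℕ) [Fact p.Prime], Subalgebra ℤ_[p] (ℚ_[p] ⊗[ℚ] F)) : Subalgebra ℤ F where
  carrier := {x | x ∈ M ∧ ∀ (p : ℕ) [Fact p.Prime], locEmb p x ∈ L p}
  mul_mem' := by
    rintro x y ⟨hx, hx'⟩ ⟨hy, hy'⟩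
    exact ⟨M.mul_mem hx hy, fun p _ => by rw [map_mul]; exact (L p).mul_mem (hx' p) (hy' p)⟩
  add_mem' := by
    rintro x y ⟨hx, hx'⟩ ⟨hy, hy'⟩
    exact ⟨M.add_mem hx hy, fun p _ => by rw [map_add]; exact (L p).add_mem (hx' p) (hy' p)⟩
  algebraMap_mem' c := ⟨M.algebraMap_mem c, fun p _ => by
    rw [Algebra.algebraMap_eq_smul_one, map_zsmul, map_one]
    exact zsmul_mem (L p).one_mem c⟩

variable {M : Subalgebra ℤ F} {L : ∀ (p : ℕ) [Fact p.Prime], Subalgebra ℤ_[p] (ℚ_[p] ⊗[ℚ] F)}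

theorem glue_le : glue M L ≤ M := fun _ hx => hx.1

theorem nsmul_mem_glue {K : ℕ}
    (hK : ∀ (p : ℕ) [Fact p.Prime], ∀ x ∈ localComponent p M, K • x ∈ L p) {x : F} (hx : x ∈ M) :
    K • x ∈ glue M L :=
  ⟨M.toSubmodule.nsmul_mem hx K, fun p _ => by rw [map_nsmul]; exact hK p _ (locEmb_mem hx)⟩

theorem isOrder_glue (hM : IsOrder M) {K : ℕ} (hK0 : K ≠ 0)
    (hK : ∀ (p : ℕ) [Fact p.Prime], ∀ x ∈ localComponent p M, K • x ∈ L p) :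
    IsOrder (glue M L) where
  fg := by
    have : IsNoetherian ℤ (Subalgebra.toSubmodule M) :=
      isNoetherian_of_fg_of_noetherian _ hM.fg
    exact Submodule.FG.of_le hM.fg glue_le
  span_eq_top := by
    rw [← top_le_iff, ← hM.span_eq_top, Submodule.span_le]
    intro x hx
    have h1 : x = (K : ℚ)⁻¹ • K • x := by
      rw [← Nat.cast_smul_eq_nsmul ℚ, smul_smul, inv_mul_cancel₀ (Nat.cast_ne_zero.2 hK0),
        one_smul]
    rw [h1]
    exact Submodule.smul_mem _ _ (Submodule.subset_span (nsmul_mem_glue hK hx))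

/-- Write `K = p^N K'` and `u = K'⁻¹` in `ℤ_p`, and approximate `u z` by `m` in `M` modulo `p^N`.
Then `K' m` lies in `L q` for every `q`: for `q ≠ p` because `p` is a unit there, and at `p` because
`p^N M_p ⊆ L p`. The error `K' p^N w` lies in the component of the glued order, as `K M` is
contained in that order. -/
theorem localComponent_glue {K : ℕ} (hK0 : K ≠ 0)
    (hK : ∀ (p : ℕ) [Fact p.Prime], ∀ x ∈ localComponent p M, K • x ∈ L p)
    (hL : ∀ (p : ℕ) [Fact p.Prime], L p ≤ localComponent p M) (p : ℕ) [Fact p.Prime] :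
    localComponent p (glue M L) = L p := by
  refine le_antisymm (localComponent_le_iff.2 fun x hx => hx.2 p) fun z hz => ?_
  obtain ⟨N, K', hK', hN⟩ := Nat.exists_eq_pow_mul_and_not_dvd hK0 p (Fact.out : p.Prime).ne_one
  obtain ⟨u, hu⟩ : ∃ u : ℤ_[p], u * K' = 1 := by
    apply IsUnit.exists_left_inv
    rw [PadicInt.isUnit_iff]
    simpa [Nat.coprime_comm] using (Nat.Prime.coprime_iff_not_dvd Fact.out).2 hK'
  have hpN : ∀ (C : Subalgebra ℤ_[p] (ℚ_[p] ⊗[ℚ] F)) (w : ℚ_[p] ⊗[ℚ] F), K • w ∈ C →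
      p ^ N • w ∈ C := fun C w hw => mem_of_nsmul_mem (Subalgebra.toSubmodule C) hK' (by
    rwa [smul_smul, mul_comm, ← hN])
  obtain ⟨m, hm, w, hw, hmw⟩ := exists_approximation (hL p (Subalgebra.smul_mem _ hz u)) N
  have hx : K' • m ∈ glue M L := by
    refine ⟨M.toSubmodule.nsmul_mem hm K', fun q _ => ?_⟩
    rw [map_nsmul]
    by_cases hqp : q = p
    · subst hqp
      have h1 : locEmb q m = u • z - q ^ N • w := by rw [hmw, add_sub_cancel_right]
      rw [h1]
      have h2 : u • z - q ^ N • w ∈ L q :=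
        sub_mem (Subalgebra.smul_mem _ hz u) (hpN _ _ (hK q w hw))
      exact (Subalgebra.toSubmodule (L q)).nsmul_mem h2 _
    · have h1 := hK q _ (locEmb_mem hm)
      rw [hN, mul_smul] at h1
      refine mem_of_nsmul_mem (Subalgebra.toSubmodule (L q)) (fun hd => hqp ?_) h1
      exact (Nat.prime_dvd_prime_iff_eq Fact.out Fact.out).1
        ((Fact.out : q.Prime).dvd_of_dvd_pow hd)
  have hz' : z = locEmb p (K' • m) + K' • p ^ N • w := by
    rw [map_nsmul, ← smul_add, ← hmw, ← Nat.cast_smul_eq_nsmul ℤ_[p], smul_smul, mul_comm, hu,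
      one_smul]
  rw [hz']
  refine add_mem (locEmb_mem hx) ?_
  refine (Subalgebra.toSubmodule (localComponent p (glue M L))).nsmul_mem (hpN _ _ ?_) _
  clear hmw hz'
  rw [← Subalgebra.mem_toSubmodule, toSubmodule_localComponent] at hw
  induction hw using Submodule.span_induction with
  | mem z hz =>
    obtain ⟨m, hm, rfl⟩ := hz
    rw [← map_nsmul]
    exact locEmb_mem (nsmul_mem_glue hK hm)
  | zero => rw [smul_zero]; exact zero_mem _
  | add x y _ _ hx hy => rw [smul_add]; exact add_mem hx hy
  | smul a x _ hx => rw [smul_comm]; exact Subalgebra.smul_mem _ hx a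

end Glue
end QuatOrder
end

/-! ### Commutative rings of rank two over `ℤ` and their prime ideals. -/

noncomputable section
namespace QuatOrder

section QuadraticRing

/-- `R = ℤ ⊕ ℤθ` with `θ² = tθ - n`. -/
structure IsIntegralGenerator {R : Type*} [CommRing R] (t n : ℤ) (θ : R) : Prop where
  sq : θ * θ = t * θ - n
  exists_eq : ∀ x : R, ∃ a b : ℤ, x = a + b * θ
  independent : ∀ a b : ℤ, (a : R) + b * θ = 0 → a = 0 ∧ b = 0

/-- A ring which is free of rank two over `ℤ` is generated by one element. -/
theorem exists_isIntegralGenerator {R : Type*} [CommRing R]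
    (b : Module.Basis (Fin 2) ℤ R) (h : ∀ g : ℤ, IsUnit (g : R) → IsUnit g) :
    ∃ (t n : ℤ) (θ : R), IsIntegralGenerator t n θ := by
  obtain ⟨a, c, hac⟩ : ∃ a c : ℤ, (1 : R) = a * b 0 + c * b 1 := by
    refine ⟨b.repr 1 0, b.repr 1 1, ?_⟩
    conv_lhs => rw [← b.sum_repr 1, Fin.sum_univ_two, zsmul_eq_mul, zsmul_eq_mul]
  -- A common divisor of the coordinates of `1` is an integer invertible in `R`, so `1` is a
  -- primitive vector and extends to a basis.
  have hco : IsCoprime a c := by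
    rw [Int.isCoprime_iff_gcd_eq_one]
    obtain ⟨a', ha⟩ := Int.gcd_dvd_left a c
    obtain ⟨c', hc⟩ := Int.gcd_dvd_right a c
    have hu : IsUnit ((a.gcd c : ℤ) : R) := by
      refine IsUnit.of_mul_eq_one (a' * b 0 + c' * b 1) ?_
      have ha' : (a : R) = (a.gcd c : ℤ) * a' := by exact_mod_cast congrArg (Int.cast (R := R)) ha
      have hc' : (c : R) = (a.gcd c : ℤ) * c' := by exact_mod_cast congrArg (Int.cast (R := R)) hc
      rw [hac, ha', hc']; ring
    simpa using Int.isUnit_iff_natAbs_eq.1 (h _ hu)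
  obtain ⟨u, v, huv⟩ := hco
  have huv' : (u : R) * a + v * c = 1 := by exact_mod_cast congrArg (Int.cast (R := R)) huv
  have h0 : b 0 = u * 1 - c * (-v * b 0 + u * b 1) := by
    rw [hac]; linear_combination (-b 0) * huv'
  have h1 : b 1 = v * 1 + a * (-v * b 0 + u * b 1) := by
    rw [hac]; linear_combination (-b 1) * huv'
  generalize hθ : (-v * b 0 + u * b 1 : R) = θ at h0 h1
  have hex : ∀ x : R, ∃ a b : ℤ, x = a + b * θ := by
    intro x
    refine ⟨b.repr x 0 * u + b.repr x 1 * v, b.repr x 1 * a - b.repr x 0 * c, ?_⟩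
    conv_lhs => rw [← b.sum_repr x, Fin.sum_univ_two, zsmul_eq_mul, zsmul_eq_mul]
    nth_rewrite 1 [h0]
    nth_rewrite 1 [h1]
    push_cast
    ring
  obtain ⟨n, t, hnt⟩ := hex (θ * θ)
  refine ⟨t, -n, θ, ?_, hex, fun x y hxy => ?_⟩
  · rw [hnt]; push_cast; ring
  · have hli := Fintype.linearIndependent_iff.1 b.linearIndependent
      ![x * a - y * v, x * c + y * u] (by
        rw [Fin.sum_univ_two]
        simp only [Matrix.cons_val, zsmul_eq_mul]
        push_cast
        rw [← hxy, ← hθ]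
        linear_combination (-x : R) * hac)
    have e0 : x * a - y * v = 0 := hli 0
    have e1 : x * c + y * u = 0 := hli 1
    constructor
    · linear_combination u * e0 + v * e1 - x * huv
    · linear_combination a * e1 - c * e0 - y * huv

variable {R : Type*} [CommRing R] {t n : ℤ} {θ : R}

/-- The presentation of `R` as a quadratic algebra. -/
def IsIntegralGenerator.equiv (h : IsIntegralGenerator t n θ) :
    QuadraticAlgebra ℤ (-n) t ≃ₐ[ℤ] R :=
  AlgEquiv.ofBijective (QuadraticAlgebra.lift ⟨θ, by
    rw [h.sq]; simp only [zsmul_eq_mul, Int.cast_neg, mul_one]; ring⟩) (by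
    constructor
    · rw [injective_iff_map_eq_zero]
      intro x hx
      simp only [QuadraticAlgebra.lift_apply_apply, zsmul_eq_mul, mul_one] at hx
      obtain ⟨h1, h2⟩ := h.independent _ _ hx
      ext
      · exact h1
      · exact h2
    · intro x
      obtain ⟨a, b, rfl⟩ := h.exists_eq x
      exact ⟨⟨a, b⟩, by simp⟩)

theorem IsIntegralGenerator.equiv_apply (h : IsIntegralGenerator t n θ)
    (x : QuadraticAlgebra ℤ (-n) t) : h.equiv x = x.re + x.im * θ := by
  have e : h.equiv x = QuadraticAlgebra.lift (R := ℤ) (a := -n) (b := t) ⟨θ, by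
    rw [h.sq]; simp only [zsmul_eq_mul, Int.cast_neg, mul_one]; ring⟩ x := rfl
  rw [e]
  simp

theorem IsIntegralGenerator.exists_ringHom (h : IsIntegralGenerator t n θ) {p : ℕ} {c : ℤ}
    (hc : (p : ℤ) ∣ c ^ 2 - t * c + n) :
    ∃ f : R →+* ZMod p, ∀ a b : ℤ, f (a + b * θ) = a + b * c := by
  have hc' : (c : ZMod p) * c = (-n : ℤ) • (1 : ZMod p) + t • (c : ZMod p) := by
    have := (ZMod.intCast_zmod_eq_zero_iff_dvd _ p).2 hc
    push_cast at this
    simp only [zsmul_eq_mul, Int.cast_neg, mul_one]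
    linear_combination this
  let g : QuadraticAlgebra ℤ (-n) t →ₐ[ℤ] ZMod p := QuadraticAlgebra.lift ⟨(c : ZMod p), hc'⟩
  refine ⟨(g.comp h.equiv.symm.toAlgHom).toRingHom, fun a b => ?_⟩
  have h1 := h.equiv_apply ⟨a, b⟩
  change g (h.equiv.symm (a + b * θ)) = _
  rw [← h1, AlgEquiv.symm_apply_apply]
  simp [g]

/-- The prime ideal `(p, θ - c)`. -/
theorem IsIntegralGenerator.exists_ideal (h : IsIntegralGenerator t n θ) {p : ℕ} [Fact p.Prime]
    {c : ℤ} (hc : (p : ℤ) ∣ c ^ 2 - t * c + n) :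
    ∃ P : Ideal R, P.IsMaximal ∧ Nat.card (R ⧸ P) = p ∧
      ∀ a b : ℤ, (a + b * θ) ∈ P ↔ (p : ℤ) ∣ a + b * c := by
  obtain ⟨f, hf⟩ := h.exists_ringHom hc
  have hs : Function.Surjective f := ZMod.ringHom_surjective f
  refine ⟨RingHom.ker f, RingHom.ker_isMaximal_of_surjective f hs, ?_, fun a b => ?_⟩
  · rw [Nat.card_congr (RingHom.quotientKerEquivOfSurjective hs).toEquiv, Nat.card_zmod]
  · rw [RingHom.mem_ker, hf, ← ZMod.intCast_zmod_eq_zero_iff_dvd]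
    push_cast; rfl

/-- The primes are `(p, θ - c)` and `(p, θ - (t - c))`, for the two distinct roots modulo `p`. Their
product contains `p²` and `p(2c - t)`, hence `p`. -/
theorem IsIntegralGenerator.exists_split (h : IsIntegralGenerator t n θ) {p : ℕ} [Fact p.Prime]
    {c : ℤ} (hc : (p : ℤ) ∣ c ^ 2 - t * c + n) (hd : ¬ (p : ℤ) ∣ 2 * c - t) :
    ∃ P Q : Ideal R, P.IsPrime ∧ Q.IsPrime ∧ P ≠ Q ∧ Ideal.span {(p : R)} = P * Q := by
  have hp : Prime (p : ℤ) := Nat.prime_iff_prime_int.1 Fact.out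
  obtain ⟨P, hP, -, hP'⟩ := h.exists_ideal hc
  obtain ⟨Q, hQ, -, hQ'⟩ := h.exists_ideal (c := t - c) (p := p) (by
    convert hc using 1; ring)
  have h1 : θ - c ∈ P := by
    have := (hP' (-c) 1).2 (by simp)
    convert this using 1; push_cast; ring
  have h2 : θ - (t - c : ℤ) ∈ Q := by
    have := (hQ' (-(t - c)) 1).2 (by simp)
    convert this using 1; push_cast; ring
  have h3 : (p : R) ∈ P := by simpa using (hP' p 0).2 (by simp)
  have h4 : (p : R) ∈ Q := by simpa using (hQ' p 0).2 (by simp)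
  refine ⟨P, Q, hP.isPrime, hQ.isPrime, ?_, le_antisymm ?_ ?_⟩
  · rintro rfl
    have := (hQ' (-c) 1).1 (by convert h1 using 1; push_cast; ring)
    apply hd
    have e : 2 * c - t = -(-c + 1 * (t - c)) := by ring
    rw [e, dvd_neg]
    exact this
  · rw [Ideal.span_singleton_le_iff_mem]
    obtain ⟨u, v, huv⟩ := (hp.coprime_iff_not_dvd).2 hd
    have huv' : (u : R) * p + v * (2 * c - t) = 1 := by
      exact_mod_cast congrArg (Int.cast (R := R)) huv
    have e : (p : R) = u * (p * p) + v * (p * (θ - (t - c : ℤ)) - (θ - c) * p) := by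
      push_cast
      linear_combination (-p : R) * huv'
    rw [e]
    exact add_mem (Ideal.mul_mem_left _ _ (Ideal.mul_mem_mul h3 h4))
      (Ideal.mul_mem_left _ _ (sub_mem (Ideal.mul_mem_mul h3 h2) (Ideal.mul_mem_mul h1 h4)))
  · rw [Ideal.mul_le]
    intro x hx y hy
    obtain ⟨a, b, rfl⟩ := h.exists_eq x
    obtain ⟨a', b', rfl⟩ := h.exists_eq y
    obtain ⟨e, he⟩ := (hP' a b).1 hx
    obtain ⟨e', he'⟩ := (hQ' a' b').1 hy
    obtain ⟨f, hf⟩ := hc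
    have he1 : (a : R) + b * c = p * e := by exact_mod_cast congrArg (Int.cast (R := R)) he
    have he2 : (a' : R) + b' * (t - c) = p * e' := by
      exact_mod_cast congrArg (Int.cast (R := R)) he'
    have hf' : (c : R) ^ 2 - t * c + n = p * f := by exact_mod_cast congrArg (Int.cast (R := R)) hf
    rw [Ideal.mem_span_singleton]
    refine ⟨e * (a' + b' * θ) + b * (θ - c) * e' - b * b' * f, ?_⟩
    linear_combination (a' + b' * θ) * he1 + b * (θ - c) * he2 + b * b' * h.sq - b * b' * hf'

/-- An element `a + bθ` of `P` outside `(p)` must have `p ∤ b`, since `P` is proper; dividing by `b`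
modulo `p` gives `θ - c`. -/
theorem IsIntegralGenerator.exists_sub_mem (h : IsIntegralGenerator t n θ) {p : ℕ} [Fact p.Prime]
    {P : Ideal R} (hP : P ≠ ⊤) (hpP : (p : R) ∈ P) (hne : P ≠ Ideal.span {(p : R)}) :
    ∃ c : ℤ, θ - c ∈ P := by
  have hp : Prime (p : ℤ) := Nat.prime_iff_prime_int.1 Fact.out
  have hle : ¬ P ≤ Ideal.span {(p : R)} := fun hle =>
    hne (le_antisymm hle ((Ideal.span_singleton_le_iff_mem _).2 hpP))
  obtain ⟨x, hx, hx'⟩ := SetLike.not_le_iff_exists.1 hle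
  obtain ⟨a, b, rfl⟩ := h.exists_eq x
  by_cases hb : (p : ℤ) ∣ b
  · exfalso
    obtain ⟨b', hb'⟩ := hb
    have hbR : (b : R) = p * b' := by exact_mod_cast congrArg (Int.cast (R := R)) hb'
    have haP : (a : R) ∈ P := by
      have := sub_mem hx (P.mul_mem_right (b' * θ) hpP)
      convert this using 1; rw [hbR]; ring
    by_cases ha : (p : ℤ) ∣ a
    · obtain ⟨a', ha'⟩ := ha
      apply hx'
      have haR : (a : R) = p * a' := by exact_mod_cast congrArg (Int.cast (R := R)) ha'
      rw [Ideal.mem_span_singleton, haR, hbR]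
      exact ⟨a' + b' * θ, by ring⟩
    · obtain ⟨u, v, huv⟩ := (hp.coprime_iff_not_dvd).2 ha
      apply hP
      rw [Ideal.eq_top_iff_one]
      have : (1 : R) = u * p + v * a := by exact_mod_cast congrArg (Int.cast (R := R)) huv.symm
      rw [this]
      exact add_mem (P.mul_mem_left _ hpP) (P.mul_mem_left _ haP)
  · obtain ⟨u, v, huv⟩ := (hp.coprime_iff_not_dvd).2 hb
    have huv' : (u : R) * p + v * b = 1 := by exact_mod_cast congrArg (Int.cast (R := R)) huv
    refine ⟨-(v * a), ?_⟩
    have : θ - (-(v * a) : ℤ) = v * (a + b * θ) + u * θ * p := by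
      push_cast; linear_combination (-θ) * huv'
    rw [this]
    exact add_mem (P.mul_mem_left _ hx) (P.mul_mem_left _ hpP)

theorem IsIntegralGenerator.dvd_of_mem (h : IsIntegralGenerator t n θ) {p : ℕ} [Fact p.Prime]
    {P : Ideal R} (hP : P ≠ ⊤) (hpP : (p : R) ∈ P) {c : ℤ} (hc : θ - c ∈ P) :
    (p : ℤ) ∣ c ^ 2 - t * c + n := by
  have hp : Prime (p : ℤ) := Nat.prime_iff_prime_int.1 Fact.out
  by_contra hd
  obtain ⟨u, v, huv⟩ := (hp.coprime_iff_not_dvd).2 hd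
  have huv' : (u : R) * p + v * (c ^ 2 - t * c + n) = 1 := by
    exact_mod_cast congrArg (Int.cast (R := R)) huv
  apply hP
  rw [Ideal.eq_top_iff_one, ← huv']
  refine add_mem (P.mul_mem_left _ hpP) (P.mul_mem_left _ ?_)
  have e : (c : R) ^ 2 - t * c + n = -(θ - t + c) * (θ - c) := by
    linear_combination h.sq
  rw [e]
  exact P.mul_mem_left _ hc

/-- A split prime gives a simple root. -/
theorem IsIntegralGenerator.exists_root_of_split (h : IsIntegralGenerator t n θ) {p : ℕ}
    [Fact p.Prime] {P Q : Ideal R} (hP : P.IsPrime) (hQ : Q.IsPrime) (hPQ : P ≠ Q)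
    (hpP : (p : R) ∈ P) (hpQ : (p : R) ∈ Q) :
    ∃ c : ℤ, (p : ℤ) ∣ c ^ 2 - t * c + n ∧ ¬ (p : ℤ) ∣ 2 * c - t := by
  wlog hne : P ≠ Ideal.span {(p : R)} generalizing P Q
  · rw [not_not] at hne
    exact this hQ hP hPQ.symm hpQ hpP (hne ▸ hPQ.symm)
  obtain ⟨c, hc⟩ := h.exists_sub_mem hP.ne_top hpP hne
  have hd := h.dvd_of_mem hP.ne_top hpP hc
  refine ⟨c, hd, fun ⟨e, he⟩ => hPQ ?_⟩
  obtain ⟨f, hf⟩ := hd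
  have he' : 2 * (c : R) - t = p * e := by exact_mod_cast congrArg (Int.cast (R := R)) he
  have hf' : (c : R) ^ 2 - t * c + n = p * f := by exact_mod_cast congrArg (Int.cast (R := R)) hf
  -- At a double root `(θ - c)²` is divisible by `p`, so `Q` also contains `θ - c`; both primes then
  -- equal the maximal ideal `(p, θ - c)`.
  have hcQ : θ - c ∈ Q := by
    apply hQ.mem_of_pow_mem 2
    have : (θ - c) ^ 2 = (-e * (θ - c) - f) * p := by
      linear_combination h.sq - (θ - c) * he' - hf'
    rw [this]
    exact Q.mul_mem_left _ hpQ
  obtain ⟨P0, hP0, -, hP0'⟩ := h.exists_ideal (p := p) ⟨f, hf⟩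
  have key : ∀ I : Ideal R, I ≠ ⊤ → (p : R) ∈ I → θ - c ∈ I → P0 = I := by
    intro I hI hpI hcI
    refine hP0.eq_of_le hI fun x hx => ?_
    obtain ⟨a, b, rfl⟩ := h.exists_eq x
    obtain ⟨g, hg⟩ := (hP0' a b).1 hx
    have hg' : (a : R) + b * c = p * g := by exact_mod_cast congrArg (Int.cast (R := R)) hg
    have : (a : R) + b * θ = b * (θ - c) + g * p := by linear_combination hg'
    rw [this]
    exact add_mem (I.mul_mem_left _ hcI) (I.mul_mem_left _ hpI)
  exact (key P hP.ne_top hpP hc).symm.trans (key Q hQ.ne_top hpQ hcQ)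

end QuadraticRing
end QuatOrder
end

/-! ### The ring of integers of the imaginary quadratic field. -/

noncomputable section
namespace QuatOrder

theorem IsIntegralGenerator.even_card_quotient {R : Type*} [CommRing R] {t n : ℤ} {θ : R}
    (h : IsIntegralGenerator t n θ) {p : ℕ} [Fact p.Prime]
    (hi : ∀ c : ℤ, ¬ (p : ℤ) ∣ c ^ 2 - t * c + n) (J : Ideal R) [Finite (R ⧸ J)] :
    Even ((Nat.card (R ⧸ J)).factorization p) := by
  refine even_factorization_card Fact.out hi _ _
    (AddMonoidHom.mulLeft (Ideal.Quotient.mk J θ)) (fun x => ?_) le_rfl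
  simp only [AddMonoidHom.coe_mulLeft, zsmul_eq_mul]
  have := congrArg (Ideal.Quotient.mk J) h.sq
  simp only [map_mul, map_sub, map_intCast] at this
  rw [← mul_assoc, this]; ring

theorem IsIntegralGenerator.split_iff {R : Type*} [CommRing R] {t n : ℤ} {θ : R}
    (h : IsIntegralGenerator t n θ) {p : ℕ} [Fact p.Prime] :
    (∃ P Q : Ideal R, P.IsPrime ∧ Q.IsPrime ∧ P ≠ Q ∧ Ideal.span {(p : R)} = P * Q) ↔
      ∃ c : ℤ, (p : ℤ) ∣ c ^ 2 - t * c + n ∧ ¬ (p : ℤ) ∣ 2 * c - t := by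
  constructor
  · rintro ⟨P, Q, hP, hQ, hne, hPQ⟩
    have hp : (p : R) ∈ P * Q := hPQ ▸ Ideal.mem_span_singleton_self _
    have h1 : P * Q ≤ P := Ideal.mul_le_left
    have h2 : P * Q ≤ Q := Ideal.mul_le_right
    exact h.exists_root_of_split hP hQ hne (h1 hp) (h2 hp)
  · rintro ⟨c, h1, h2⟩
    exact h.exists_split h1 h2

section ImaginaryQuadratic

variable {d : ℕ}

theorem finrank_imagQuad (hd : d ≠ 0) : Module.finrank ℚ (imagQuad d) = 2 := by
  rw [IntermediateField.adjoin.finrank (isIntegral_generator d)]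
  set x : ℂ := Complex.I * ((Real.sqrt d : ℝ) : ℂ) with hx
  have hx2 : x ^ 2 = -(d : ℂ) := by
    have h1 : ((Real.sqrt d : ℝ) : ℂ) ^ 2 = (d : ℂ) := by
      rw [← Complex.ofReal_pow, Real.sq_sqrt (Nat.cast_nonneg d)]
      simp
    rw [hx, mul_pow, h1, Complex.I_sq]; ring
  apply le_antisymm
  · have hm : (Polynomial.X ^ 2 + Polynomial.C (d : ℚ) : Polynomial ℚ).Monic :=
      Polynomial.monic_X_pow_add_C _ two_ne_zero
    have := minpoly.min ℚ x hm (by simp [hx2])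
    rw [← Polynomial.natDegree_X_pow_add_C (n := 2) (r := (d : ℚ))]
    exact Polynomial.natDegree_le_natDegree this
  · have h0 := minpoly.natDegree_pos (isIntegral_generator d)
    have h1 : (minpoly ℚ x).natDegree ≠ 1 := by
      rw [Ne, minpoly.natDegree_eq_one_iff]
      rintro ⟨q, hq⟩
      have him := congrArg Complex.im hq
      have : Real.sqrt d ≠ 0 := by
        rw [Real.sqrt_ne_zero (Nat.cast_nonneg d)]
        exact Nat.cast_ne_zero.2 hd
      simp [hx] at him
      exact this him.symm
    rw [← hx] at h0
    omega

theorem exists_generator_ringOfIntegers (hd : d ≠ 0) :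
    ∃ (t n : ℤ) (θ : 𝓞 (imagQuad d)), IsIntegralGenerator t n θ := by
  have hr : Module.finrank ℤ (𝓞 (imagQuad d)) = 2 := by
    rw [NumberField.RingOfIntegers.rank, finrank_imagQuad hd]
  refine exists_isIntegralGenerator (Module.finBasisOfFinrankEq ℤ _ hr) fun g hg => ?_
  have := hg.map (Algebra.norm ℤ)
  have h2 := Algebra.norm_algebraMap (S := 𝓞 (imagQuad d)) g
  rw [hr, algebraMap_int_eq, eq_intCast] at h2
  rw [h2] at this
  exact (isUnit_pow_iff two_ne_zero).1 this

variable {t n : ℤ} {θ : 𝓞 (imagQuad d)}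

/-- Otherwise `(θ - c) / p` would be a root of a monic integral polynomial, yet it does not lie in
`ℤ + ℤθ`. -/
theorem IsIntegralGenerator.isMaximal (h : IsIntegralGenerator t n θ) {p : ℕ} (hp : p.Prime)
    (c : ℤ) (h1 : (p : ℤ) ∣ 2 * c - t) : ¬ (p : ℤ) ^ 2 ∣ c ^ 2 - t * c + n := by
  rintro ⟨f, hf⟩
  obtain ⟨e, he⟩ := h1
  have hp0 : (p : (imagQuad d)) ≠ 0 := Nat.cast_ne_zero.2 hp.ne_zero
  have hsq : (θ : (imagQuad d)) * θ = t * θ - n := by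
    have := congrArg (algebraMap (𝓞 (imagQuad d)) (imagQuad d)) h.sq
    simpa using this
  have he' : 2 * (c : (imagQuad d)) - t = p * e := by exact_mod_cast congrArg (Int.cast (R := imagQuad d)) he
  have hf' : (c : (imagQuad d)) ^ 2 - t * c + n = p ^ 2 * f := by
    exact_mod_cast congrArg (Int.cast (R := imagQuad d)) hf
  have hint : IsIntegral ℤ (((θ : (imagQuad d)) - c) / p) := by
    refine ⟨Polynomial.X ^ 2 + Polynomial.C e * Polynomial.X + Polynomial.C f, ?_, ?_⟩
    · monicity!
    · simp only [Polynomial.eval₂_add, Polynomial.eval₂_pow, Polynomial.eval₂_X,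
        Polynomial.eval₂_mul, Polynomial.eval₂_C]
      simp only [algebraMap_int_eq, eq_intCast]
      field_simp
      linear_combination hsq - ((θ : (imagQuad d)) - c) * he' - hf'
  obtain ⟨y, hy⟩ := (IsIntegralClosure.isIntegral_iff (A := 𝓞 (imagQuad d))).1 hint
  have hy' : (p : 𝓞 (imagQuad d)) * y = θ - c := by
    apply NumberField.RingOfIntegers.ext
    rw [eq_div_iff hp0] at hy
    simp only [map_mul, map_sub, map_natCast, map_intCast]
    rw [mul_comm]; exact hy
  obtain ⟨a, b, rfl⟩ := h.exists_eq y
  have := (h.independent (p * a + c) (p * b - 1) (by push_cast; linear_combination hy')).2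
  have h2 : (p : ℤ) ∣ 1 := ⟨b, by linarith⟩
  exact hp.one_lt.ne' (by exact_mod_cast Int.eq_one_of_dvd_one (by positivity) h2)

theorem intPoly_dvd_iff {p : ℕ} [Fact p.Prime] (x : ℤ_[p]) (k : ℕ) :
    ∃ c : ℤ, (p : ℤ_[p]) ^ k ∣ x - c := by
  refine ⟨x.appr k, ?_⟩
  rw [← Ideal.mem_span_singleton]
  exact_mod_cast PadicInt.appr_spec k x

theorem padicInt_pow_dvd_intCast {p : ℕ} [Fact p.Prime] (k : ℕ) (a : ℤ) :
    (p : ℤ_[p]) ^ k ∣ a ↔ (p : ℤ) ^ k ∣ a := by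
  rw [← Ideal.mem_span_singleton, ← PadicInt.norm_le_pow_iff_mem_span_pow,
    PadicInt.norm_int_le_pow_iff_dvd]

variable {p : ℕ} [Fact p.Prime]

theorem padicInt_dvd_intCast (a : ℤ) : (p : ℤ_[p]) ∣ a ↔ (p : ℤ) ∣ a := by
  simpa using padicInt_pow_dvd_intCast (p := p) 1 a

theorem isMaximalPoly_intCast (h : ∀ c : ℤ, (p : ℤ) ∣ 2 * c - t → ¬ (p : ℤ) ^ 2 ∣ c ^ 2 - t * c + n) :
    IsMaximalPoly (t : ℤ_[p]) n := by
  intro x h1 h2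
  obtain ⟨c, e, hc⟩ := intPoly_dvd_iff x 2
  apply h c
  · rw [← padicInt_dvd_intCast]
    have := h1.sub (Dvd.intro (2 * (p : ℤ_[p]) * e) rfl)
    convert this using 1
    push_cast
    linear_combination (-2 : ℤ_[p]) * hc
  · rw [← padicInt_pow_dvd_intCast]
    have := h2.sub (Dvd.intro (e * (x + c - t)) rfl)
    convert this using 1
    push_cast
    linear_combination (-(x + c - t) : ℤ_[p]) * hc

theorem isInertPoly_intCast :
    IsInertPoly (t : ℤ_[p]) n ↔ ∀ c : ℤ, ¬ (p : ℤ) ∣ c ^ 2 - t * c + n := by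
  constructor
  · intro h c hc
    apply h c
    rw [← padicInt_dvd_intCast] at hc
    exact_mod_cast hc
  · intro h x hx
    obtain ⟨c, e, hc⟩ := intPoly_dvd_iff x 1
    apply h c
    rw [← padicInt_dvd_intCast]
    have := hx.sub (Dvd.intro (e * (x + c - t)) rfl)
    convert this using 1
    push_cast
    linear_combination (-(x + c - t) : ℤ_[p]) * hc

theorem isSplitPoly_intCast :
    IsSplitPoly (t : ℤ_[p]) n ↔ ∃ c : ℤ, (p : ℤ) ∣ c ^ 2 - t * c + n ∧ ¬ (p : ℤ) ∣ 2 * c - t := by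
  constructor
  · rintro ⟨x, hx, hx2⟩
    obtain ⟨c, e, hc⟩ := intPoly_dvd_iff x 1
    refine ⟨c, ?_, ?_⟩
    · rw [← padicInt_dvd_intCast]
      have := hx.sub (Dvd.intro (e * (x + c - t)) rfl)
      convert this using 1
      push_cast
      linear_combination (-(x + c - t) : ℤ_[p]) * hc
    · rw [← padicInt_dvd_intCast]
      intro h
      apply hx2
      have := h.add (Dvd.intro (2 * e) rfl)
      convert this using 1
      push_cast
      linear_combination (2 : ℤ_[p]) * hc
  · rintro ⟨c, h1, h2⟩
    rw [← padicInt_dvd_intCast] at h1 h2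
    exact ⟨c, by exact_mod_cast h1, by exact_mod_cast h2⟩

theorem IsIntegralGenerator.isSplitAt_iff (h : IsIntegralGenerator t n θ) :
    IsSplitAt d p ↔ IsSplitPoly (t : ℤ_[p]) n := by
  rw [isSplitPoly_intCast]
  exact h.split_iff

theorem IsIntegralGenerator.even_absNorm (h : IsIntegralGenerator t n θ)
    (hi : ∀ c : ℤ, ¬ (p : ℤ) ∣ c ^ 2 - t * c + n) (J : Ideal (𝓞 (imagQuad d)))
    (hJ : Ideal.absNorm J ≠ 0) : Even ((Ideal.absNorm J).factorization p) := by
  have := (Ideal.absNorm_ne_zero_iff J).1 hJ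
  rw [Ideal.absNorm_apply, Submodule.cardQuot_apply]
  exact h.even_card_quotient hi J

end ImaginaryQuadratic
end QuatOrder
end

/-! ### Norms of fractional ideals. -/

noncomputable section
namespace QuatOrder

section Norms

variable {d : ℕ} {t n : ℤ} {θ : 𝓞 (imagQuad d)}

theorem isAbsNormOfIdeal_of_ideal {J : Ideal (𝓞 (imagQuad d))} {m : ℕ} (hm : m ≠ 0)
    (h : Ideal.absNorm J = m) : IsAbsNormOfIdeal d (m : ℚ) := by
  have h1 : FractionalIdeal.absNorm (J : FractionalIdeal (𝓞 (imagQuad d))⁰ (imagQuad d)) = m := by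
    rw [FractionalIdeal.coeIdeal_absNorm, h]
  have h0 : (J : FractionalIdeal (𝓞 (imagQuad d))⁰ (imagQuad d)) ≠ 0 := by
    intro h0
    rw [h0, map_zero] at h1
    exact hm (by exact_mod_cast h1.symm)
  exact ⟨Units.mk0 _ h0, h1⟩

/-- The norm of a fractional ideal is a quotient of norms of two integral ideals, each of even
valuation at an inert prime. -/
theorem IsIntegralGenerator.even_of_isAbsNorm (h : IsIntegralGenerator t n θ) {p : ℕ}
    [Fact p.Prime] (hi : ∀ c : ℤ, ¬ (p : ℤ) ∣ c ^ 2 - t * c + n) {m : ℕ} (hm : m ≠ 0)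
    (hJ : IsAbsNormOfIdeal d (m : ℚ)) : Even (m.factorization p) := by
  obtain ⟨J, hJ⟩ := hJ
  rw [FractionalIdeal.absNorm_eq] at hJ
  generalize (J : FractionalIdeal (𝓞 (imagQuad d))⁰ (imagQuad d)).num = I at hJ
  generalize (J : FractionalIdeal (𝓞 (imagQuad d))⁰ (imagQuad d)).den = D at hJ
  obtain ⟨x, hx⟩ := D
  have hN : ((|Algebra.norm ℤ x| : ℤ) : ℚ) = (Ideal.absNorm (Ideal.span {x}) : ℚ) := by
    rw [Ideal.absNorm_span_singleton, Int.abs_eq_natAbs, Int.cast_natCast]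
  rw [hN] at hJ
  have hx0 : Ideal.absNorm (Ideal.span {x}) ≠ 0 := by
    rw [Ideal.absNorm_span_singleton, Int.natAbs_ne_zero, Algebra.norm_ne_zero_iff]
    exact nonZeroDivisors.ne_zero hx
  rw [div_eq_iff (Nat.cast_ne_zero.2 hx0)] at hJ
  have hJ' : Ideal.absNorm I = m * Ideal.absNorm (Ideal.span {x}) := by exact_mod_cast hJ
  have h1 := h.even_absNorm hi (Ideal.span {x}) hx0
  have h2 := h.even_absNorm hi I (by rw [hJ']; exact mul_ne_zero hm hx0)
  rw [hJ', Nat.factorization_mul hm hx0, Finsupp.add_apply, Nat.even_add] at h2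
  exact h2.2 h1

theorem IsIntegralGenerator.exists_ideal_prime_pow (hd : d ≠ 0) (h : IsIntegralGenerator t n θ)
    {p : ℕ} [Fact p.Prime] {k : ℕ} (hk : (∀ c : ℤ, ¬ (p : ℤ) ∣ c ^ 2 - t * c + n) → Even k) :
    ∃ J : Ideal (𝓞 (imagQuad d)), Ideal.absNorm J = p ^ k := by
  by_cases hi : ∀ c : ℤ, ¬ (p : ℤ) ∣ c ^ 2 - t * c + n
  · obtain ⟨l, rfl⟩ := hk hi
    refine ⟨Ideal.span {(p : 𝓞 (imagQuad d))} ^ l, ?_⟩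
    have h2 := Algebra.norm_algebraMap (S := 𝓞 (imagQuad d)) (p : ℤ)
    rw [NumberField.RingOfIntegers.rank, finrank_imagQuad hd, map_natCast] at h2
    rw [map_pow, Ideal.absNorm_span_singleton, h2, ← two_mul, pow_mul]
    simp
  · push Not at hi
    obtain ⟨c, hc⟩ := hi
    obtain ⟨P, -, hP, -⟩ := h.exists_ideal hc
    exact ⟨P ^ k, by rw [map_pow, Ideal.absNorm_apply, Submodule.cardQuot_apply, hP]⟩

/-- The required ideal is a product over the primes dividing `m`: powers of `(p)` at inert primes,
powers of a prime of norm `p` at the others. -/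
theorem IsIntegralGenerator.isAbsNorm_of_even (hd : d ≠ 0) (h : IsIntegralGenerator t n θ) {m : ℕ}
    (hm : m ≠ 0) (he : ∀ p : ℕ, p.Prime → (∀ c : ℤ, ¬ (p : ℤ) ∣ c ^ 2 - t * c + n) →
      Even (m.factorization p)) : IsAbsNormOfIdeal d (m : ℚ) := by
  have : ∀ p : m.primeFactors, ∃ J : Ideal (𝓞 (imagQuad d)),
      Ideal.absNorm J = p ^ m.factorization p := by
    rintro ⟨p, hp⟩
    have hp' := Nat.prime_of_mem_primeFactors hp
    have := Fact.mk hp'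
    exact h.exists_ideal_prime_pow hd (he p hp')
  choose J hJ using this
  refine isAbsNormOfIdeal_of_ideal (J := ∏ p, J p) hm ?_
  rw [map_prod]
  simp only [hJ]
  rw [Finset.prod_coe_sort m.primeFactors (fun p => p ^ m.factorization p)]
  exact Nat.prod_factorization_pow_eq_self hm

end Norms

/-! ### Copies of `𝔬_p` and roots of the defining polynomial. -/

section Compatible

variable {p : ℕ} [Fact p.Prime]

theorem IsQuadRoot.eval_injective {A : Type*} [Ring A] [Nontrivial A] [Algebra ℚ_[p] A]
    [Algebra ℤ_[p] A] [IsScalarTower ℤ_[p] ℚ_[p] A] {t n : ℤ_[p]} {θ : A} (h : IsQuadRoot t n θ) :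
    Function.Injective h.eval := by
  rw [injective_iff_map_eq_zero]
  intro x hx
  rw [h.eval_apply, ← algebraMap_smul ℚ_[p] x.re, ← algebraMap_smul ℚ_[p] x.im] at hx
  have hz : ∀ z : ℤ_[p], algebraMap ℤ_[p] ℚ_[p] z = 0 → z = 0 := fun z hz => PadicInt.ext hz
  have him : algebraMap ℤ_[p] ℚ_[p] x.im = 0 := by
    by_contra h0
    apply h.not_scalar (-(algebraMap ℤ_[p] ℚ_[p] x.im)⁻¹ * algebraMap ℤ_[p] ℚ_[p] x.re)
    rw [mul_smul, neg_smul, ← smul_neg, ← eq_neg_of_add_eq_zero_right hx, smul_smul,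
      inv_mul_cancel₀ h0, one_smul]
  rw [him, zero_smul, add_zero] at hx
  ext
  · exact hz _ ((smul_eq_zero.1 hx).resolve_right one_ne_zero)
  · exact hz _ him

theorem IsQuadRoot.nonempty_range_equiv {A : Type*} [Ring A] [Nontrivial A] [Algebra ℚ_[p] A]
    [Algebra ℤ_[p] A] [IsScalarTower ℤ_[p] ℚ_[p] A] {t n : ℤ_[p]} {θ : A} (h : IsQuadRoot t n θ) :
    Nonempty (h.eval.range ≃ₐ[ℤ_[p]] QuadOrder t n) :=
  ⟨(AlgEquiv.ofInjective h.eval h.eval_injective).symm⟩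

variable {d : ℕ} {t n : ℤ} {θ : 𝓞 (imagQuad d)}

theorem IsIntegralGenerator.isQuadRoot_locEmb (hd : d ≠ 0) (h : IsIntegralGenerator t n θ) :
    IsQuadRoot (t : ℤ_[p]) n (locEmb p (θ : imagQuad d)) where
  sq := by
    have h1 : (θ : imagQuad d) * θ = t • (θ : imagQuad d) - n • 1 := by
      have := congrArg (algebraMap (𝓞 (imagQuad d)) (imagQuad d)) h.sq
      simpa using this
    rw [← map_mul, h1, map_sub, map_zsmul, map_zsmul, map_one, PadicInt.coe_intCast,
      PadicInt.coe_intCast, Int.cast_smul_eq_zsmul, Int.cast_smul_eq_zsmul]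
  not_scalar c hc := by
    have hli : LinearIndependent ℚ ![(1 : imagQuad d), θ] := by
      rw [← LinearIndependent.iff_fractionRing (R := ℤ), Fintype.linearIndependent_iff]
      intro g hg
      have : ((g 0 : ℤ) : 𝓞 (imagQuad d)) + g 1 * θ = 0 := by
        apply NumberField.RingOfIntegers.ext
        rw [Fin.sum_univ_two] at hg
        simpa using hg
      obtain ⟨h0, h1⟩ := h.independent _ _ this
      intro i
      fin_cases i
      · exact h0
      · exact h1
    let v := basisOfLinearIndependentOfCardEqFinrank hli (by rw [finrank_imagQuad hd]; rfl)
    have hv0 : v 0 = 1 := by simp [v]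
    have hv1 : v 1 = (θ : imagQuad d) := by simp [v]
    have e1 := basis_repr_locEmb (p := p) v (θ : imagQuad d) 1
    have e0 := basis_repr_locEmb (p := p) v 1 1
    have q0 : v.repr 1 1 = 0 := by rw [← hv0, v.repr_self]; simp
    have q1 : v.repr (θ : imagQuad d) 1 = 1 := by rw [← hv1, v.repr_self]; simp
    rw [map_one (locEmb p), q0] at e0
    rw [hc, map_smul, Finsupp.smul_apply, e0, q1] at e1
    simp at e1

theorem IsIntegralGenerator.range_eval (hd : d ≠ 0) (h : IsIntegralGenerator t n θ) :
    (h.isQuadRoot_locEmb (p := p) hd).eval.range =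
      localComponent p (integralClosure ℤ (imagQuad d)) := by
  apply le_antisymm
  · rintro _ ⟨r, rfl⟩
    exact IsQuadRoot.eval_mem _ (locEmb_mem θ.2) r
  · rw [localComponent_le_iff]
    intro x hx
    obtain ⟨a, b, hab⟩ := h.exists_eq ⟨x, hx⟩
    refine ⟨⟨a, b⟩, ?_⟩
    have h1 : x = a • (1 : imagQuad d) + b • (θ : imagQuad d) := by
      have := congrArg (algebraMap (𝓞 (imagQuad d)) (imagQuad d)) hab
      simpa using this
    change IsQuadRoot.eval _ _ = _
    rw [IsQuadRoot.eval_apply, h1, map_add, map_zsmul, map_zsmul, map_one,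
      Int.cast_smul_eq_zsmul, Int.cast_smul_eq_zsmul]

/-- A `ℤ_p`-order contains a copy of `𝔬_p` if and only if it contains a root of the defining
polynomial of `𝔬`. -/
theorem IsIntegralGenerator.exists_subalgebra_iff {A : Type*} [Ring A] [Nontrivial A]
    [Algebra ℚ_[p] A] [Algebra ℤ_[p] A] [IsScalarTower ℤ_[p] ℚ_[p] A]
    (hd : d ≠ 0) (h : IsIntegralGenerator t n θ) (G : Subalgebra ℤ_[p] A) :
    (∃ O : Subalgebra ℤ_[p] A, O ≤ G ∧
        Nonempty (O ≃ₐ[ℤ_[p]] localComponent p (integralClosure ℤ (imagQuad d)))) ↔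
      ∃ θ' ∈ G, IsQuadRoot (t : ℤ_[p]) n θ' := by
  have hr := h.isQuadRoot_locEmb (p := p) hd
  constructor
  · rintro ⟨O, hO, ⟨e⟩⟩
    let θ₀ : localComponent p (integralClosure ℤ (imagQuad d)) := ⟨_, locEmb_mem θ.2⟩
    have hsq : θ₀ * θ₀ = (t : ℤ_[p]) • θ₀ - (n : ℤ_[p]) • 1 := by
      apply Subtype.ext
      refine hr.sq.trans ?_
      rw [AddSubgroupClass.coe_sub, SetLike.val_smul, SetLike.val_smul,
        ← algebraMap_smul ℚ_[p] (t : ℤ_[p]), ← algebraMap_smul ℚ_[p] (n : ℤ_[p])]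
      rfl
    refine ⟨e.symm θ₀, hO (e.symm θ₀).2, ?_, fun c hc => ?_⟩
    · have h1 := congrArg (fun x => ((e.symm x : O) : A)) hsq
      simp only [map_mul, map_sub, map_smul, map_one] at h1
      refine h1.trans ?_
      rw [AddSubgroupClass.coe_sub, SetLike.val_smul, SetLike.val_smul,
        ← algebraMap_smul ℚ_[p] (t : ℤ_[p]), ← algebraMap_smul ℚ_[p] (n : ℤ_[p])]
      rfl
    -- The isomorphism `e` is only `ℤ_p`-linear, so the denominator of the scalar `c` is cleared
    -- before the relation is carried over to `𝔬_p`.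
    · obtain ⟨N, hN⟩ := exists_norm_pow_mul_le (p := p) ‖c‖
      rw [← norm_mul] at hN
      obtain ⟨u, hu⟩ := exists_padicInt_eq hN
      have h1 : (p : ℤ_[p]) ^ N • e.symm θ₀ = u • 1 := by
        apply Subtype.ext
        rw [SetLike.val_smul, SetLike.val_smul, hc, ← algebraMap_smul ℚ_[p] u,
          ← algebraMap_smul ℚ_[p] ((p : ℤ_[p]) ^ N), smul_smul]
        have : algebraMap ℤ_[p] ℚ_[p] ((p : ℤ_[p]) ^ N) * c = algebraMap ℤ_[p] ℚ_[p] u := by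
          refine Eq.trans ?_ hu.symm
          simp
        rw [this]; rfl
      have h2 := congrArg (fun x => ((e x : localComponent p
        (integralClosure ℤ (imagQuad d))) : ℚ_[p] ⊗[ℚ] imagQuad d)) h1
      simp only [map_smul, e.apply_symm_apply, map_one] at h2
      rw [SetLike.val_smul, SetLike.val_smul, ← algebraMap_smul ℚ_[p] u,
          ← algebraMap_smul ℚ_[p] ((p : ℤ_[p]) ^ N)] at h2
      have hpN : algebraMap ℤ_[p] ℚ_[p] ((p : ℤ_[p]) ^ N) ≠ 0 := by
        simp [(Fact.out : p.Prime).ne_zero]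
      apply hr.not_scalar ((algebraMap ℤ_[p] ℚ_[p] ((p : ℤ_[p]) ^ N))⁻¹ *
        algebraMap ℤ_[p] ℚ_[p] u)
      have h3 := congrArg (fun x => (algebraMap ℤ_[p] ℚ_[p] ((p : ℤ_[p]) ^ N))⁻¹ • x) h2
      simp only [smul_smul, inv_mul_cancel₀ hpN, one_smul] at h3
      exact h3
  · rintro ⟨θ', hθ', h'⟩
    refine ⟨h'.eval.range, ?_, ?_⟩
    · rintro _ ⟨r, rfl⟩
      exact h'.eval_mem hθ' r
    · obtain ⟨e⟩ := h'.nonempty_range_equiv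
      obtain ⟨f⟩ := hr.nonempty_range_equiv
      rw [h.range_eval hd] at f
      exact ⟨e.trans f.symm⟩

end Compatible
end QuatOrder
end

/-! ### Ramified primes of `F`. -/

noncomputable section
namespace QuatOrder

section Ramification

open scoped Quaternion

variable {F : Type*} [Ring F] [Algebra ℚ F]

theorem IsQuaternionAlgebra.isPadicQuaternion (hF : IsQuaternionAlgebra ℚ F) (p : ℕ)
    [Fact p.Prime] : IsPadicQuaternion (p := p) (ℚ_[p] ⊗[ℚ] F) := by
  obtain ⟨a, b, ha, hb, ⟨e⟩⟩ := hF.exists_equiv two_ne_zero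
  obtain ⟨f⟩ := baseChange_quaternion_equiv (L := ℚ_[p]) two_ne_zero ha hb e
  exact ⟨_, _, (map_ne_zero _).2 ha, (map_ne_zero _).2 hb, ⟨f⟩⟩

theorem IsPadicQuaternion.nontrivial {p : ℕ} [Fact p.Prime] {A : Type*} [Ring A] [Algebra ℚ_[p] A]
    (hA : IsPadicQuaternion (p := p) A) : Nontrivial A :=
  Module.nontrivial_of_finrank_pos (R := ℚ_[p]) (by rw [hA.finrank_eq]; norm_num)

/-- An order contains two elements whose commutator does not square to zero. -/
theorem IsOrder.exists_commutator_sq_ne_zero (hF : IsQuaternionAlgebra ℚ F) {M : Subalgebra ℤ F}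
    (hM : IsOrder M) : ∃ x ∈ M, ∃ y ∈ M, (x * y - y * x) ^ 2 ≠ 0 := by
  obtain ⟨a, b, ha, hb, ⟨e⟩⟩ := hF.exists_equiv two_ne_zero
  obtain ⟨k, hk, hx⟩ := hM.exists_nsmul_mem (e.symm ⟨0, 1, 0, 0⟩)
  obtain ⟨l, hl, hy⟩ := hM.exists_nsmul_mem (e.symm ⟨0, 0, 1, 0⟩)
  refine ⟨_, hx, _, hy, fun h => ?_⟩
  have h1 := congrArg e h
  simp only [map_pow, map_sub, map_mul, map_nsmul, e.apply_symm_apply, map_zero] at h1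
  have h2 := congrArg QuaternionAlgebra.re h1
  simp [sq, ha, hb] at h2
  rw [mul_comm (l : ℚ), ← two_mul] at h2
  simp [hk, hl] at h2

/-- Fix a commutator in `M` with nonzero square `c`. At a ramified prime the residue ring is
commutative, which makes `c` divisible by `p` in `M_p`; so `p` divides a fixed nonzero integral
coordinate of `c`. -/
theorem finite_ramified (hF : IsQuaternionAlgebra ℚ F) {M : Subalgebra ℤ F}
    (hM : IsMaximalOrder M) : {p : ℕ | ∃ _ : Fact p.Prime, IsRamifiedAt p F}.Finite := by
  obtain ⟨x, hx, y, hy, hc⟩ := hM.prop.exists_commutator_sq_ne_zero hF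
  generalize hcd : (x * y - y * x) ^ 2 = c at hc
  obtain ⟨k, v, hv⟩ := hM.prop.exists_basis
  have hcM : c ∈ M := by
    rw [← hcd]
    exact M.pow_mem (sub_mem (M.mul_mem hx hy) (M.mul_mem hy hx)) 2
  obtain ⟨i, hi⟩ : ∃ i, v.repr c i ≠ 0 := by
    by_contra! h
    exact hc (v.repr.map_eq_zero_iff.1 (Finsupp.ext h))
  obtain ⟨z, hz⟩ := (hv c).1 hcM i
  refine Set.Finite.subset z.natAbs.primeFactors.finite_toSet ?_
  rintro p ⟨hp, hr⟩
  have hz0 : z ≠ 0 := by rintro rfl; exact hi (by simpa using hz)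
  have hpz : (p : ℤ) ∣ z := by
    obtain ⟨a, b, ha, hb, hdiv, e⟩ : ∃ a b : ℚ_[p], a ≠ 0 ∧ b ≠ 0 ∧
        (∀ x : ℍ[ℚ_[p],a,b], x ≠ 0 → IsUnit x) ∧
        Nonempty ((ℚ_[p] ⊗[ℚ] F) ≃ₐ[ℚ_[p]] ℍ[ℚ_[p],a,b]) := by
      obtain ⟨a, b, ha, hb, ⟨e⟩⟩ := hF.isPadicQuaternion p
      refine ⟨a, b, ha, hb, fun x hx => ?_, ⟨e⟩⟩
      have := (hr (e.symm x) (by simpa using hx)).map e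
      simpa using this
    obtain ⟨e⟩ := e
    have hMp := (hM.localComponent (p := p)).mem_iff ha hb hdiv e
    obtain ⟨w, hw, hwc⟩ := commutator_sq_dvd ha hb hdiv ((hMp _).1 (locEmb_mem hx))
      ((hMp _).1 (locEmb_mem hy))
    obtain ⟨c', hc'⟩ := exists_rat_smul_eq (p := p) 1 c
    have hwM : e.symm w ∈ QuatOrder.localComponent p M := by
      rw [hMp, e.apply_symm_apply]; exact hw
    have hcw : locEmb p c' = e.symm w := by
      apply pow_nsmul_injective (N := 1)
      apply e.injective
      rw [← map_nsmul, hc', ← hcd, map_nsmul, e.apply_symm_apply, pow_one,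
        ← Nat.cast_smul_eq_nsmul ℤ_[p]]
      simpa only [sq, map_sub, map_mul] using hwc
    rw [← hcw, hM.prop.locEmb_mem_iff] at hwM
    obtain ⟨s, hs, hsc⟩ := hwM
    obtain ⟨u, hu⟩ := (hv _).1 hsc i
    rw [map_nsmul, Finsupp.smul_apply, nsmul_eq_mul] at hu
    rw [← hc', map_nsmul, Finsupp.smul_apply, nsmul_eq_mul, pow_one] at hz
    have h1 : (s : ℤ) * z = p * u := by
      have : (s : ℚ) * z = p * u := by rw [← hz, ← hu]; ring
      exact_mod_cast this
    exact ((Nat.prime_iff_prime_int.1 hp.out).dvd_or_dvd ⟨u, h1⟩).resolve_left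
      (fun h => hs (by exact_mod_cast h))
  rw [Finset.mem_coe, Nat.mem_primeFactors]
  exact ⟨hp.out, Int.natCast_dvd.1 hpz, Int.natAbs_ne_zero.2 hz0⟩

/-- Finiteness of the ramified set matters here: `finprod` takes the default value `1` on infinite
support. -/
theorem coprime_sigmaK_iff (hF : IsQuaternionAlgebra ℚ F) {M : Subalgebra ℤ F}
    (hM : IsMaximalOrder M) (d l : ℕ) :
    l.Coprime (sigmaK d F) ↔ ∀ p ∈ ramifiedSplitPrimes d F, ¬ p ∣ l := by
  have hfin : (ramifiedSplitPrimes d F).Finite := (finite_ramified hF hM).subset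
    fun p ⟨hp, hr, _⟩ => ⟨hp, hr⟩
  rw [sigmaK, finprod_mem_eq_finite_toFinset_prod _ hfin, Nat.coprime_prod_right_iff]
  simp only [Set.Finite.mem_toFinset]
  refine forall₂_congr fun p hp => ?_
  obtain ⟨hp, -, -⟩ := hp
  rw [Nat.coprime_comm, Nat.Prime.coprime_iff_not_dvd hp.out]

end Ramification

/-! ### The three assertions. -/

section Main

variable {F : Type*} [Ring F] [Algebra ℚ F] {d : ℕ} {t n : ℤ} {θ : 𝓞 (imagQuad d)}

theorem IsCompatible.exists_root (hF : IsQuaternionAlgebra ℚ F) (hd : d ≠ 0)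
    (h : IsIntegralGenerator t n θ) {M G : Subalgebra ℤ F} (hM : IsMaximalOrder M) (hGM : G ≤ M)
    (hG : IsCompatible d G) (p : ℕ) [Fact p.Prime] (hp : p ∣ orderIndex M G) :
    ∃ θ' ∈ localComponent p G, IsQuadRoot (t : ℤ_[p]) n θ' := by
  have := (hF.isPadicQuaternion p).nontrivial
  exact (h.exists_subalgebra_iff hd _).1 (hG.exists_le M hM hGM p hp)

theorem IsIntegralGenerator.isMaximalPoly (h : IsIntegralGenerator t n θ) (p : ℕ) [Fact p.Prime] :
    IsMaximalPoly (t : ℤ_[p]) n :=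
  isMaximalPoly_intCast (h.isMaximal Fact.out)

theorem IsCompatible.coprime_sigmaK (hF : IsQuaternionAlgebra ℚ F) (hd : d ≠ 0)
    (h : IsIntegralGenerator t n θ) {M G : Subalgebra ℤ F} (hM : IsMaximalOrder M) (hGM : G ≤ M)
    (hG : IsCompatible d G) : (orderIndex M G).Coprime (sigmaK d F) := by
  rw [coprime_sigmaK_iff hF hM]
  rintro p ⟨hp, hr, hs⟩ hdvd
  obtain ⟨θ', -, hθ'⟩ := hG.exists_root hF hd h hM hGM p hdvd
  exact (hF.isPadicQuaternion p).not_isSplitPoly hr hθ' (h.isSplitAt_iff.1 hs)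

theorem IsCompatible.isAbsNorm (hF : IsQuaternionAlgebra ℚ F) (hd : d ≠ 0)
    (h : IsIntegralGenerator t n θ) {M G : Subalgebra ℤ F} (hM : IsMaximalOrder M) (hGM : G ≤ M)
    (hG : IsCompatible d G) : IsAbsNormOfIdeal d (orderIndex M G : ℚ) := by
  refine h.isAbsNorm_of_even hd (hM.prop.orderIndex_ne_zero hG.isOrder) fun p hp hi => ?_
  have := Fact.mk hp
  by_cases hdvd : p ∣ orderIndex M G
  · obtain ⟨θ', hθ', hr⟩ := hG.exists_root hF hd h hM hGM p hdvd
    have hidx := padicIndex_localComponent (p := p) hM.prop hG.isOrder hGM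
    have := even_factorization_padicIndex hi (localComponent_mono hGM) hθ' hr (by
      rw [hidx]; exact pow_ne_zero _ hp.ne_zero)
    rwa [hidx, hp.factorization_pow, Finsupp.single_eq_same] at this
  · rw [Nat.factorization_eq_zero_of_not_dvd hdvd]; exact Even.zero

/-- Coprimality to `Σ_k(F)` excludes a split polynomial in a division algebra, so a root exists; the
norm condition supplies the parity needed for the index. At primes not dividing `l` nothing is
changed, which makes gluing possible. -/
theorem exists_localOrder (hF : IsQuaternionAlgebra ℚ F)
    (h : IsIntegralGenerator t n θ) {M : Subalgebra ℤ F} (hM : IsMaximalOrder M) {l : ℕ}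
    (hl : l ≠ 0) (hc : l.Coprime (sigmaK d F)) (hn : IsAbsNormOfIdeal d (l : ℚ)) (p : ℕ)
    [Fact p.Prime] : ∃ (L : Subalgebra ℤ_[p] (ℚ_[p] ⊗[ℚ] F)) (N : ℕ),
      L ≤ localComponent p M ∧ (∀ x ∈ localComponent p M, p ^ N • x ∈ L) ∧
      padicIndex (localComponent p M) L = p ^ l.factorization p ∧
      (p ∣ l → ∃ θ' ∈ L, IsQuadRoot (t : ℤ_[p]) n θ') ∧
      (¬ p ∣ l → N = 0 ∧ L = localComponent p M) := by
  have hA := hF.isPadicQuaternion p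
  have hMp := hM.localComponent (p := p)
  by_cases hp : p ∣ l
  · obtain ⟨θ₀, h1, h2⟩ := hMp.exists_root hA (h.isMaximalPoly p) (fun hdiv hs =>
      (coprime_sigmaK_iff hF hM d l).1 hc p ⟨inferInstance, hdiv, h.isSplitAt_iff.2 hs⟩ hp)
    obtain ⟨L, h3, h4, h5, N, h6⟩ := hMp.exists_suborder hA (h.isMaximalPoly p) h1 h2
      (l.factorization p) (fun hi => h.even_of_isAbsNorm (isInertPoly_intCast.1 hi) hl hn)
    refine ⟨L, N, h3, fun x hx => ?_, h5, fun _ => ⟨θ₀, h4, h2⟩, fun h => absurd hp h⟩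
    have := h6 x hx
    rwa [← Nat.cast_pow, Nat.cast_smul_eq_nsmul] at this
  · refine ⟨_, 0, le_rfl, fun x hx => by simpa using hx, ?_, fun h => absurd h hp,
      fun _ => ⟨rfl, rfl⟩⟩
    rw [Nat.factorization_eq_zero_of_not_dvd hp, pow_zero]
    exact AddSubgroup.relIndex_self _

theorem exists_isCompatible (hF : IsQuaternionAlgebra ℚ F) (hd : d ≠ 0)
    (h : IsIntegralGenerator t n θ) {M : Subalgebra ℤ F} (hM : IsMaximalOrder M) {l : ℕ}
    (hl : l ≠ 0) (hc : l.Coprime (sigmaK d F)) (hn : IsAbsNormOfIdeal d (l : ℚ)) :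
    ∃ G : Subalgebra ℤ F, G ≤ M ∧ IsCompatible d G ∧ orderIndex M G = l := by
  choose L N hLM hN hidx hroot htriv using
    fun (p : ℕ) (hp : Fact p.Prime) => exists_localOrder hF h hM hl hc hn p
  let N' : ℕ → ℕ := fun p => if hp : p.Prime then N p ⟨hp⟩ else 0
  have hN' : ∀ (p : ℕ) (hp : Fact p.Prime), N' p = N p hp := fun p hp => dif_pos hp.out
  let K := ∏ p ∈ l.primeFactors, p ^ N' p
  have hK0 : K ≠ 0 := Finset.prod_ne_zero_iff.2 fun p hp =>
    pow_ne_zero _ (Nat.prime_of_mem_primeFactors hp).ne_zero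
  have hK : ∀ (p : ℕ) [hp : Fact p.Prime], ∀ x ∈ localComponent p M, K • x ∈ L p hp := by
    intro p hp x hx
    by_cases hpl : p ∣ l
    · obtain ⟨e, he⟩ := Finset.dvd_prod_of_mem (fun p => p ^ N' p)
        (Nat.mem_primeFactors.2 ⟨hp.out, hpl, hl⟩)
      have hKe : K = e * p ^ N p hp := by rw [← hN' p hp, mul_comm]; exact he
      rw [hKe, mul_smul]
      exact (Subalgebra.toSubmodule (L p hp)).nsmul_mem (hN p hp x hx) e
    · rw [(htriv p hp hpl).2]
      exact (Subalgebra.toSubmodule (localComponent p M)).nsmul_mem hx K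
  have hord : IsOrder (glue M fun p [hp : Fact p.Prime] => L p hp) := isOrder_glue hM.prop hK0 hK
  have hloc : ∀ (p : ℕ) [hp : Fact p.Prime],
      localComponent p (glue M fun p [hp : Fact p.Prime] => L p hp) = L p hp :=
    fun p hp => localComponent_glue hK0 hK (fun p hp => hLM p hp) p
  refine ⟨_, glue_le, ⟨hord, fun M' hM' hle p hp hdvd => ?_⟩, ?_⟩
  · have := (hF.isPadicQuaternion p).nontrivial
    rw [h.exists_subalgebra_iff hd, hloc p]
    refine hroot p hp ?_
    -- Compatibility refers to every maximal order `M'` above the glued order. If `p ∤ l`, the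
    -- `p`-component is already maximal, so it equals that of `M'` and `p` does not divide the index
    -- in `M'`.
    by_contra hpl
    have h1 := (hM.localComponent (p := p)).eq_of_le (hM'.localComponent (p := p)).prop
      (by rw [← (htriv p hp hpl).2, ← hloc p]; exact localComponent_mono hle)
    have h2 := padicIndex_localComponent (p := p) hM'.prop hord hle
    rw [hloc p, (htriv p hp hpl).2, h1, padicIndex, AddSubgroup.relIndex_self] at h2
    have h3 := hp.out.factorization_pos_of_dvd (hM'.prop.orderIndex_ne_zero hord) hdvd
    exact (Nat.one_lt_pow h3.ne' hp.out.one_lt).ne h2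
  · refine Nat.eq_of_factorization_eq (hM.prop.orderIndex_ne_zero hord) hl fun p => ?_
    by_cases hp : p.Prime
    · have := Fact.mk hp
      have h2 := padicIndex_localComponent (p := p) hM.prop hord glue_le
      rw [hloc p, hidx] at h2
      exact (Nat.pow_right_injective hp.two_le h2).symm
    · rw [Nat.factorization_eq_zero_of_not_prime _ hp, Nat.factorization_eq_zero_of_not_prime _ hp]

theorem IsCompatible.nonempty_algEquiv (hF : IsQuaternionAlgebra ℚ F) (hd : d ≠ 0)
    (h : IsIntegralGenerator t n θ) {M M' G G' : Subalgebra ℤ F} (hG : IsCompatible d G)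
    (hG' : IsCompatible d G') (hM : IsMaximalOrder M) (hGM : G ≤ M) (hM' : IsMaximalOrder M')
    (hGM' : G' ≤ M') (hi : orderIndex M G = orderIndex M' G') (p : ℕ) [Fact p.Prime] :
    Nonempty (localComponent p G ≃ₐ[ℤ_[p]] localComponent p G') := by
  have hA := hF.isPadicQuaternion p
  by_cases hdvd : p ∣ orderIndex M G
  · obtain ⟨θ₁, h1, h2⟩ := hG.exists_root hF hd h hM hGM p hdvd
    obtain ⟨θ₂, h3, h4⟩ := hG'.exists_root hF hd h hM' hGM' p (hi ▸ hdvd)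
    have h5 := padicIndex_localComponent (p := p) hM.prop hG.isOrder hGM
    have h6 := padicIndex_localComponent (p := p) hM'.prop hG'.isOrder hGM'
    obtain ⟨σ, hσ⟩ := hM.localComponent.exists_equiv_of_padicIndex_eq hA (h.isMaximalPoly p)
      (localComponent_mono hGM) h1 h2 hM'.localComponent (localComponent_mono hGM') h3 h4
      (by rw [h5, h6, hi]) (by rw [h5]; exact pow_ne_zero _ (Fact.out : p.Prime).ne_zero)
    exact nonempty_algEquiv_of_mem_iff σ hσ
  · rw [localComponent_eq_of_not_dvd hGM hdvd, localComponent_eq_of_not_dvd hGM' (hi ▸ hdvd)]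
    obtain ⟨σ, hσ⟩ := hM.localComponent.exists_equiv hA (hM'.localComponent (p := p))
    exact nonempty_algEquiv_of_mem_iff σ hσ

end Main
end QuatOrder
end

theorem mainTheorem8 (d : ℕ) (hd : Squarefree d)
    {F : Type*} [Ring F] [Algebra ℚ F] (hF : QuatOrder.IsQuaternionAlgebra ℚ F)
    (M : Subalgebra ℤ F) (hM : QuatOrder.IsMaximalOrder M) :
    (∀ G : Subalgebra ℤ F, G ≤ M → QuatOrder.IsCompatible d G →
      (QuatOrder.orderIndex M G).Coprime (QuatOrder.sigmaK d F) ∧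
      QuatOrder.IsAbsNormOfIdeal d (QuatOrder.orderIndex M G : ℚ)) ∧
    (∀ l : ℕ, 0 < l → l.Coprime (QuatOrder.sigmaK d F) → QuatOrder.IsAbsNormOfIdeal d (l : ℚ) →
      ∃ G : Subalgebra ℤ F, G ≤ M ∧ QuatOrder.IsCompatible d G ∧
        QuatOrder.orderIndex M G = l) ∧
    (∀ G G' M₁ M₂ : Subalgebra ℤ F,
      QuatOrder.IsCompatible d G → QuatOrder.IsCompatible d G' →
      QuatOrder.IsMaximalOrder M₁ → G ≤ M₁ → QuatOrder.IsMaximalOrder M₂ → G' ≤ M₂ →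
      QuatOrder.orderIndex M₁ G = QuatOrder.orderIndex M₂ G' →
      ∀ (p : ℕ) [Fact p.Prime],
        Nonempty (QuatOrder.localComponent p G ≃ₐ[ℤ_[p]] QuatOrder.localComponent p G')) := by
  have hd0 := hd.ne_zero
  obtain ⟨t, n, θ, h⟩ := QuatOrder.exists_generator_ringOfIntegers hd0
  exact ⟨fun G hGM hG => ⟨hG.coprime_sigmaK hF hd0 h hM hGM, hG.isAbsNorm hF hd0 h hM hGM⟩,
    fun l hl hc hn => QuatOrder.exists_isCompatible hF hd0 h hM hl.ne' hc hn,
    fun G G' M₁ M₂ hG hG' hM₁ hGM hM₂ hGM' hi p _ =>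
      hG.nonempty_algEquiv hF hd0 h hG' hM₁ hGM hM₂ hGM' hi p⟩
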